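/- Consider the spatial three-body problem with a star of mass $\bar m_0>0$ and two planets of masses $\mu\bar m_1,\mu\bar m_2$ ($\mu,\bar m_1,\bar m_2>0$), and put $M_i=\bar m_0+\mu\bar m_i$, $m_i=\bar m_0\bar m_i/(\bar m_0+\mu\bar m_i)$. Use the RPS (regular, planetary, symplectic) coordinates $(\Lambda,\lambda,\bar z)$, $\Lambda=(\Lambda_1,\Lambda_2)\in(0,\infty)^2$, $\lambda=(\lambda_1,\lambda_2)\in\mathbb T^2$ (with $\mathbb T=\mathbb R/2\pi\mathbb Z$), $\bar z=(\eta_1,\eta_2,\xi_1,\xi_2,p_1,q_1)\in\mathbb R^6$, the cyclic pair $(p_2,q_2)$ being fixed at $(0,0)$ (that is, the total angular momentum ${\rm C}$ is directed along the third axis). Here $$\lambda_i=\ell_i+\gamma_i+\psi,\qquad \eta_i+{\rm i}\xi_i=\sqrt{2(\Lambda_i-\Gamma_i)}\,e^{-{\rm i}(\gamma_i+\psi)},\qquad p_1+{\rm i}q_1=\sqrt{2(\Gamma_1+\Gamma_2-G)}\,e^{-{\rm i}\psi},$$ where the $i$-th planet moves instantaneously on a Keplerian ellipse with semi-major axis $a_i=\frac1{M_i}\big(\frac{\Lambda_i}{m_i}\big)^2$,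 eccentricity $e_i=\sqrt{1-(\Gamma_i/\Lambda_i)^2}$ and mean anomaly $\ell_i$; $\Gamma_i=|{\rm C}^{(i)}|$ is the length of its angular momentum, $G=|{\rm C}|=|{\rm C}^{(1)}+{\rm C}^{(2)}|$, $\gamma_i$ is the argument of its perihelion measured from the node ${\rm C}^{(1)}\times{\rm C}^{(2)}$, and $\psi$ is the longitude of this node. The coordinates are defined for $\Gamma_i=\Lambda_i-\frac{\eta_i^2+\xi_i^2}2>0$ and $\frac{p_1^2+q_1^2}2<2\min(\Gamma_1,\Gamma_2)$ (eccentricities in $[0,1)$, mutual inclination in $[0,\pi)$). Let $x^{(i)}(\Lambda,\lambda_i,\bar z)\in\mathbb R^3$ be the position of the $i$-th planet and $$f_{12}^{(k)}(\Lambda,\bar z)=\frac1{k!}\frac{d^k}{d\varepsilon^k}\bigg[\frac1{(2\pi)^2}\int_{\mathbb T^2}\frac{d\lambda_1\,d\lambda_2}{|\varepsilon x^{(1)}(\Lambda,\lambda_1,\bar z)-x^{(2)}(\Lambda,\lambda_2,\bar z)|}\bigg]_{\varepsilon=0},\qquad N=-\bar m_1\bar m_2\big(f_{12}^{(0)}+f_{12}^{(2)}\big).$$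 Then $f_{12}^{(2)}$ and $N$ are integrable, in the following sense. (i) On the whole domain of the coordinates, $f_{12}^{(2)}$ and $N$ depend on $(\eta_2,\xi_2)$ only through $\frac{\eta_2^2+\xi_2^2}2$. (ii) Let $0<a_-<a_+$, $0<\alpha<1$ and $\mathcal A=\{\Lambda\in(0,\infty)^2:\ a_-<a_1<\alpha a_2<a_+\}$. There are $\varepsilon_0>0$ such that $\mathcal A\times B^6_{\varepsilon_0}$, with $B^6_{\varepsilon_0}=\{|\bar z|<\varepsilon_0\}$, lies in the domain of the coordinates, and a real-analytic change of variables of $\mathcal A\times\mathbb T^2\times B^6_{\varepsilon_0}$ onto itself of the form $$\Lambda=\Lambda,\qquad \lambda=\breve\lambda+\varphi(\Lambda,\breve z),\qquad \bar z=\breve{\mathcal Z}(\Lambda,\breve z),$$ which is symplectic, i.e. preserves $\sum_{i=1}^2 d\Lambda_i\wedge d\lambda_i+\sum_{i=1}^2d\eta_i\wedge d\xi_i+dp_1\wedge dq_1$, and such that $f_{12}^{(2)}(\Lambda,\breve{\mathcal Z}(\Lambda,\breve z))$ and $\breve N(\Lambda,\breve z)=N(\Lambda,\breve{\mathcal Z}(\Lambda,\breve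 z))$ are functions of $\Lambda$ and of $\frac{\breve\eta_1^2+\breve\xi_1^2}2$, $\frac{\breve\eta_2^2+\breve\xi_2^2}2$, $\frac{\breve p_1^2+\breve q_1^2}2$ only. Moreover this change of variables preserves $\frac{\eta_2^2+\xi_2^2}2$ and $\frac{\eta_1^2+\xi_1^2}2+\frac{p_1^2+q_1^2}2$: $$\frac{\eta_2^2+\xi_2^2}2=\frac{\breve\eta_2^2+\breve\xi_2^2}2,\qquad \frac{\eta_1^2+\xi_1^2}2+\frac{p_1^2+q_1^2}2=\frac{\breve\eta_1^2+\breve\xi_1^2}2+\frac{\breve p_1^2+\breve q_1^2}2 .$$ -/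

import Mathlib

open Real Set

noncomputable section

namespace SpatialThreeBody

/-- The masses of the spatial three-body problem: a star of mass `m0` and two planets of masses
`μ * mbar 0`, `μ * mbar 1` (planets are indexed by `0, 1`, the inner one being `0`). -/
structure Masses where
  m0 : ℝ
  mbar : Fin 2 → ℝ
  μ : ℝ
  m0_pos : 0 < m0
  mbar_pos : ∀ i, 0 < mbar i
  μ_pos : 0 < μ

/-- The auxiliary masses `M_i` of the heliocentric two-body Hamiltonians
`|y|² / (2 m_i) - m_i M_i / |x|`. -/
def Masses.M (D : Masses) (i : Fin 2) : ℝ := D.m0 + D.μ * D.mbar i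

/-- The auxiliary (reduced) masses `m_i`. -/
def Masses.m (D : Masses) (i : Fin 2) : ℝ := D.m0 * D.mbar i / (D.m0 + D.μ * D.mbar i)

/-- The secular variables `z = (η₁, η₂, ξ₁, ξ₂, p₁, q₁)`, with the Euclidean norm. The cyclic pair
`(p₂, q₂)` is fixed at `(0, 0)`, that is, the total angular momentum is directed along the third
axis. -/
abbrev Secular := EuclideanSpace ℝ (Fin 6)

def eta (z : Secular) (i : Fin 2) : ℝ := ![z 0, z 1] i
def xi (z : Secular) (i : Fin 2) : ℝ := ![z 2, z 3] i
def pInc (z : Secular) : ℝ := z 4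
def qInc (z : Secular) : ℝ := z 5

/-- The action `(η_i² + ξ_i²) / 2`. -/
def tEcc (z : Secular) (i : Fin 2) : ℝ := (eta z i ^ 2 + xi z i ^ 2) / 2

/-- The action `(p₁² + q₁²) / 2`. -/
def tInc (z : Secular) : ℝ := (pInc z ^ 2 + qInc z ^ 2) / 2

/-! ### The RPS (regular, planetary, symplectic) coordinates

The variables are related to the Deprit variables `(Λ, Γ, Ψ, ℓ, γ, ψ)` by
`λ_i = ℓ_i + γ_i + ψ₁ + ψ₂`,
`η_i + √-1 ξ_i = √(2 (Λ_i - Γ_i)) exp (-√-1 (γ_i + ψ₁ + ψ₂))`,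
`p₁ + √-1 q₁ = √(2 (Γ₁ + Γ₂ - Ψ₁)) exp (-√-1 (ψ₁ + ψ₂))`, where
`Γ_i = |C⁽ⁱ⁾|` and `Ψ₁ = |C|`, `C = C⁽¹⁾ + C⁽²⁾`, are the lengths of the angular momenta, `ℓ_i` is
the mean anomaly, `γ_i` the argument of the perihelion from the node `C⁽¹⁾ × C⁽²⁾` in the plane of
the `i`-th orbit and `ψ₁ + ψ₂` (for `C` along the third axis) the longitude of this node. -/

/-- The length `Γ_i` of the angular momentum of planet `i`. -/
def Gam (Λ : Fin 2 → ℝ) (z : Secular) (i : Fin 2) : ℝ := Λ i - tEcc z i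

/-- The length `G` of the total angular momentum. -/
def Gtot (Λ : Fin 2 → ℝ) (z : Secular) : ℝ := Gam Λ z 0 + Gam Λ z 1 - tInc z

/-- The domain of the coordinates (for any values of the angles `λ`): `Λ_i > 0`, eccentricities in
`[0, 1)` and mutual inclination in `[0, π)`. -/
def RPSDomain (Λ : Fin 2 → ℝ) (z : Secular) : Prop :=
  ∀ i, 0 < Λ i ∧ 0 < Gam Λ z i ∧ tInc z < 2 * Gam Λ z i

/-- The semi-major axis `a_i`. -/
def semiAxis (D : Masses) (Λ : Fin 2 → ℝ) (i : Fin 2) : ℝ := 1 / D.M i * (Λ i / D.m i) ^ 2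

/-- The eccentricity `e_i`, which is `√(1 - (Γ_i / Λ_i)²)`. -/
def ecc (Λ : Fin 2 → ℝ) (z : Secular) (i : Fin 2) : ℝ :=
  √((eta z i ^ 2 + xi z i ^ 2) / Λ i - ((eta z i ^ 2 + xi z i ^ 2) / (2 * Λ i)) ^ 2)

/-- The longitude `γ_i + ψ₁ + ψ₂` of the perihelion. For a circular orbit this angle is arbitrary
and has no influence on the position below. -/
def periLong (z : Secular) (i : Fin 2) : ℝ := -Complex.arg ⟨eta z i, xi z i⟩

/-- The longitude `ψ₁ + ψ₂` of the node `C⁽¹⁾ × C⁽²⁾`. For zero mutual inclination this angle is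
arbitrary and has no influence on the position below. -/
def nodeLong (z : Secular) : ℝ := -Complex.arg ⟨pInc z, qInc z⟩

/-- The inclination of the `i`-th orbital plane with respect to the plane orthogonal to `C`,
as an oriented angle about the node `C⁽¹⁾ × C⁽²⁾`; by `C = C⁽¹⁾ + C⁽²⁾` and the law of cosines. -/
def incl (Λ : Fin 2 → ℝ) (z : Secular) (i : Fin 2) : ℝ :=
  ![-1, 1] i * arccos ((Gtot Λ z ^ 2 + Gam Λ z i ^ 2 - Gam Λ z (1 - i) ^ 2) /
    (2 * Gtot Λ z * Gam Λ z i))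

/-- The eccentric anomaly: the solution `ζ` of Kepler's equation `ζ - e sin ζ = ℓ`
(unique for `0 ≤ e < 1`). -/
def eccAnomaly (e ℓ : ℝ) : ℝ := Function.invFun (fun ζ : ℝ => ζ - e * sin ζ) ℓ

def rot1 (t : ℝ) : Matrix (Fin 3) (Fin 3) ℝ :=
  !![1, 0, 0; 0, cos t, -sin t; 0, sin t, cos t]

def rot3 (t : ℝ) : Matrix (Fin 3) (Fin 3) ℝ :=
  !![cos t, -sin t, 0; sin t, cos t, 0; 0, 0, 1]

/-- Position on a Keplerian ellipse with semi-major axis `a`, eccentricity `e` and mean anomaly `ℓ`,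
focus at the origin, perihelion along the first axis, angular momentum along the third. -/
def keplerPos (a e ℓ : ℝ) : Fin 3 → ℝ :=
  ![a * (cos (eccAnomaly e ℓ) - e), a * √(1 - e ^ 2) * sin (eccAnomaly e ℓ), 0]

/-- The position `x⁽ⁱ⁾(Λ, λ_i, z)` of planet `i`, where `l` is the value of `λ_i`. -/
def position (D : Masses) (Λ : Fin 2 → ℝ) (z : Secular) (i : Fin 2) (l : ℝ) :
    EuclideanSpace ℝ (Fin 3) :=
  WithLp.toLp 2 ((rot3 (nodeLong z) * rot1 (incl Λ z i) * rot3 (periLong z i - nodeLong z)).mulVec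
    (keplerPos (semiAxis D Λ i) (ecc Λ z i) (l - periLong z i)))

/-! ### The secular perturbing function -/

/-- The double average of `1 / |ε x⁽¹⁾ - x⁽²⁾|` over the mean longitudes. -/
def doubleAverage (D : Masses) (Λ : Fin 2 → ℝ) (z : Secular) (ε : ℝ) : ℝ :=
  1 / (2 * π) ^ 2 * ∫ l₁ in (0 : ℝ)..2 * π, ∫ l₂ in (0 : ℝ)..2 * π,
    1 / ‖ε • position D Λ z 0 l₁ - position D Λ z 1 l₂‖

/-- The `k`-th term `f₁₂⁽ᵏ⁾` of the expansion of the averaged direct perturbing function in powers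
of the semi-major axes ratio. -/
def f12 (k : ℕ) (D : Masses) (Λ : Fin 2 → ℝ) (z : Secular) : ℝ :=
  1 / (k.factorial : ℝ) * iteratedDeriv k (doubleAverage D Λ z) 0

/-- `N = -m̄₁ m̄₂ (f₁₂⁽⁰⁾ + f₁₂⁽²⁾)`. -/
def secularN (D : Masses) (Λ : Fin 2 → ℝ) (z : Secular) : ℝ :=
  -(D.mbar 0 * D.mbar 1) * (f12 0 D Λ z + f12 2 D Λ z)

/-! ### The phase space -/

/-- Points `(Λ, λ, z)`; the angles `λ ∈ 𝕋²` are represented by their lifts to `ℝ²`. -/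
abbrev Phase := (Fin 2 → ℝ) × (Fin 2 → ℝ) × Secular

/-- The set `𝒜` of the `Λ` with `a₋ < a₁ < α a₂ < a₊`. -/
def actionDomain (D : Masses) (am ap α : ℝ) : Set (Fin 2 → ℝ) :=
  {Λ | (∀ i, 0 < Λ i) ∧ am < semiAxis D Λ 0 ∧ semiAxis D Λ 0 < α * semiAxis D Λ 1 ∧
    α * semiAxis D Λ 1 < ap}

/-- The phase space `A × 𝕋² × B_ε` (lifted to `A × ℝ² × B_ε`). -/
def phaseSpace (A : Set (Fin 2 → ℝ)) (ε : ℝ) : Set Phase :=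
  A ×ˢ (univ ×ˢ Metric.ball (0 : Secular) ε)

/-- The two-form `∑ dΛ_i ∧ dλ_i + ∑ dη_i ∧ dξ_i + dp₁ ∧ dq₁`. -/
def symplForm (u v : Phase) : ℝ :=
  (∑ i, (u.1 i * v.2.1 i - u.2.1 i * v.1 i)) +
  (∑ i, (eta u.2.2 i * xi v.2.2 i - xi u.2.2 i * eta v.2.2 i)) +
  (pInc u.2.2 * qInc v.2.2 - qInc u.2.2 * pInc v.2.2)

/-- `Φ` is differentiable on `S` and preserves the two-form there. -/
def IsSymplecticOn (Φ : Phase → Phase) (S : Set Phase) : Prop :=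
  ∀ P ∈ S, DifferentiableAt ℝ Φ P ∧
    ∀ u v : Phase, symplForm (fderiv ℝ Φ P u) (fderiv ℝ Φ P v) = symplForm u v

/-- The map `(Λ, λ, z) ↦ (Λ, λ + φ(Λ, z), Z(Λ, z))`. -/
def liftMap (φ : (Fin 2 → ℝ) × Secular → (Fin 2 → ℝ)) (Z : (Fin 2 → ℝ) × Secular → Secular)
    (P : Phase) : Phase :=
  (P.1, P.2.1 + φ (P.1, P.2.2), Z (P.1, P.2.2))

end SpatialThreeBody

end

open SpatialThreeBody

/-! ### Analytic dependence of integrals on parameters, and analytic inverses of norm preserving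
families -/

section AnalyticTools

open Filter Topology MeasureTheory
open scoped NNReal ENNReal

variable {P E F : Type*} [NormedAddCommGroup P] [NormedSpace ℝ P]
  [NormedAddCommGroup E] [NormedSpace ℝ E] [NormedAddCommGroup F] [NormedSpace ℝ F]

/-! Write x₀ = η₁ + iξ₁, x₁ = p₁ + iq₁, x₂ = η₂ + iξ₂, let t₁, t, t₂ be the actions |x_j|²/2 of x₀,
x₁, x₂, and put J = t₁ + t, X + iY = x₀ conj x₁.

The quadrupole term. Its integrand is the second Legendre term of 1/|x⁽¹⁾ - x⁽²⁾|. In the average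
over the outer planet, r⁻³ dℓ is proportional to (1 + e cos v) dv, v being the true anomaly, so the
averages of cos 2v / r³ and sin 2v / r³ vanish (`integral_quadrupole_eq_zero`) and the outer
perihelion disappears. This gives (i): `f12_two_eq` writes the quadrupole term as a factor depending
on Λ and t₂ times `shape`, a function of Λ, t₁, t, t₂ and Y². The term of order zero depends on Λ
and t₂ only (`f12_zero_eq`).

Normal form without the symplectic structure. `shape` is invariant under the simultaneous rotations
of x₀ and x₁ and under those of x₂, so that J and t₂ are integrals and one degree of freedom is
left. Since 4 t₁ t = X² + Y², `shape` equals base + slope · (t₁ + m X² + n Y²), where base and slope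
depend on Λ, J, t₂ only (`shape_eq`), and slope is not zero at the origin (`slope_zero_pos`). The
map M given by `actionShear` is explicit and analytic, commutes with these rotations, preserves J
and t₂, and its first action is t₁ + m X² + n Y². In general it is not symplectic.

Symplectic correction. Let θ = ½ ∑ (x dy - y dx) and let N be the inverse of M. The average T of the
form N*θ over the circles of the first plane is an action variable; T and J - T are analytic
multiples of t₁ and t. A rescaling of each plane by the square roots of these quotients, followed by
suitable rotations, is a map Φ with Φ*θ = N*θ + dS + γ dΛ (`exists_symplectic_rescaling`). Hence W =
Φ ∘ M satisfies W*θ = θ + dS + γ dΛ, with another S and γ, and the dΛ part is absorbed by a shift of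
λ (`symplForm_fderiv_lift`). Near the origin (T, J, t₂) determine the actions
(`exists_act_eq_of_newAction_eq`), so the first action of M is a function of Λ and of the actions of
W. Therefore `shape` depends only on Λ and on the new actions; no convergence of a formal normal
form has to be studied.

All maps preserve J and t₂, hence |z|² = 2 (J + t₂), so balls go onto themselves; and Λ stays in a
compact box, which makes the radius uniform. -/

theorem FormalMultilinearSeries.exists_summable_bound_changeOrigin
    (p : FormalMultilinearSeries ℝ E F) {ρ : ℝ≥0} (hρ : (ρ + ρ : ℝ≥0∞) < p.radius) :
    ∃ C : ℕ → ℝ≥0, (Summable fun k => C k * ρ ^ k) ∧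
      ∀ x : E, ‖x‖₊ ≤ ρ → ∀ k, ‖p.changeOrigin x k‖₊ ≤ C k := by
  have hρp' : (ρ : ℝ≥0∞) < p.radius := lt_of_le_of_lt le_self_add hρ
  refine ⟨fun k => ∑' s : Σ l : ℕ, { s : Finset (Fin (k + l)) // s.card = l },
    ‖p (k + s.1)‖₊ * ρ ^ s.1, ?_, fun x hx k => ?_⟩
  · simpa only [← NNReal.tsum_mul_right] using
      (NNReal.summable_sigma.1 (p.changeOriginSeries_summable_aux₁ hρ)).2
  · have h1 : (‖x‖₊ : ℝ≥0∞) < p.radius := lt_of_le_of_lt (by exact_mod_cast hx) hρp'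
    refine (p.nnnorm_changeOrigin_le k h1).trans ?_
    refine Summable.tsum_le_tsum (fun x => ?_) (p.changeOriginSeries_summable_aux₂ h1 k)
      (p.changeOriginSeries_summable_aux₂ hρp' k)
    gcongr

/-- A function analytic at `(s₀, x₀)` is, for `s` near `s₀`, the sum of a power series in the second
variable, with coefficients depending continuously on `s` and uniformly bounded. -/
theorem AnalyticAt.exists_partial_power_series [CompleteSpace F] {f : ℝ × E → F} {s₀ : ℝ} {x₀ : E}
    (hf : AnalyticAt ℝ f (s₀, x₀)) :
    ∃ (ρ : ℝ≥0) (C : ℕ → ℝ≥0) (T : (n : ℕ) → ℝ → ContinuousMultilinearMap ℝ (fun _ : Fin n => E) F),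
      0 < ρ ∧ (Summable fun k => C k * ρ ^ k) ∧
      (∀ s ∈ Metric.ball s₀ (ρ : ℝ), ∀ n, ‖T n s‖ ≤ C n) ∧
      (∀ n, ContinuousOn (T n) (Metric.ball s₀ (ρ : ℝ))) ∧
      ∀ s ∈ Metric.ball s₀ (ρ : ℝ), ∀ y : E, ‖y‖ ≤ ρ →
        HasSum (fun n => T n s fun _ => y) (f (s, x₀ + y)) := by
  obtain ⟨p, r, hp⟩ := hf
  -- Twice ρ leaves room for two displacements of size at most ρ: first s - s₀, which moves the
  -- centre of the expansion, then y.
  obtain ⟨ρ, hρ0, hρ⟩ : ∃ ρ : ℝ≥0, 0 < ρ ∧ ((ρ + ρ : ℝ≥0) : ℝ≥0∞) < r := by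
    obtain ⟨t, ht0, ht⟩ := ENNReal.lt_iff_exists_nnreal_btwn.1 hp.r_pos
    refine ⟨t / 2, ?_, ?_⟩
    · exact half_pos (by exact_mod_cast ht0)
    · rwa [add_halves]
  have hρp : (ρ + ρ : ℝ≥0∞) < p.radius := by
    refine lt_of_lt_of_le ?_ hp.r_le
    simpa using hρ
  have hρp' : (ρ : ℝ≥0∞) < p.radius := lt_of_le_of_lt le_self_add hρp
  obtain ⟨C, hCsum, hC⟩ := p.exists_summable_bound_changeOrigin hρp
  set ι : ℝ → ℝ × E := fun s => (s - s₀, 0) with hι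
  have hιn : ∀ s ∈ Metric.ball s₀ (ρ : ℝ), ‖ι s‖₊ ≤ ρ := by
    intro s hs
    rw [Metric.mem_ball, Real.dist_eq] at hs
    rw [← NNReal.coe_le_coe]
    simp [hι, hs.le]
  have hCb : ∀ s ∈ Metric.ball s₀ (ρ : ℝ), ∀ k, ‖p.changeOrigin (ι s) k‖₊ ≤ C k :=
    fun s hs k => hC _ (hιn s hs) k
  set T : (n : ℕ) → ℝ → ContinuousMultilinearMap ℝ (fun _ : Fin n => E) F := fun n s =>
    (p.changeOrigin (ι s) n).compContinuousLinearMap (fun _ => ContinuousLinearMap.inr ℝ ℝ E) with hT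
  have hTb : ∀ s ∈ Metric.ball s₀ (ρ : ℝ), ∀ n, ‖T n s‖ ≤ C n := by
    intro s hs n
    refine (ContinuousMultilinearMap.norm_compContinuousLinearMap_le _ _).trans ?_
    have h1 : ‖p.changeOrigin (ι s) n‖ ≤ C n := by exact_mod_cast hCb s hs n
    have h2 : ∏ _i : Fin n, ‖ContinuousLinearMap.inr ℝ ℝ E‖ ≤ 1 :=
      Finset.prod_le_one (fun _ _ => norm_nonneg _) (fun _ _ =>
        ContinuousLinearMap.norm_inr_le_one ℝ ℝ E)
    calc _ ≤ (C n : ℝ) * 1 := by gcongr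
      _ = _ := mul_one _
  have hTc : ∀ n, ContinuousOn (T n) (Metric.ball s₀ (ρ : ℝ)) := by
    intro n
    have h1 := (p.hasFPowerSeriesOnBall_changeOrigin n (hρp'.bot_lt)).continuousOn
    have h2 : ContinuousOn (fun s => p.changeOrigin (ι s) n) (Metric.ball s₀ (ρ : ℝ)) := by
      refine h1.comp (by fun_prop) ?_
      intro s hs
      rw [Metric.mem_eball, edist_zero_right]
      exact lt_of_le_of_lt (by exact_mod_cast hιn s hs) hρp'
    exact (ContinuousMultilinearMap.compContinuousLinearMapL
      (fun _ : Fin n => ContinuousLinearMap.inr ℝ ℝ E)).continuous.comp_continuousOn h2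
  refine ⟨ρ, C, T, hρ0, hCsum, hTb, hTc, fun s hs y hy' => ?_⟩
  have h1 : (‖ι s‖₊ : ℝ≥0∞) ≤ ρ := by exact_mod_cast hιn s hs
  have h2 := hp.changeOrigin (y := ι s) (lt_of_le_of_lt h1 (lt_of_le_of_lt
    (by exact_mod_cast le_self_add) hρ))
  have h3 := h2.hasSum (y := (0, y)) (by
    rw [Metric.mem_eball, edist_zero_right, lt_tsub_iff_left]
    refine lt_of_le_of_lt ?_ hρ
    have : ‖((0 : ℝ), y)‖ₑ ≤ ρ := by
      have h4 : ‖((0 : ℝ), y)‖₊ ≤ ρ := by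
        rw [← NNReal.coe_le_coe]; simpa [Prod.norm_def] using hy'
      exact_mod_cast h4
    push_cast
    gcongr)
  have h4 : (s₀, x₀) + ι s + (0, y) = (s, x₀ + y) := by simp [hι]
  rw [h4] at h3
  simpa [hT] using h3

/-- Local version of the analyticity of integrals depending on a parameter. -/
theorem AnalyticAt.exists_ball_intervalIntegral [CompleteSpace F] {f : ℝ × E → F} {s₀ : ℝ} {x₀ : E}
    (hf : AnalyticAt ℝ f (s₀, x₀)) :
    ∃ δ > 0, ∀ a ∈ Metric.ball s₀ δ, ∀ b ∈ Metric.ball s₀ δ,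
      AnalyticAt ℝ (fun x => ∫ s in a..b, f (s, x)) x₀ := by
  obtain ⟨ρ, C, T, hρ0, hCsum, hTb, hTc, hsum⟩ := hf.exists_partial_power_series
  refine ⟨ρ, by exact_mod_cast hρ0, fun a ha b hb => ?_⟩
  have hsub : uIcc a b ⊆ Metric.ball s₀ (ρ : ℝ) := by
    rw [Real.ball_eq_Ioo] at ha hb ⊢
    exact OrdConnected.uIcc_subset ordConnected_Ioo ha hb
  have hTi : ∀ n, IntervalIntegrable (T n) volume a b := fun n =>
    ((hTc n).mono hsub).intervalIntegrable
  refine ⟨fun n => ∫ s in a..b, T n s, ρ, ?_⟩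
  refine ⟨?_, by exact_mod_cast hρ0, ?_⟩
  · obtain ⟨B, hB⟩ : ∃ B : ℝ≥0, ∀ n, C n * ρ ^ n ≤ B :=
      ⟨∑' n, C n * ρ ^ n, fun n => hCsum.le_tsum n (fun _ _ => zero_le)⟩
    refine FormalMultilinearSeries.le_radius_of_bound _ (B * |b - a|) fun n => ?_
    have h1 : ‖∫ s in a..b, T n s‖ ≤ C n * |b - a| :=
      intervalIntegral.norm_integral_le_of_norm_le_const fun s hs =>
        hTb s (hsub (uIoc_subset_uIcc hs)) n
    have h2 : (C n : ℝ) * (ρ : ℝ) ^ n ≤ B := by exact_mod_cast hB n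
    calc ‖∫ s in a..b, T n s‖ * (ρ : ℝ) ^ n ≤ C n * |b - a| * (ρ : ℝ) ^ n := by gcongr
      _ = (C n : ℝ) * (ρ : ℝ) ^ n * |b - a| := by ring
      _ ≤ _ := by gcongr
  · intro y hy
    rw [Metric.mem_eball, edist_zero_right] at hy
    have hy' : ‖y‖ ≤ ρ := by
      have : ‖y‖₊ < ρ := by exact_mod_cast hy
      exact_mod_cast this.le
    have happ : ∀ n, (∫ s in a..b, T n s) (fun _ => y) = ∫ s in a..b, T n s fun _ => y := fun n =>
      ((ContinuousMultilinearMap.apply ℝ (fun _ : Fin n => E) F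
        (fun _ => y)).intervalIntegral_comp_comm (hTi n)).symm
    simp only [happ]
    have hIoc : ∀ {s}, s ∈ uIoc a b → s ∈ Metric.ball s₀ (ρ : ℝ) :=
      fun hs => hsub (uIoc_subset_uIcc hs)
    have hs' : Summable fun n => (C n * ρ ^ n : ℝ) := by exact_mod_cast hCsum
    refine intervalIntegral.hasSum_integral_of_dominated_convergence
      (fun n _ => (C n * ρ ^ n : ℝ)) (fun n => ?_) (fun n => ?_) ?_ ?_ ?_
    · have h1 : ContinuousOn (fun s => T n s fun _ => y) (uIcc a b) :=
        (ContinuousMultilinearMap.apply ℝ (fun _ : Fin n => E) F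
          (fun _ => y)).continuous.comp_continuousOn ((hTc n).mono hsub)
      exact (h1.mono uIoc_subset_uIcc).aestronglyMeasurable measurableSet_uIoc
    · refine Eventually.of_forall fun s hs => ?_
      refine ((T n s).le_opNorm _).trans ?_
      rw [Finset.prod_const, Finset.card_univ, Fintype.card_fin]
      gcongr
      exact hTb s (hIoc hs) n
    · exact Eventually.of_forall fun s _ => hs'
    · exact intervalIntegrable_const
    · exact Eventually.of_forall fun s hs => hsum s (hIoc hs) y hy'

/-- An integral depending analytically on a parameter. -/
theorem analyticAt_intervalIntegral [CompleteSpace F] {f : ℝ × E → F} {a b : ℝ} (hab : a ≤ b) {x₀ : E}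
    (hf : ∀ s ∈ Icc a b, AnalyticAt ℝ f (s, x₀)) :
    AnalyticAt ℝ (fun x => ∫ s in a..b, f (s, x)) x₀ := by
  choose! δ hδ0 hδ using fun s hs => (hf s hs).exists_ball_intervalIntegral
  -- The local version only covers short intervals around each s; by compactness finitely many of
  -- them subdivide the interval of integration.
  obtain ⟨t, ht0, htm, ⟨n, hn⟩, ht⟩ := exists_monotone_Icc_subset_open_cover_Icc hab
    (c := fun s : Icc a b => ((↑) : Icc a b → ℝ) ⁻¹' Metric.ball (s : ℝ) (δ s))
    (fun _ => Metric.isOpen_ball.preimage continuous_subtype_val)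
    (fun s _ => mem_iUnion.2 ⟨s, Metric.mem_ball_self (hδ0 s s.2)⟩)
  obtain ⟨U, V, -, hV, hU, hxV, hUV⟩ := generalized_tube_lemma (isCompact_Icc (a := a) (b := b))
    (isCompact_singleton (x := x₀)) (isOpen_analyticAt ℝ f) (by
      rintro ⟨s, x⟩ ⟨hs, hx⟩
      rw [mem_singleton_iff] at hx
      subst hx
      exact hf s hs)
  have hcont : ∀ x ∈ V, ContinuousOn (fun s => f (s, x)) (Icc a b) := fun x hx s hs =>
    (ContinuousAt.comp (f := fun s => (s, x)) (hUV (mk_mem_prod (hU hs) hx)).continuousAt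
      (by fun_prop)).continuousWithinAt
  have hsum : (fun x => ∑ k ∈ Finset.range n, ∫ s in (t k : ℝ)..(t (k + 1) : ℝ), f (s, x))
      =ᶠ[𝓝 x₀] fun x => ∫ s in a..b, f (s, x) := by
    filter_upwards [hV.mem_nhds (hxV rfl)] with x hx
    have := intervalIntegral.sum_integral_adjacent_intervals (μ := volume) (f := fun s => f (s, x))
      (a := fun k => (t k : ℝ)) (n := n) (fun k _ => ((hcont x hx).mono ?_).intervalIntegrable)
    · rw [this, ht0, hn n le_rfl]
    · rw [uIcc_of_le (show (t k : ℝ) ≤ t (k + 1) from htm (Nat.le_succ k))]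
      exact Icc_subset_Icc (t k).2.1 (t (k + 1)).2.2
  refine AnalyticAt.congr (Finset.analyticAt_fun_sum _ fun k _ => ?_) hsum
  obtain ⟨s, hs⟩ := ht k
  exact hδ s s.2 _ (hs (left_mem_Icc.2 (htm (Nat.le_succ k)))) _
    (hs (right_mem_Icc.2 (htm (Nat.le_succ k))))

/-- A property that holds near every point of `C × {0}`, `C` compact, holds on a neighbourhood of
`C` times a ball. -/
theorem exists_tube_of_eventually {P E : Type*} [TopologicalSpace P] [SeminormedAddCommGroup E]
    {C : Set P} (hC : IsCompact C) {p : P × E → Prop}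
    (hp : ∀ c ∈ C, ∀ᶠ q in 𝓝 (c, (0 : E)), p q) :
    ∃ (Ω : Set P) (ε : ℝ), IsOpen Ω ∧ C ⊆ Ω ∧ 0 < ε ∧ ∀ q ∈ Ω ×ˢ Metric.ball (0 : E) ε, p q := by
  obtain ⟨U, V, hU, hV, hCU, hxV, hUV⟩ := generalized_tube_lemma hC
    (isCompact_singleton (x := (0 : E))) (n := interior {q | p q}) isOpen_interior (by
      rintro ⟨s, x⟩ ⟨hs, hx⟩
      rw [mem_singleton_iff] at hx
      subst hx
      exact mem_interior_iff_mem_nhds.2 (hp s hs))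
  obtain ⟨ε, hε, hεV⟩ := Metric.isOpen_iff.1 hV 0 (hxV rfl)
  exact ⟨U, ε, hU, hCU, hε, fun q hq => interior_subset (hUV ⟨hq.1, hεV hq.2⟩)⟩

theorem eventually_of_mem_tube {P E : Type*} [TopologicalSpace P] [SeminormedAddCommGroup E]
    {C Ω : Set P} {ε : ℝ} (hΩ : IsOpen Ω) (hCΩ : C ⊆ Ω) (hε : 0 < ε)
    {p : P × E → Prop} (hp : ∀ q ∈ Ω ×ˢ Metric.ball (0 : E) ε, p q) {c : P} (hc : c ∈ C) :
    ∀ᶠ q in 𝓝 (c, (0 : E)), p q :=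
  Filter.mem_of_superset ((hΩ.prod Metric.isOpen_ball).mem_nhds
    ⟨hCΩ hc, Metric.mem_ball_self hε⟩) hp

/-- The derivative at the origin of a norm preserving family is norm preserving. -/
theorem norm_fderiv_of_norm_preserving {M : P × E → E} {p₀ : P} (hM : DifferentiableAt ℝ M (p₀, 0))
    (hn : ∀ᶠ q in 𝓝 (p₀, (0 : E)), ‖M q‖ = ‖q.2‖) (v : E) : ‖fderiv ℝ M (p₀, 0) (0, v)‖ = ‖v‖ := by
  have hM0 : M (p₀, 0) = 0 := by simpa using hn.self_of_nhds
  have hline : HasDerivAt (fun r : ℝ => ((p₀, r • v) : P × E)) (0, v) 0 := by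
    have h2 : HasDerivAt (fun r : ℝ => r • v) v 0 := by
      simpa using (hasDerivAt_id (0 : ℝ)).smul_const v
    exact (hasDerivAt_const 0 p₀).prodMk h2
  have hd : HasDerivAt (fun r : ℝ => M (p₀, r • v)) (fderiv ℝ M (p₀, 0) (0, v)) 0 := by
    have h1 : HasFDerivAt M (fderiv ℝ M (p₀, 0)) (p₀, (0 : ℝ) • v) := by
      simpa using hM.hasFDerivAt
    exact h1.comp_hasDerivAt (0 : ℝ) hline
  have h3 : Tendsto (fun r : ℝ => ‖r⁻¹ • M (p₀, r • v)‖) (𝓝[≠] 0)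
      (𝓝 ‖fderiv ℝ M (p₀, 0) (0, v)‖) := by
    have := (hasDerivAt_iff_tendsto_slope_zero.1 hd).norm
    simpa [hM0] using this
  refine tendsto_nhds_unique h3 ?_
  have hc : Tendsto (fun r : ℝ => ((p₀, r • v) : P × E)) (𝓝[≠] 0) (𝓝 (p₀, 0)) := by
    have := hline.continuousAt.tendsto
    simp only [zero_smul] at this
    exact this.mono_left nhdsWithin_le_nhds
  refine tendsto_const_nhds.congr' ?_
  filter_upwards [hc.eventually hn, self_mem_nhdsWithin] with r hr hr0
  rw [norm_smul, hr, norm_smul, norm_inv, inv_mul_cancel_left₀ (norm_ne_zero_iff.2 hr0)]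

/-- A norm preserving analytic family of maps is invertible near the origin, and the inverse is
analytic. -/
theorem exists_analytic_inverse_of_norm_preserving [FiniteDimensional ℝ P] [FiniteDimensional ℝ E]
    {C : Set P} (hC : IsCompact C) {M : P × E → E} (hM : ∀ p ∈ C, AnalyticAt ℝ M (p, 0))
    (hn : ∀ p ∈ C, ∀ᶠ q in 𝓝 (p, (0 : E)), ‖M q‖ = ‖q.2‖) :
    ∃ (Ω : Set P) (ε : ℝ) (N : P × E → E), IsOpen Ω ∧ C ⊆ Ω ∧ 0 < ε ∧
      ∀ q ∈ Ω ×ˢ Metric.ball (0 : E) ε, AnalyticAt ℝ M q ∧ AnalyticAt ℝ N q ∧ ‖M q‖ = ‖q.2‖ ∧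
        ‖N q‖ = ‖q.2‖ ∧ N (q.1, M q) = q.2 ∧ M (q.1, N q) = q.2 := by
  classical
  -- One globally defined candidate, picked by the norm condition; on each small neighbourhood it
  -- turns out to be the local inverse, so there is nothing to glue.
  set N : P × E → E := fun q =>
    if h : ∃ x, ‖x‖ = ‖q.2‖ ∧ M (q.1, x) = q.2 then h.choose else 0 with hN
  suffices h : ∀ p ∈ C, ∀ᶠ q in 𝓝 (p, (0 : E)), AnalyticAt ℝ M q ∧ AnalyticAt ℝ N q ∧
      ‖M q‖ = ‖q.2‖ ∧ ‖N q‖ = ‖q.2‖ ∧ N (q.1, M q) = q.2 ∧ M (q.1, N q) = q.2 by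
    obtain ⟨Ω, ε, h1, h2, h3, h4⟩ := exists_tube_of_eventually hC h
    exact ⟨Ω, ε, N, h1, h2, h3, h4⟩
  intro p hp
  have hp0 : M (p, 0) = 0 := by simpa using (hn p hp).self_of_nhds
  set G : P × E → P × E := fun q => (q.1, M q) with hG
  have hGa : AnalyticAt ℝ G (p, 0) := analyticAt_fst.prod (hM p hp)
  have hG0 : G (p, 0) = (p, 0) := by simp [hG, hp0]
  have hder : HasStrictFDerivAt G ((ContinuousLinearMap.fst ℝ P E).prod (fderiv ℝ M (p, 0)))
      (p, 0) := hasStrictFDerivAt_fst.prodMk (hM p hp).hasStrictFDerivAt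
  have hinj : Function.Injective
      ((ContinuousLinearMap.fst ℝ P E).prod (fderiv ℝ M (p, 0)) : P × E →ₗ[ℝ] P × E) := by
    rw [injective_iff_map_eq_zero]
    rintro ⟨a, v⟩ hv
    simp only [ContinuousLinearMap.coe_coe, ContinuousLinearMap.prod_apply, Prod.mk_eq_zero,
      ContinuousLinearMap.coe_fst'] at hv
    obtain ⟨rfl, hv⟩ := hv
    -- The derivative at the origin preserves norms, which is the injectivity that the inverse
    -- function theorem needs in finite dimension.
    have := norm_fderiv_of_norm_preserving (hM p hp).differentiableAt (hn p hp) v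
    rw [hv, norm_zero] at this
    rw [norm_eq_zero.1 this.symm]
    rfl
  set e : (P × E) ≃L[ℝ] (P × E) :=
    (LinearEquiv.ofInjectiveEndo _ hinj).toContinuousLinearEquiv with he
  have hder' : HasStrictFDerivAt G (e : P × E →L[ℝ] P × E) (p, 0) := by
    convert hder using 1
    ext x <;> rfl
  set φ := hder'.toOpenPartialHomeomorph G with hφ
  have hφG : (φ : P × E → P × E) = G := hder'.toOpenPartialHomeomorph_coe
  have hsrc : ((p, 0) : P × E) ∈ φ.source := hder'.mem_toOpenPartialHomeomorph_source
  have htgt : ((p, 0) : P × E) ∈ φ.target := by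
    have := φ.map_source hsrc
    rwa [hφG, hG0] at this
  have hsymm0 : φ.symm (p, 0) = (p, 0) := by
    conv_lhs => rw [← hG0, ← hφG]
    exact φ.left_inv hsrc
  have hsa : AnalyticAt ℝ φ.symm (p, 0) := by
    have h1 : AnalyticAt ℝ φ (p, 0) := by rw [hφG]; exact hGa
    have h2 : HasFDerivAt φ (e : P × E →L[ℝ] P × E) (p, 0) := by
      rw [hφG]; exact hder'.hasFDerivAt
    have := φ.analyticAt_symm' (i := e) hsrc h1 h2.fderiv
    rwa [hφG, hG0] at this
  have hfst : ∀ q ∈ φ.target, (φ.symm q).1 = q.1 := fun q hq => by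
    have := φ.right_inv hq
    have h := congrArg Prod.fst this
    rwa [hφG] at h
  have hsnd : ∀ q ∈ φ.target, M (q.1, (φ.symm q).2) = q.2 := fun q hq => by
    have := φ.right_inv hq
    have h := congrArg Prod.snd this
    rw [hφG] at h
    rw [← hfst q hq]
    exact h
  obtain ⟨δ, hδ, hδs⟩ := Metric.mem_nhds_iff.1 (φ.open_source.mem_nhds hsrc)
  have hmem : ∀ a x, dist a p < δ → ‖x‖ < δ → (a, x) ∈ φ.source := fun a x ha hx => hδs (by
    rw [Metric.mem_ball, Prod.dist_eq, max_lt_iff, dist_zero_right]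
    exact ⟨ha, hx⟩)
  -- near `(p, 0)` the inverse is the second component of the local inverse
  have key : ∀ᶠ q in 𝓝 (p, (0 : E)), N q = (φ.symm q).2 ∧ ‖N q‖ = ‖q.2‖ ∧ M (q.1, N q) = q.2 := by
    have hs1 : ∀ᶠ q in 𝓝 (p, (0 : E)), ‖M (φ.symm q)‖ = ‖(φ.symm q).2‖ := by
      have := hsa.continuousAt.tendsto
      rw [hsymm0] at this
      exact this.eventually (hn p hp)
    have hb : ∀ᶠ q in 𝓝 (p, (0 : E)), q ∈ Metric.ball ((p, 0) : P × E) δ :=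
      Metric.ball_mem_nhds _ hδ
    filter_upwards [φ.open_target.mem_nhds htgt, hs1, hb] with q hq hq1 hq2
    rw [Metric.mem_ball, Prod.dist_eq, max_lt_iff, dist_zero_right] at hq2
    have hM1 : M (φ.symm q) = q.2 := by
      have := hsnd q hq
      rwa [← hfst q hq] at this
    have hex : ∃ x, ‖x‖ = ‖q.2‖ ∧ M (q.1, x) = q.2 :=
      ⟨(φ.symm q).2, by rw [← hq1, hM1], hsnd q hq⟩
    have hNq : N q = hex.choose := dif_pos hex
    have hc := hex.choose_spec
    rw [← hNq] at hc
    refine ⟨?_, hc⟩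
    -- The norm condition keeps the chosen preimage in the domain of injectivity of `φ`, so it can
    -- only be the local inverse.
    have h1 : (q.1, N q) ∈ φ.source := hmem _ _ hq2.1 (hc.1.trans_lt hq2.2)
    have h2 : φ (q.1, N q) = q := by
      rw [hφG]; exact Prod.ext rfl hc.2
    rw [← h2, φ.left_inv h1, h2]
  have hNa : AnalyticAt ℝ N (p, 0) := by
    refine AnalyticAt.congr (f := fun q => (φ.symm q).2) ?_ ?_
    · exact (analyticAt_snd (p := φ.symm (p, 0))).comp hsa
    · filter_upwards [key] with q hq using hq.1.symm
  have hG' : Tendsto G (𝓝 (p, 0)) (𝓝 (p, 0)) := by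
    have := hGa.continuousAt.tendsto
    rwa [hG0] at this
  filter_upwards [(hM p hp).eventually_analyticAt, hNa.eventually_analyticAt, hn p hp, key,
    hG'.eventually key, φ.open_source.mem_nhds hsrc] with q h1 h2 h3 h4 h5 h6
  refine ⟨h1, h2, h3, h4.2.1, ?_, h4.2.2⟩
  have := h5.1
  rw [← hφG, φ.left_inv h6, hφG] at this
  exact this

end AnalyticTools

/-! ### The torus action on ℂ³, its generators and the symplectic form -/

section TorusAction

open Filter Topology MeasureTheory

/-- The space `ℂ³`, as a real vector space with the Euclidean norm. -/
abbrev C3 := EuclideanSpace ℂ (Fin 3)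

namespace C3

noncomputable section

/-- The inclusion of the `j`-th coordinate plane. -/
def sng (j : Fin 3) : ℂ →L[ℝ] C3 :=
  LinearMap.toContinuousLinearMap
    { toFun := fun v => WithLp.toLp 2 (Pi.single j v)
      map_add' := fun v w => by rw [Pi.single_add]; rfl
      map_smul' := fun r v => by rw [Pi.single_smul]; rfl }

/-- The `j`-th coordinate. -/
def crd (j : Fin 3) : C3 →L[ℝ] ℂ :=
  LinearMap.toContinuousLinearMap
    { toFun := fun x => x j
      map_add' := fun _ _ => rfl
      map_smul' := fun _ _ => rfl }

def reC (j : Fin 3) : C3 →L[ℝ] ℝ := Complex.reCLM.comp (crd j)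
def imC (j : Fin 3) : C3 →L[ℝ] ℝ := Complex.imCLM.comp (crd j)

/-- Multiplication by a complex number in each coordinate. -/
def diag (c : Fin 3 → ℂ) : C3 →L[ℝ] C3 :=
  LinearMap.toContinuousLinearMap
    { toFun := fun x => WithLp.toLp 2 (fun j => c j * x j)
      map_add' := fun x y => by ext j; simp [mul_add]
      map_smul' := fun r x => by ext j; simp [mul_left_comm] }

/-- The action of the torus by rotations of the coordinate planes. -/
def tor (s : Fin 3 → ℝ) : C3 →L[ℝ] C3 := diag fun j => Complex.exp (s j * Complex.I)

/-- The generators of the torus action. -/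
def gen (d : Fin 3 → ℝ) : C3 →L[ℝ] C3 := diag fun j => d j * Complex.I

/-- The direction of the rotations of the first coordinate plane. -/
def dir0 : Fin 3 → ℝ := Pi.single 0 1

/-- The direction of the simultaneous rotations of the first two coordinate planes. -/
def dir01 : Fin 3 → ℝ := ![1, 1, 0]

/-- The direction of the rotations of the last coordinate plane. -/
def dir2 : Fin 3 → ℝ := Pi.single 2 1

/-- The actions `|x_j|² / 2`. -/
def act (x : C3) (j : Fin 3) : ℝ := ((x j).re ^ 2 + (x j).im ^ 2) / 2

/-- The standard symplectic form. -/
def om : C3 →L[ℝ] C3 →L[ℝ] ℝ :=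
  ∑ j, ((reC j).smulRight (imC j) - (imC j).smulRight (reC j))

@[simp] theorem reC_apply (j : Fin 3) (x : C3) : reC j x = (x j).re := rfl
@[simp] theorem imC_apply (j : Fin 3) (x : C3) : imC j x = (x j).im := rfl
@[simp] theorem diag_apply (c : Fin 3 → ℂ) (x : C3) (j : Fin 3) : diag c x j = c j * x j := rfl
theorem tor_apply (s : Fin 3 → ℝ) (x : C3) (j : Fin 3) :
    tor s x j = Complex.exp (s j * Complex.I) * x j := rfl
theorem gen_apply (s : Fin 3 → ℝ) (x : C3) (j : Fin 3) : gen s x j = s j * Complex.I * x j := rfl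
@[simp] theorem sng_same (j : Fin 3) (v : ℂ) : sng j v j = v := by simp [sng]
theorem sng_of_ne {i j : Fin 3} (h : i ≠ j) (v : ℂ) : sng j v i = 0 := by simp [sng, h]

theorem om_apply (x y : C3) : om x y = ∑ j, ((x j).re * (y j).im - (x j).im * (y j).re) := by
  simp [om]

theorem om_swap (x y : C3) : om x y = -om y x := by
  rw [om_apply, om_apply, ← Finset.sum_neg_distrib]
  exact Finset.sum_congr rfl fun j _ => by ring

theorem norm_sq_eq_act (x : C3) : ‖x‖ ^ 2 = 2 * ∑ j, act x j := by
  rw [EuclideanSpace.norm_sq_eq, Finset.mul_sum]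
  refine Finset.sum_congr rfl fun j _ => ?_
  rw [← Complex.normSq_eq_norm_sq, Complex.normSq_apply, act]
  ring

theorem norm_eq_of_act_sum_eq {x y : C3} (h : ∑ j, act x j = ∑ j, act y j) : ‖x‖ = ‖y‖ := by
  rw [← sq_eq_sq₀ (norm_nonneg _) (norm_nonneg _), norm_sq_eq_act, norm_sq_eq_act, h]

theorem norm_le_of_act_le {x y : C3} (h : ∀ j, act x j ≤ act y j) : ‖x‖ ≤ ‖y‖ := by
  rw [← sq_le_sq₀ (norm_nonneg _) (norm_nonneg _), norm_sq_eq_act, norm_sq_eq_act]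
  have := Finset.sum_le_sum fun j (_ : j ∈ Finset.univ) => h j
  linarith

theorem act_eq_norm (x : C3) (j : Fin 3) : act x j = ‖x j‖ ^ 2 / 2 := by
  rw [act, ← Complex.normSq_eq_norm_sq, Complex.normSq_apply]; ring

theorem act_tor (s : Fin 3 → ℝ) (x : C3) (j : Fin 3) : act (tor s x) j = act x j := by
  rw [act_eq_norm, act_eq_norm, tor_apply, norm_mul, Complex.norm_exp_ofReal_mul_I, one_mul]

@[simp] theorem norm_tor (s : Fin 3 → ℝ) (x : C3) : ‖tor s x‖ = ‖x‖ :=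
  norm_eq_of_act_sum_eq (Finset.sum_congr rfl fun j _ => act_tor s x j)

theorem tor_add (s t : Fin 3 → ℝ) (x : C3) : tor (s + t) x = tor s (tor t x) := by
  ext j
  simp only [tor_apply, Pi.add_apply, Complex.ofReal_add, add_mul, Complex.exp_add]
  ring

@[simp] theorem tor_zero (x : C3) : tor 0 x = x := by
  ext j; simp [tor_apply]

theorem tor_two_pi (j : Fin 3) (x : C3) : tor ((2 * π) • Pi.single j (1 : ℝ)) x = x := by
  ext i
  rw [tor_apply]
  by_cases h : i = j
  · subst h
    simp [Complex.exp_two_pi_mul_I]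
  · simp [h]

theorem tor_two_pi_dir0 (x : C3) : tor ((2 * π) • dir0) x = x := tor_two_pi 0 x

theorem gen_tor (d s : Fin 3 → ℝ) (x : C3) : gen d (tor s x) = tor s (gen d x) := by
  ext j; simp only [gen_apply, tor_apply]; ring

theorem gen_single (j : Fin 3) (x : C3) :
    gen (Pi.single j 1) x = sng j (Complex.I * x j) := by
  ext i
  rw [gen_apply]
  by_cases h : i = j
  · subst h; simp
  · simp [h, sng_of_ne h]

theorem om_tor (s : Fin 3 → ℝ) (x y : C3) : om (tor s x) (tor s y) = om x y := by
  rw [om_apply, om_apply]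
  refine Finset.sum_congr rfl fun j _ => ?_
  simp only [tor_apply, Complex.mul_re, Complex.mul_im, Complex.exp_ofReal_mul_I_re,
    Complex.exp_ofReal_mul_I_im]
  linear_combination ((x j).re * (y j).im - (x j).im * (y j).re) * Real.sin_sq_add_cos_sq (s j)

/-- The standard primitive is ½ `om x`, so this computes the momentum map of the torus action. -/
theorem om_gen (d : Fin 3 → ℝ) (x : C3) : om x (gen d x) = 2 * ∑ j, d j * act x j := by
  rw [om_apply, Finset.mul_sum]
  refine Finset.sum_congr rfl fun j _ => ?_
  simp [gen_apply, act]
  ring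

theorem hasDerivAt_tor (d : Fin 3 → ℝ) (x : C3) (r : ℝ) :
    HasDerivAt (fun r : ℝ => tor (r • d) x) (gen d (tor (r • d) x)) r := by
  have h : ∀ r : ℝ, tor (r • d) x = ∑ j, sng j (Complex.exp ((r • d) j * Complex.I) * x j) := by
    intro r
    ext i
    simp only [WithLp.ofLp_sum, Finset.sum_apply]
    rw [Finset.sum_eq_single i (fun j _ hj => sng_of_ne hj.symm _) (by simp), sng_same, tor_apply]
  have h' : gen d (tor (r • d) x) =
      ∑ j, sng j (Complex.exp ((r • d) j * Complex.I) * (d j * Complex.I) * x j) := by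
    ext i
    simp only [WithLp.ofLp_sum, Finset.sum_apply]
    rw [Finset.sum_eq_single i (fun j _ hj => sng_of_ne hj.symm _) (by simp), sng_same, gen_apply,
      tor_apply]
    ring
  rw [h', funext h]
  refine HasDerivAt.fun_sum fun j _ => ?_
  refine (sng j).hasFDerivAt.comp_hasDerivAt r ?_
  refine HasDerivAt.mul_const ?_ _
  refine HasDerivAt.cexp ?_
  refine HasDerivAt.mul_const ?_ _
  have h1 : HasDerivAt (fun r : ℝ => r * d j) (d j) r := by
    simpa using (hasDerivAt_id r).mul_const (d j)
  exact h1.ofReal_comp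

theorem eq_sum_sng (x : C3) : x = ∑ j, sng j (x j) := by
  ext i
  simp only [WithLp.ofLp_sum, Finset.sum_apply]
  rw [Finset.sum_eq_single i (fun j _ hj => sng_of_ne hj.symm _) (by simp), sng_same]

theorem sng_eq (j : Fin 3) (v : ℂ) : sng j v = v.re • sng j 1 + v.im • sng j Complex.I := by
  rw [← map_smul, ← map_smul, ← map_add]
  congr 1
  simp [Complex.re_add_im]

section Analytic

variable {E F G : Type*} [NormedAddCommGroup E] [NormedSpace ℝ E] [NormedAddCommGroup F]
  [NormedSpace ℝ F] [NormedAddCommGroup G] [NormedSpace ℝ G]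

theorem analyticAt_iff_coords {f : E → C3} {q : E} :
    AnalyticAt ℝ f q ↔ ∀ j, AnalyticAt ℝ (fun q => (f q j).re) q ∧
      AnalyticAt ℝ (fun q => (f q j).im) q := by
  refine ⟨fun h j => ⟨(reC j).analyticAt _ |>.comp h, (imC j).analyticAt _ |>.comp h⟩, fun h => ?_⟩
  have h' : f = fun q => ∑ j, ((f q j).re • sng j 1 + (f q j).im • sng j Complex.I) := by
    funext q
    conv_lhs => rw [eq_sum_sng (f q)]
    exact Finset.sum_congr rfl fun j _ => sng_eq j _
  rw [h']
  exact Finset.analyticAt_fun_sum _ fun j _ =>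
    ((h j).1.smul analyticAt_const).add ((h j).2.smul analyticAt_const)

theorem _root_.AnalyticAt.re_coord {f : E → C3} {q : E} (h : AnalyticAt ℝ f q) (j : Fin 3) :
    AnalyticAt ℝ (fun q => (f q j).re) q := (analyticAt_iff_coords.1 h j).1

theorem _root_.AnalyticAt.im_coord {f : E → C3} {q : E} (h : AnalyticAt ℝ f q) (j : Fin 3) :
    AnalyticAt ℝ (fun q => (f q j).im) q := (analyticAt_iff_coords.1 h j).2

theorem _root_.AnalyticAt.act_coord {f : E → C3} {q : E} (h : AnalyticAt ℝ f q) (j : Fin 3) :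
    AnalyticAt ℝ (fun q => act (f q) j) q := by
  have h1 := h.re_coord j
  have h2 := h.im_coord j
  unfold act
  exact ((h1.pow 2).add (h2.pow 2)).div_const

theorem _root_.AnalyticAt.clm_bilin (L : E →L[ℝ] F →L[ℝ] G) {H : Type*} [NormedAddCommGroup H]
    [NormedSpace ℝ H] {f : H → E} {g : H → F} {q : H} (hf : AnalyticAt ℝ f q)
    (hg : AnalyticAt ℝ g q) : AnalyticAt ℝ (fun q => L (f q) (g q)) q :=
  AnalyticAt.comp (g := fun p : E × F => L p.1 p.2) (f := fun q => (f q, g q))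
    (L.analyticAt_bilinear (f q, g q)) (hf.prod hg)

theorem _root_.AnalyticAt.clm_comp_fun {H : Type*} [NormedAddCommGroup H]
    [NormedSpace ℝ H] {f : H → F →L[ℝ] G} {g : H → E →L[ℝ] F} {q : H} (hf : AnalyticAt ℝ f q)
    (hg : AnalyticAt ℝ g q) : AnalyticAt ℝ (fun q => (f q).comp (g q)) q :=
  AnalyticAt.clm_bilin (ContinuousLinearMap.compL ℝ E F G) hf hg

theorem _root_.AnalyticAt.clm_apply_fun {H : Type*} [NormedAddCommGroup H]
    [NormedSpace ℝ H] {f : H → F →L[ℝ] G} {g : H → F} {q : H} (hf : AnalyticAt ℝ f q)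
    (hg : AnalyticAt ℝ g q) : AnalyticAt ℝ (fun q => f q (g q)) q :=
  AnalyticAt.clm_bilin (ContinuousLinearMap.id ℝ (F →L[ℝ] G)) hf hg

theorem analyticAt_tor (d : Fin 3 → ℝ) {f : E → ℝ} {g : E → C3} {q : E} (hf : AnalyticAt ℝ f q)
    (hg : AnalyticAt ℝ g q) : AnalyticAt ℝ (fun q => tor (f q • d) (g q)) q := by
  refine analyticAt_iff_coords.2 fun j => ?_
  have h1 : AnalyticAt ℝ (fun q => Real.cos (f q * d j)) q :=
    Real.analyticAt_cos.comp (hf.mul analyticAt_const)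
  have h2 : AnalyticAt ℝ (fun q => Real.sin (f q * d j)) q :=
    Real.analyticAt_sin.comp (hf.mul analyticAt_const)
  simp only [tor_apply, Complex.mul_re, Complex.mul_im, Complex.exp_ofReal_mul_I_re,
    Complex.exp_ofReal_mul_I_im, Pi.smul_apply, smul_eq_mul]
  exact ⟨(h1.mul (hg.re_coord j)).sub (h2.mul (hg.im_coord j)),
    (h1.mul (hg.im_coord j)).add (h2.mul (hg.re_coord j))⟩

end Analytic

end

end C3

end TorusAction

/-! ### Division lemmas of Hadamard type for torus invariant functions and forms -/

section Hadamard

open Filter Topology MeasureTheory C3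

variable {P : Type*} [NormedAddCommGroup P] {Ω : Set P} {ε : ℝ}

/-- Identities obtained by cancelling a coordinate are extended by continuity to the points where
this coordinate vanishes. -/
theorem eq_of_eq_along_line {F G : P × C3 → ℝ} {q : P × C3} (hF : ContinuousAt F q)
    (hG : ContinuousAt G q) (v : C3)
    (h : ∀ᶠ r in 𝓝[≠] (0 : ℝ), F (q.1, q.2 + r • v) = G (q.1, q.2 + r • v)) : F q = G q := by
  have hl : Tendsto (fun r : ℝ => ((q.1, q.2 + r • v) : P × C3)) (𝓝[≠] 0) (𝓝 q) := by
    have : ContinuousAt (fun r : ℝ => ((q.1, q.2 + r • v) : P × C3)) 0 := by fun_prop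
    have h2 := this.tendsto
    simp only [zero_smul, add_zero] at h2
    exact h2.mono_left nhdsWithin_le_nhds
  exact tendsto_nhds_unique ((hF.tendsto.comp hl).congr' h) (hG.tendsto.comp hl)

theorem eventually_mem_tube_along_line (hΩ : IsOpen Ω) {q : P × C3}
    (hq : q ∈ Ω ×ˢ Metric.ball (0 : C3) ε) (v : C3) :
    ∀ᶠ r in 𝓝[≠] (0 : ℝ), ((q.1, q.2 + r • v) : P × C3) ∈ Ω ×ˢ Metric.ball (0 : C3) ε := by
  have : ContinuousAt (fun r : ℝ => ((q.1, q.2 + r • v) : P × C3)) 0 := by fun_prop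
  refine (this.eventually ?_).filter_mono nhdsWithin_le_nhds
  simp only [zero_smul, add_zero]
  exact (hΩ.prod Metric.isOpen_ball).mem_nhds hq

theorem norm_add_sng_le (x : C3) (j : Fin 3) (v : ℂ) (h : ‖x j + v‖ ≤ ‖x j‖) :
    ‖x + sng j v‖ ≤ ‖x‖ := by
  refine norm_le_of_act_le fun i => ?_
  rw [act_eq_norm, act_eq_norm]
  have : ‖(x + sng j v) i‖ ≤ ‖x i‖ := by
    by_cases hij : i = j
    · subst hij; simpa using h
    · simp [sng_of_ne hij]
  gcongr

/-- Keeps in the ball the segment along which the real part of one coordinate is contracted to zero,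
so that Hadamard's integral is defined. -/
theorem norm_add_re_scale_le (x : C3) (j : Fin 3) {s : ℝ} (hs : s ∈ Icc (0 : ℝ) 1) :
    ‖x + sng j (((s - 1) * (x j).re : ℝ) : ℂ)‖ ≤ ‖x‖ := by
  refine norm_add_sng_le x j _ ?_
  rw [← sq_le_sq₀ (norm_nonneg _) (norm_nonneg _), ← Complex.normSq_eq_norm_sq,
    ← Complex.normSq_eq_norm_sq, Complex.normSq_apply, Complex.normSq_apply]
  simp only [Complex.add_re, Complex.ofReal_re, Complex.add_im, Complex.ofReal_im, add_zero]
  have : s ^ 2 ≤ 1 := by nlinarith [hs.1, hs.2]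
  nlinarith [sq_nonneg (x j).re]

theorem norm_add_scale_le (x : C3) (j : Fin 3) {s : ℝ} (hs : s ∈ Icc (0 : ℝ) 1) :
    ‖x + sng j (((s - 1 : ℝ) : ℂ) * x j)‖ ≤ ‖x‖ := by
  refine norm_add_sng_le x j _ ?_
  have : x j + ((s - 1 : ℝ) : ℂ) * x j = (s : ℂ) * x j := by push_cast; ring
  rw [this, norm_mul, Complex.norm_real, Real.norm_eq_abs, abs_of_nonneg hs.1]
  exact mul_le_of_le_one_left (norm_nonneg _) hs.2

variable [NormedSpace ℝ P]

/-- An analytic family of covectors that vanishes on the rotations of a coordinate plane is, in this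
plane, an analytic multiple of the differential of the action. -/
theorem exists_radial_coefficient (hΩ : IsOpen Ω) (j : Fin 3) {h : P × C3 → C3 →L[ℝ] ℝ}
    (hh : AnalyticOnNhd ℝ h (Ω ×ˢ Metric.ball (0 : C3) ε))
    (h0 : ∀ q ∈ Ω ×ˢ Metric.ball (0 : C3) ε, h q (sng j (Complex.I * q.2 j)) = 0) :
    ∃ b : P × C3 → ℝ, AnalyticOnNhd ℝ b (Ω ×ˢ Metric.ball (0 : C3) ε) ∧
      ∀ q ∈ Ω ×ˢ Metric.ball (0 : C3) ε, ∀ v : ℂ,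
        h q (sng j v) = b q * ((q.2 j).re * v.re + (q.2 j).im * v.im) := by
  set D := Ω ×ˢ Metric.ball (0 : C3) ε with hD
  set β : P × C3 → ℝ := fun q => h q (sng j 1) with hβ
  set β' : P × C3 → ℝ := fun q => h q (sng j Complex.I) with hβ'
  have hβa : AnalyticOnNhd ℝ β D := fun q hq => (hh q hq).clm_apply_fun analyticAt_const
  have hβa' : AnalyticOnNhd ℝ β' D := fun q hq => (hh q hq).clm_apply_fun analyticAt_const
  have hv : ∀ q v, h q (sng j v) = v.re * β q + v.im * β' q := fun q v => by
    rw [sng_eq, map_add, map_smul, map_smul]; rfl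
  have hrel : ∀ q ∈ D, (q.2 j).re * β' q = (q.2 j).im * β q := fun q hq => by
    have := h0 q hq
    rw [hv] at this
    simp at this
    linarith
  -- `β` vanishes where the real part does
  have hzero : ∀ q ∈ D, (q.2 j).re = 0 → β q = 0 := by
    intro q hq hre
    refine eq_of_eq_along_line (G := fun _ => 0) (hβa q hq).continuousAt continuousAt_const
      (sng j Complex.I) ?_
    have him : ∀ᶠ r in 𝓝[≠] (0 : ℝ), (q.2 j).im + r ≠ 0 := by
      by_cases h0 : (q.2 j).im = 0
      · filter_upwards [self_mem_nhdsWithin] with r hr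
        rw [h0, zero_add]; exact hr
      · have : ContinuousAt (fun r : ℝ => (q.2 j).im + r) 0 := by fun_prop
        exact (this.eventually_ne (by simpa using h0)).filter_mono nhdsWithin_le_nhds
    filter_upwards [him, eventually_mem_tube_along_line hΩ hq (sng j Complex.I)] with r hr hr2
    have := hrel _ hr2
    simp [hre] at this
    rcases this with h1 | h1
    · exact absurd h1 hr
    · exact h1
  -- Hadamard quotient: `β` vanishes where the real part does, so it is this real part times the
  -- mean of its partial derivative along the segment from there.
  set b : P × C3 → ℝ := fun q => ∫ s in (0 : ℝ)..1,
    fderiv ℝ β (q.1, q.2 + sng j (((s - 1) * (q.2 j).re : ℝ) : ℂ)) (0, sng j 1) with hb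
  have hmem : ∀ q ∈ D, ∀ s ∈ Icc (0 : ℝ) 1,
      ((q.1, q.2 + sng j (((s - 1) * (q.2 j).re : ℝ) : ℂ)) : P × C3) ∈ D := fun q hq s hs =>
    ⟨hq.1, by
      have := hq.2
      rw [mem_ball_zero_iff] at this ⊢
      exact (norm_add_re_scale_le _ _ hs).trans_lt this⟩
  have hba : AnalyticOnNhd ℝ b D := by
    intro q hq
    refine analyticAt_intervalIntegral (f := fun p : ℝ × P × C3 => fderiv ℝ β
      (p.2.1, p.2.2 + sng j (((p.1 - 1) * (p.2.2 j).re : ℝ) : ℂ)) (0, sng j 1)) zero_le_one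
      fun s hs => ?_
    refine AnalyticAt.clm_apply_fun ?_ analyticAt_const
    have h1 : AnalyticAt ℝ (fun p : ℝ × P × C3 =>
        ((p.2.1, p.2.2 + sng j (((p.1 - 1) * (p.2.2 j).re : ℝ) : ℂ)) : P × C3)) (s, q) := by
      have h2 : AnalyticAt ℝ (fun p : ℝ × P × C3 => p.2.2) (s, q) :=
        analyticAt_snd.comp analyticAt_snd
      refine (analyticAt_fst.comp analyticAt_snd).prod (h2.add ?_)
      refine ((sng j).analyticAt _).comp ((Complex.ofRealCLM.analyticAt _).comp ?_)
      exact (analyticAt_fst.sub analyticAt_const).mul (h2.re_coord j)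
    exact AnalyticAt.comp (g := fderiv ℝ β) ((hβa _ (hmem q hq s hs)).fderiv) h1
  have hβb : ∀ q ∈ D, β q = (q.2 j).re * b q := by
    intro q hq
    set c : ℝ → P × C3 := fun s => (q.1, q.2 + sng j (((s - 1) * (q.2 j).re : ℝ) : ℂ)) with hc
    have hcd : ∀ s, HasDerivAt c ((q.2 j).re • (0, sng j 1)) s := by
      intro s
      have h1 : HasDerivAt (fun s : ℝ => (((s - 1) * (q.2 j).re : ℝ) : ℂ)) ((q.2 j).re : ℂ) s := by
        have : HasDerivAt (fun s : ℝ => (s - 1) * (q.2 j).re) (q.2 j).re s := by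
          simpa using ((hasDerivAt_id s).sub_const 1).mul_const (q.2 j).re
        exact this.ofReal_comp
      have h2 := ((sng j).hasFDerivAt.comp_hasDerivAt s h1).const_add q.2
      have h3 : sng j ((q.2 j).re : ℂ) = (q.2 j).re • sng j 1 := by
        rw [← map_smul]; simp
      rw [h3] at h2
      have h4 : (q.2 j).re • ((0, sng j 1) : P × C3) = (0, (q.2 j).re • sng j 1) := by
        rw [Prod.smul_mk, smul_zero]
      rw [h4]
      exact (hasDerivAt_const s q.1).prodMk h2
    have hd : ∀ s ∈ uIcc (0 : ℝ) 1, HasDerivAt (fun s => β (c s))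
        ((q.2 j).re * fderiv ℝ β (c s) (0, sng j 1)) s := by
      intro s hs
      rw [uIcc_of_le zero_le_one] at hs
      have := (hβa _ (hmem q hq s hs)).differentiableAt.hasFDerivAt.comp_hasDerivAt s (hcd s)
      rw [map_smul, smul_eq_mul] at this
      exact this
    have hcont : ContinuousOn (fun s => (q.2 j).re * fderiv ℝ β (c s) (0, sng j 1))
        (uIcc (0 : ℝ) 1) := by
      intro s hs
      rw [uIcc_of_le zero_le_one] at hs
      have h1 : ContinuousAt (fderiv ℝ β) (c s) := (hβa _ (hmem q hq s hs)).fderiv.continuousAt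
      have h2 : ContinuousAt (fun s => fderiv ℝ β (c s)) s := h1.comp (hcd s).continuousAt
      exact (continuousAt_const.mul (h2.clm_apply continuousAt_const)).continuousWithinAt
    have hint := intervalIntegral.integral_eq_sub_of_hasDerivAt hd hcont.intervalIntegrable
    rw [intervalIntegral.integral_const_mul] at hint
    have h1 : c 1 = q := by simp [hc]
    have h0 : β (c 0) = 0 := hzero _ (hmem q hq 0 ⟨le_rfl, zero_le_one⟩) (by simp [hc])
    rw [h1, h0, sub_zero] at hint
    exact hint.symm
  refine ⟨b, hba, fun q hq v => ?_⟩
  have hβb' : β' q = (q.2 j).im * b q := by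
    -- The same `b` serves the imaginary direction: cancel the real part in `hrel`, then let it tend
    -- to zero.
    have hoff : ∀ q ∈ D, (q.2 j).re ≠ 0 → β' q = (q.2 j).im * b q := fun q hq hre => by
      have := hrel q hq
      rw [hβb q hq] at this
      exact mul_left_cancel₀ hre (by linarith)
    by_cases hre : (q.2 j).re = 0
    · refine eq_of_eq_along_line (G := fun q => (q.2 j).im * b q) (hβa' q hq).continuousAt
        ?_ (sng j 1) ?_
      · exact ((imC j).continuous.continuousAt.comp continuousAt_snd).mul (hba q hq).continuousAt
      · filter_upwards [self_mem_nhdsWithin, eventually_mem_tube_along_line hΩ hq (sng j 1)]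
          with r hr hr2
        exact hoff _ hr2 (by simpa [hre] using hr)
    · exact hoff q hq hre
  rw [hv, hβb q hq, hβb']
  ring

/-- An invariant analytic function that vanishes on a coordinate hyperplane is an analytic multiple of
the corresponding action. -/
theorem exists_action_factor (hΩ : IsOpen Ω) (j : Fin 3) {T : P × C3 → ℝ}
    (hT : AnalyticOnNhd ℝ T (Ω ×ˢ Metric.ball (0 : C3) ε))
    (hinv : ∀ q ∈ Ω ×ˢ Metric.ball (0 : C3) ε, fderiv ℝ T q (0, sng j (Complex.I * q.2 j)) = 0)
    (h0 : ∀ q ∈ Ω ×ˢ Metric.ball (0 : C3) ε, q.2 j = 0 → T q = 0) :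
    ∃ τ : P × C3 → ℝ, AnalyticOnNhd ℝ τ (Ω ×ˢ Metric.ball (0 : C3) ε) ∧
      ∀ q ∈ Ω ×ˢ Metric.ball (0 : C3) ε, T q = τ q * act q.2 j := by
  set D := Ω ×ˢ Metric.ball (0 : C3) ε with hD
  obtain ⟨b, hba, hb⟩ := exists_radial_coefficient hΩ j
    (h := fun q => (fderiv ℝ T q).comp (ContinuousLinearMap.inr ℝ P C3))
    (fun q hq => (hT q hq).fderiv.clm_comp_fun analyticAt_const) (fun q hq => by
      simpa using hinv q hq)
  have hmem : ∀ q ∈ D, ∀ s ∈ Icc (0 : ℝ) 1,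
      ((q.1, q.2 + sng j (((s - 1 : ℝ) : ℂ) * q.2 j)) : P × C3) ∈ D := fun q hq s hs =>
    ⟨hq.1, by
      have := hq.2
      rw [mem_ball_zero_iff] at this ⊢
      exact (norm_add_scale_le _ _ hs).trans_lt this⟩
  -- Along the ray s ↦ s x_j the derivative of `T` is s b |x_j|² = 2 s b times the action, and `T`
  -- vanishes at s = 0.
  refine ⟨fun q => ∫ s in (0 : ℝ)..1, 2 * s * b (q.1, q.2 + sng j (((s - 1 : ℝ) : ℂ) * q.2 j)),
    fun q hq => ?_, fun q hq => ?_⟩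
  · refine analyticAt_intervalIntegral (f := fun p : ℝ × P × C3 =>
      2 * p.1 * b (p.2.1, p.2.2 + sng j (((p.1 - 1 : ℝ) : ℂ) * p.2.2 j))) zero_le_one
      fun s hs => ?_
    have h1 : AnalyticAt ℝ (fun p : ℝ × P × C3 =>
        ((p.2.1, p.2.2 + sng j (((p.1 - 1 : ℝ) : ℂ) * p.2.2 j)) : P × C3)) (s, q) := by
      have h2 : AnalyticAt ℝ (fun p : ℝ × P × C3 => p.2.2) (s, q) :=
        analyticAt_snd.comp analyticAt_snd
      refine (analyticAt_fst.comp analyticAt_snd).prod (h2.add ?_)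
      refine ((sng j).analyticAt _).comp (AnalyticAt.mul ?_ (((crd j).analyticAt _).comp h2))
      exact (Complex.ofRealCLM.analyticAt _).comp (analyticAt_fst.sub analyticAt_const)
    exact (analyticAt_const.mul analyticAt_fst).mul
      (AnalyticAt.comp (g := b) (hba _ (hmem q hq s hs)) h1)
  · set c : ℝ → P × C3 := fun s => (q.1, q.2 + sng j (((s - 1 : ℝ) : ℂ) * q.2 j)) with hc
    have hcd : ∀ s, HasDerivAt c (0, sng j (q.2 j)) s := by
      intro s
      have h1 : HasDerivAt (fun s : ℝ => ((s - 1 : ℝ) : ℂ) * q.2 j) (q.2 j) s := by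
        have : HasDerivAt (fun s : ℝ => s - 1) 1 s := (hasDerivAt_id s).sub_const 1
        simpa using this.ofReal_comp.mul_const (q.2 j)
      exact (hasDerivAt_const s q.1).prodMk
        (((sng j).hasFDerivAt.comp_hasDerivAt s h1).const_add q.2)
    have hcj : ∀ s, (c s).2 j = (s : ℂ) * q.2 j := fun s => by simp [hc]; ring
    have hd : ∀ s ∈ uIcc (0 : ℝ) 1, HasDerivAt (fun s => T (c s))
        (2 * s * b (c s) * act q.2 j) s := by
      intro s hs
      rw [uIcc_of_le zero_le_one] at hs
      have h1 := (hT _ (hmem q hq s hs)).differentiableAt.hasFDerivAt.comp_hasDerivAt s (hcd s)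
      have h2 := hb (c s) (hmem q hq s hs) (q.2 j)
      rw [ContinuousLinearMap.comp_apply, ContinuousLinearMap.inr_apply, hcj] at h2
      have h3 : 2 * s * b (c s) * act q.2 j = fderiv ℝ T (c s) (0, sng j (q.2 j)) := by
        rw [h2]
        simp [act]
        ring
      rw [h3]
      exact h1
    have hcont : ContinuousOn (fun s => 2 * s * b (c s) * act q.2 j) (uIcc (0 : ℝ) 1) := by
      intro s hs
      rw [uIcc_of_le zero_le_one] at hs
      have h1 : ContinuousAt b (c s) := (hba _ (hmem q hq s hs)).continuousAt
      have h2 : ContinuousAt (fun s => b (c s)) s := h1.comp (hcd s).continuousAt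
      exact ((continuousAt_const.mul continuousAt_id).mul h2 |>.mul
        continuousAt_const).continuousWithinAt
    have hint := intervalIntegral.integral_eq_sub_of_hasDerivAt hd hcont.intervalIntegrable
    rw [intervalIntegral.integral_mul_const] at hint
    have h1 : c 1 = q := by simp [hc]
    have h0 : T (c 0) = 0 := h0 _ (hmem q hq 0 ⟨le_rfl, zero_le_one⟩) (by simp [hc])
    rw [h1, h0, sub_zero] at hint
    exact hint.symm

end Hadamard

/-! ### Averages over the circles of the first plane and the cohomological equation -/

section CircleAverages

open Filter Topology MeasureTheory C3

variable {P : Type*} {Ω : Set P} {ε : ℝ}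

theorem tor_mem_tube {q : P × C3} (hq : q ∈ Ω ×ˢ Metric.ball (0 : C3) ε) (s : Fin 3 → ℝ) :
    ((q.1, tor s q.2) : P × C3) ∈ Ω ×ˢ Metric.ball (0 : C3) ε := by
  refine ⟨hq.1, ?_⟩
  have := hq.2
  rw [mem_ball_zero_iff] at this ⊢
  simpa using this

theorem tor_smul_add_smul (d : Fin 3 → ℝ) (r s : ℝ) (x : C3) :
    tor ((r + s) • d) x = tor (r • d) (tor (s • d) x) := by
  rw [add_smul, tor_add]

theorem tor_comm (s t : Fin 3 → ℝ) (x : C3) : tor s (tor t x) = tor t (tor s x) := by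
  rw [← tor_add, ← tor_add, add_comm]

/-- The average of `f` over the rotations of the first coordinate plane. -/
noncomputable def rotAverage (f : P × C3 → ℝ) (q : P × C3) : ℝ :=
  (2 * π)⁻¹ * ∫ s in (0 : ℝ)..2 * π, f (q.1, tor (s • dir0) q.2)

/-- A primitive of `f - rotAverage f` along the rotations of the first coordinate plane. -/
noncomputable def rotPrimitive (f : P × C3 → ℝ) (q : P × C3) : ℝ :=
  (2 * π)⁻¹ * ∫ s in (0 : ℝ)..2 * π, (s - π) * f (q.1, tor (s • dir0) q.2)

theorem rotAverage_tor_of_invariant {f : P × C3 → ℝ} {q : P × C3} {t : Fin 3 → ℝ}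
    (h : ∀ s, f (q.1, tor t (tor s q.2)) = f (q.1, tor s q.2)) :
    rotAverage f (q.1, tor t q.2) = rotAverage f q := by
  unfold rotAverage
  simp only [tor_comm _ t, h]

theorem rotPrimitive_tor_of_invariant {f : P × C3 → ℝ} {q : P × C3} {t : Fin 3 → ℝ}
    (h : ∀ s, f (q.1, tor t (tor s q.2)) = f (q.1, tor s q.2)) :
    rotPrimitive f (q.1, tor t q.2) = rotPrimitive f q := by
  unfold rotPrimitive
  simp only [tor_comm _ t, h]

theorem periodic_rot (f : P × C3 → ℝ) (q : P × C3) :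
    Function.Periodic (fun s : ℝ => f (q.1, tor (s • dir0) q.2)) (2 * π) := fun s => by
  simp only [tor_smul_add_smul, tor_two_pi_dir0]

theorem rotAverage_rot (f : P × C3 → ℝ) (q : P × C3) (r : ℝ) :
    rotAverage f (q.1, tor (r • dir0) q.2) = rotAverage f q := by
  unfold rotAverage
  simp only [← tor_smul_add_smul]
  rw [intervalIntegral.integral_comp_add_right
    (fun s : ℝ => f (q.1, tor (s • dir0) q.2)) r, zero_add, add_comm (2 * π)]
  rw [(periodic_rot f q).intervalIntegral_add_eq r 0, zero_add]

variable [NormedAddCommGroup P] [NormedSpace ℝ P]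

theorem analyticAt_comp_tor {f : P × C3 → ℝ}
    (hf : AnalyticOnNhd ℝ f (Ω ×ˢ Metric.ball (0 : C3) ε)) {q : P × C3}
    (hq : q ∈ Ω ×ˢ Metric.ball (0 : C3) ε) (d : Fin 3 → ℝ) (s : ℝ) :
    AnalyticAt ℝ (fun p : ℝ × P × C3 => f (p.2.1, tor (p.1 • d) p.2.2)) (s, q) :=
  AnalyticAt.comp (g := f) (f := fun p : ℝ × P × C3 => (p.2.1, tor (p.1 • d) p.2.2))
    (hf _ (tor_mem_tube hq _)) ((analyticAt_fst.comp analyticAt_snd).prod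
      (analyticAt_tor d analyticAt_fst (analyticAt_snd.comp analyticAt_snd)))

theorem analyticOnNhd_rotAverage {f : P × C3 → ℝ}
    (hf : AnalyticOnNhd ℝ f (Ω ×ˢ Metric.ball (0 : C3) ε)) :
    AnalyticOnNhd ℝ (rotAverage f) (Ω ×ˢ Metric.ball (0 : C3) ε) := fun q hq => by
  have h := analyticAt_intervalIntegral
    (f := fun p : ℝ × P × C3 => f (p.2.1, tor (p.1 • dir0) p.2.2)) two_pi_pos.le
    fun s _ => analyticAt_comp_tor hf hq dir0 s
  exact analyticAt_const.mul h

theorem analyticOnNhd_rotPrimitive {f : P × C3 → ℝ}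
    (hf : AnalyticOnNhd ℝ f (Ω ×ˢ Metric.ball (0 : C3) ε)) :
    AnalyticOnNhd ℝ (rotPrimitive f) (Ω ×ˢ Metric.ball (0 : C3) ε) := fun q hq => by
  have h := analyticAt_intervalIntegral
    (f := fun p : ℝ × P × C3 => (p.1 - π) * f (p.2.1, tor (p.1 • dir0) p.2.2)) two_pi_pos.le
    fun s _ => (analyticAt_fst.sub analyticAt_const).mul (analyticAt_comp_tor hf hq dir0 s)
  exact analyticAt_const.mul h

theorem hasDerivAt_orbit {F : Type*} [NormedAddCommGroup F] [NormedSpace ℝ F] {g : P × C3 → F}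
    {q : P × C3} (hg : DifferentiableAt ℝ g q) (d : Fin 3 → ℝ) :
    HasDerivAt (fun r : ℝ => g (q.1, tor (r • d) q.2)) (fderiv ℝ g q (0, gen d q.2)) 0 := by
  have h1 : HasDerivAt (fun r : ℝ => ((q.1, tor (r • d) q.2) : P × C3)) (0, gen d q.2) 0 := by
    have := (hasDerivAt_const (0 : ℝ) q.1).prodMk (hasDerivAt_tor d q.2 0)
    simpa using this
  have h2 : HasFDerivAt g (fderiv ℝ g q) (q.1, tor ((0 : ℝ) • d) q.2) := by
    simpa using hg.hasFDerivAt
  exact h2.comp_hasDerivAt (0 : ℝ) h1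

theorem fderiv_gen_of_invariant {g : P × C3 → ℝ} {q : P × C3} (hg : DifferentiableAt ℝ g q)
    {d : Fin 3 → ℝ} (h : ∀ r : ℝ, g (q.1, tor (r • d) q.2) = g q) :
    fderiv ℝ g q (0, gen d q.2) = 0 := by
  have h1 := hasDerivAt_orbit hg d
  simp only [h] at h1
  exact h1.unique (hasDerivAt_const _ _)

/-- Moving the base point along the circle translates the weight s - π, and the jump of this weight
over a period, 2π, produces `f q`, while its slope produces the average. The constant π only fixes
the mean of the primitive; any other one would do. -/
theorem fderiv_rotPrimitive {f : P × C3 → ℝ}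
    (hf : AnalyticOnNhd ℝ f (Ω ×ˢ Metric.ball (0 : C3) ε)) {q : P × C3}
    (hq : q ∈ Ω ×ˢ Metric.ball (0 : C3) ε) :
    fderiv ℝ (rotPrimitive f) q (0, gen dir0 q.2) = f q - rotAverage f q := by
  set k : ℝ → ℝ := fun s => f (q.1, tor (s • dir0) q.2) with hk
  have hkc : Continuous k := by
    refine continuous_iff_continuousAt.2 fun s => ?_
    have h1 := (analyticAt_comp_tor hf hq dir0 s).continuousAt
    have h2 : ContinuousAt (fun s : ℝ => ((s, q) : ℝ × P × C3)) s := by fun_prop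
    exact ContinuousAt.comp (f := fun s : ℝ => ((s, q) : ℝ × P × C3)) h1 h2
  have hper : Function.Periodic k (2 * π) := periodic_rot f q
  have hk0 : k 0 = f q := by simp [hk]
  have hgc : Continuous fun s => (s - π) * k s := by fun_prop
  set G : ℝ → ℝ := fun r => ∫ s in (0 : ℝ)..r, (s - π) * k s with hG
  have hGd : ∀ r, HasDerivAt G ((r - π) * k r) r := fun r =>
    intervalIntegral.integral_hasDerivAt_right (hgc.intervalIntegrable _ _)
      (hgc.stronglyMeasurableAtFilter _ _) hgc.continuousAt
  have hform : ∀ r : ℝ, rotPrimitive f (q.1, tor (r • dir0) q.2) =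
      (2 * π)⁻¹ * (G (r + 2 * π) - G r - r * ∫ s in (0 : ℝ)..2 * π, k s) := by
    intro r
    unfold rotPrimitive
    congr 1
    have h1 : ∀ s : ℝ, (s - π) * f (q.1, tor (s • dir0) (tor (r • dir0) q.2)) =
        (fun s => (s - π) * k s - r * k s) (s + r) := fun s => by
      simp only [← tor_smul_add_smul, hk]
      ring
    simp only [h1]
    rw [intervalIntegral.integral_comp_add_right (fun s => (s - π) * k s - r * k s) r, zero_add,
      add_comm (2 * π), intervalIntegral.integral_sub (hgc.intervalIntegrable _ _)
        ((by fun_prop : Continuous fun s => r * k s).intervalIntegrable _ _),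
      intervalIntegral.integral_const_mul, hper.intervalIntegral_add_eq r 0, zero_add]
    congr 1
    rw [hG]
    exact (intervalIntegral.integral_interval_sub_left (hgc.intervalIntegrable _ _)
      (hgc.intervalIntegrable _ _)).symm
  have h1 := hasDerivAt_orbit (analyticOnNhd_rotPrimitive hf q hq).differentiableAt dir0
  have h2 : HasDerivAt (fun r : ℝ => (2 * π)⁻¹ * (G (r + 2 * π) - G r -
      r * ∫ s in (0 : ℝ)..2 * π, k s)) ((2 * π)⁻¹ * (((0 + 2 * π) - π) * k (0 + 2 * π) -
        (0 - π) * k 0 - 1 * ∫ s in (0 : ℝ)..2 * π, k s)) 0 := by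
    refine HasDerivAt.const_mul _ (((HasDerivAt.comp_add_const 0 (2 * π) (hGd _)).sub (hGd 0)).sub ?_)
    exact (hasDerivAt_id (0 : ℝ)).mul_const _
  rw [funext hform] at h1
  rw [h1.unique h2, hper 0, hk0]
  unfold rotAverage
  have := Real.pi_pos.ne'
  field_simp
  ring

end CircleAverages

/-! ### Equivariant families, the pulled-back primitive and the action variable -/

section EquivariantFamilies

open Filter Topology MeasureTheory C3

variable {P : Type*} [NormedAddCommGroup P] [NormedSpace ℝ P] {Ω : Set P} {ε : ℝ}
  {N : P × C3 → C3}

/-- An analytic family of maps of a ball of `ℂ³` that commutes with the simultaneous rotations of the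
first two planes and with the rotations of the third one, and preserves the corresponding actions. -/
structure EquivariantFamily (Ω : Set P) (ε : ℝ) (N : P × C3 → C3) : Prop where
  isOpen : IsOpen Ω
  analytic : AnalyticOnNhd ℝ N (Ω ×ˢ Metric.ball (0 : C3) ε)
  tor_dir01 : ∀ q ∈ Ω ×ˢ Metric.ball (0 : C3) ε, ∀ r : ℝ,
    N (q.1, tor (r • dir01) q.2) = tor (r • dir01) (N q)
  tor_dir2 : ∀ q ∈ Ω ×ˢ Metric.ball (0 : C3) ε, ∀ r : ℝ,
    N (q.1, tor (r • dir2) q.2) = tor (r • dir2) (N q)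
  act_add : ∀ q ∈ Ω ×ˢ Metric.ball (0 : C3) ε,
    act (N q) 0 + act (N q) 1 = act q.2 0 + act q.2 1
  act_two : ∀ q ∈ Ω ×ˢ Metric.ball (0 : C3) ε, act (N q) 2 = act q.2 2

/-- The pull-back of the standard primitive `½ ∑ (x_j dy_j - y_j dx_j)` of the symplectic form. -/
noncomputable def pullbackPrimitive (N : P × C3 → C3) (q : P × C3) : P × C3 →L[ℝ] ℝ :=
  (1 / 2 : ℝ) • (om (N q)).comp (fderiv ℝ N q)

theorem pullbackPrimitive_apply (N : P × C3 → C3) (q δ : P × C3) :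
    pullbackPrimitive N q δ = 1 / 2 * om (N q) (fderiv ℝ N q δ) := rfl

/-- The pulled-back primitive along the rotations of the first plane. -/
noncomputable def angularDensity (N : P × C3 → C3) (q : P × C3) : ℝ :=
  pullbackPrimitive N q (0, gen dir0 q.2)

theorem AnalyticAt.pullbackPrimitive {q : P × C3} (h : AnalyticAt ℝ N q) :
    AnalyticAt ℝ (pullbackPrimitive N) q := by
  have h1 : AnalyticAt ℝ (fun q => om (N q)) q := (om.analyticAt _).comp h
  exact (analyticAt_const (v := (1 / 2 : ℝ))).smul (h1.clm_comp_fun h.fderiv)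

theorem analyticAt_angularDensity {q : P × C3} (h : AnalyticAt ℝ N q) :
    AnalyticAt ℝ (angularDensity N) q := by
  have h1 : AnalyticAt ℝ (fun q : P × C3 => ((0, gen dir0 q.2) : P × C3)) q :=
    analyticAt_const.prod (((gen dir0).analyticAt _).comp analyticAt_snd)
  exact h.pullbackPrimitive.clm_apply_fun h1

/-- Along a direction in which `N` is equivariant it carries the generator to the generator, and
`om_gen` applies. This is available for `dir01` and `dir2`, but not for `dir0`, where an average is
needed. -/
theorem pullbackPrimitive_gen {q : P × C3} (hN : DifferentiableAt ℝ N q) {d : Fin 3 → ℝ}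
    (h : ∀ r : ℝ, N (q.1, tor (r • d) q.2) = tor (r • d) (N q)) :
    pullbackPrimitive N q (0, gen d q.2) = ∑ j, d j * act (N q) j := by
  have h1 := hasDerivAt_orbit hN d
  simp only [h] at h1
  have h2 := hasDerivAt_tor d (N q) 0
  rw [zero_smul, tor_zero] at h2
  rw [pullbackPrimitive_apply, h1.unique h2, om_gen]
  ring

/-- The primitive is torus invariant, so its pull-back is invariant under the rotations that commute
with `N`; the generator of `dir0` is invariant because the torus is commutative. -/
theorem angularDensity_tor (hΩ : IsOpen Ω) (hN : AnalyticOnNhd ℝ N (Ω ×ˢ Metric.ball (0 : C3) ε))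
    {t : Fin 3 → ℝ} (h : ∀ q ∈ Ω ×ˢ Metric.ball (0 : C3) ε, N (q.1, tor t q.2) = tor t (N q))
    {q : P × C3} (hq : q ∈ Ω ×ˢ Metric.ball (0 : C3) ε) :
    angularDensity N (q.1, tor t q.2) = angularDensity N q := by
  set A : P × C3 →L[ℝ] P × C3 := (ContinuousLinearMap.fst ℝ P C3).prod
    ((tor t).comp (ContinuousLinearMap.snd ℝ P C3)) with hA
  have hAq : A q = (q.1, tor t q.2) := rfl
  have h1 : HasFDerivAt (fun q => N (A q)) ((fderiv ℝ N (A q)).comp A) q :=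
    (hN _ (tor_mem_tube hq t)).differentiableAt.hasFDerivAt.comp q A.hasFDerivAt
  have h2 : HasFDerivAt (fun q => tor t (N q)) ((tor t).comp (fderiv ℝ N q)) q :=
    (tor t).hasFDerivAt.comp q (hN q hq).differentiableAt.hasFDerivAt
  have h3 : (fun q => N (A q)) =ᶠ[𝓝 q] fun q => tor t (N q) := by
    filter_upwards [(hΩ.prod Metric.isOpen_ball).mem_nhds hq] with q' hq'
    exact h q' hq'
  have h4 := (h1.congr_of_eventuallyEq h3.symm).unique h2
  have h5 := congrArg (fun L => L ((0, gen dir0 q.2) : P × C3)) h4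
  simp only [ContinuousLinearMap.comp_apply] at h5
  have h6 : A (0, gen dir0 q.2) = (0, gen dir0 (tor t q.2)) := by
    rw [gen_tor]; rfl
  rw [h6] at h5
  rw [angularDensity, pullbackPrimitive_apply, angularDensity, pullbackPrimitive_apply]
  simp only
  rw [← hAq, h5, hAq, h q hq, om_tor]

/-- If `R + i I = ρ e^{ic} (x + i y)`, then
`R dI - I dR = ρ² (x dy - y dx) + ρ² (x² + y²) dc`. -/
theorem wronskian_polar {Q : Type*} [NormedAddCommGroup Q] [NormedSpace ℝ Q] {ρ c x y : Q → ℝ}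
    {q : Q} (hρ : DifferentiableAt ℝ ρ q) (hc : DifferentiableAt ℝ c q)
    (hx : DifferentiableAt ℝ x q) (hy : DifferentiableAt ℝ y q) (δ : Q) :
    (ρ q * (cos (c q) * x q - sin (c q) * y q)) *
        fderiv ℝ (fun q => ρ q * (sin (c q) * x q + cos (c q) * y q)) q δ -
      (ρ q * (sin (c q) * x q + cos (c q) * y q)) *
        fderiv ℝ (fun q => ρ q * (cos (c q) * x q - sin (c q) * y q)) q δ =
      ρ q ^ 2 * (x q * fderiv ℝ y q δ - y q * fderiv ℝ x q δ) +
        ρ q ^ 2 * (x q ^ 2 + y q ^ 2) * fderiv ℝ c q δ := by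
  have hs := hc.hasFDerivAt.sin
  have hk := hc.hasFDerivAt.cos
  have h1 := hρ.hasFDerivAt.mul ((hs.mul hx.hasFDerivAt).add (hk.mul hy.hasFDerivAt))
  have h2 := hρ.hasFDerivAt.mul ((hk.mul hx.hasFDerivAt).sub (hs.mul hy.hasFDerivAt))
  have e1 : fderiv ℝ (fun q => ρ q * (sin (c q) * x q + cos (c q) * y q)) q = _ := h1.fderiv
  have e2 : fderiv ℝ (fun q => ρ q * (cos (c q) * x q - sin (c q) * y q)) q = _ := h2.fderiv
  rw [e1, e2]
  simp only [add_apply, sub_apply, smul_apply, smul_eq_mul, Pi.mul_apply, Pi.add_apply, Pi.sub_apply]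
  have h := Real.sin_sq_add_cos_sq (c q)
  generalize sin (c q) = s at *
  generalize cos (c q) = k at *
  generalize fderiv ℝ y q δ = dy
  generalize fderiv ℝ x q δ = dx
  generalize fderiv ℝ c q δ = dc
  generalize fderiv ℝ ρ q δ = dr
  generalize ρ q = r
  generalize x q = x
  generalize y q = y
  linear_combination (r ^ 2 * (x * dy - y * dx) + r ^ 2 * (x ^ 2 + y ^ 2) * dc *
    (s ^ 2 + k ^ 2 + 1) - r ^ 2 * (x ^ 2 + y ^ 2) * dc * (s ^ 2 + k ^ 2)) * h

theorem gen_dir0 (x : C3) : gen dir0 x = sng 0 (Complex.I * x 0) := gen_single 0 x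

theorem gen_dir2 (x : C3) : gen dir2 x = sng 2 (Complex.I * x 2) := gen_single 2 x

theorem gen_dir01 (x : C3) :
    gen dir01 x = sng 0 (Complex.I * x 0) + sng 1 (Complex.I * x 1) := by
  ext i
  fin_cases i <;> simp [gen_apply, dir01, sng_of_ne]

/-- Reduces invariance under the whole torus to the two symmetries of the family and to the
direction that is averaged. -/
theorem tor_eq_dirs (s : Fin 3 → ℝ) (x : C3) :
    tor s x = tor ((s 0 - s 1) • dir0) (tor (s 1 • dir01) (tor (s 2 • dir2) x)) := by
  rw [← tor_add, ← tor_add]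
  congr 1
  congr 1
  ext i
  simp only [Pi.add_apply, Pi.smul_apply, dir0, dir01, dir2]
  fin_cases i <;> simp

namespace EquivariantFamily

/-- The action variable: the average of the angular density. -/
noncomputable def newAction (N : P × C3 → C3) : P × C3 → ℝ := rotAverage (angularDensity N)

theorem analyticOnNhd_angularDensity (hN : EquivariantFamily Ω ε N) :
    AnalyticOnNhd ℝ (angularDensity N) (Ω ×ˢ Metric.ball (0 : C3) ε) := fun q hq =>
  analyticAt_angularDensity (hN.analytic q hq)

theorem analyticOnNhd_newAction (hN : EquivariantFamily Ω ε N) :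
    AnalyticOnNhd ℝ (newAction N) (Ω ×ˢ Metric.ball (0 : C3) ε) :=
  analyticOnNhd_rotAverage hN.analyticOnNhd_angularDensity

theorem angularDensity_dir01 (hN : EquivariantFamily Ω ε N) {q : P × C3}
    (hq : q ∈ Ω ×ˢ Metric.ball (0 : C3) ε) (r : ℝ) :
    angularDensity N (q.1, tor (r • dir01) q.2) = angularDensity N q :=
  angularDensity_tor hN.isOpen hN.analytic (fun q hq => hN.tor_dir01 q hq r) hq

theorem angularDensity_dir2 (hN : EquivariantFamily Ω ε N) {q : P × C3}
    (hq : q ∈ Ω ×ˢ Metric.ball (0 : C3) ε) (r : ℝ) :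
    angularDensity N (q.1, tor (r • dir2) q.2) = angularDensity N q :=
  angularDensity_tor hN.isOpen hN.analytic (fun q hq => hN.tor_dir2 q hq r) hq

theorem newAction_tor (hN : EquivariantFamily Ω ε N) {q : P × C3}
    (hq : q ∈ Ω ×ˢ Metric.ball (0 : C3) ε) (s : Fin 3 → ℝ) :
    newAction N (q.1, tor s q.2) = newAction N q := by
  have h01 : ∀ q ∈ Ω ×ˢ Metric.ball (0 : C3) ε, ∀ r : ℝ,
      newAction N (q.1, tor (r • dir01) q.2) = newAction N q := fun q hq r =>
    rotAverage_tor_of_invariant fun s => hN.angularDensity_dir01 (tor_mem_tube hq s) r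
  have h2 : ∀ q ∈ Ω ×ˢ Metric.ball (0 : C3) ε, ∀ r : ℝ,
      newAction N (q.1, tor (r • dir2) q.2) = newAction N q := fun q hq r =>
    rotAverage_tor_of_invariant fun s => hN.angularDensity_dir2 (tor_mem_tube hq s) r
  rw [tor_eq_dirs]
  have e1 := rotAverage_rot (angularDensity N)
    (q.1, tor (s 1 • dir01) (tor (s 2 • dir2) q.2)) (s 0 - s 1)
  have e2 := h01 (q.1, tor (s 2 • dir2) q.2) (tor_mem_tube hq _) (s 1)
  exact e1.trans (e2.trans (h2 q hq _))

theorem fderiv_newAction_sng (hN : EquivariantFamily Ω ε N) {q : P × C3}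
    (hq : q ∈ Ω ×ˢ Metric.ball (0 : C3) ε) (j : Fin 3) :
    fderiv ℝ (newAction N) q (0, sng j (Complex.I * q.2 j)) = 0 := by
  rw [← gen_single]
  exact fderiv_gen_of_invariant (hN.analyticOnNhd_newAction q hq).differentiableAt
    fun r => hN.newAction_tor hq _

/-- The circle of integration degenerates to a point. -/
theorem newAction_eq_zero {q : P × C3} (h : q.2 0 = 0) : newAction N q = 0 := by
  have : ∀ s : ℝ, angularDensity N (q.1, tor (s • dir0) q.2) = 0 := fun s => by
    have h1 : gen dir0 (tor (s • dir0) q.2) = 0 := by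
      rw [gen_dir0, tor_apply, h]; simp
    rw [angularDensity]
    simp only [h1]
    exact map_zero (pullbackPrimitive N _)
  simp [newAction, rotAverage, this]

theorem pullbackPrimitive_dir01 (hN : EquivariantFamily Ω ε N) {q : P × C3}
    (hq : q ∈ Ω ×ˢ Metric.ball (0 : C3) ε) :
    pullbackPrimitive N q (0, gen dir01 q.2) = act q.2 0 + act q.2 1 := by
  rw [pullbackPrimitive_gen (hN.analytic q hq).differentiableAt (hN.tor_dir01 q hq),
    ← hN.act_add q hq, Fin.sum_univ_three]
  simp [dir01]

theorem pullbackPrimitive_dir2 (hN : EquivariantFamily Ω ε N) {q : P × C3}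
    (hq : q ∈ Ω ×ˢ Metric.ball (0 : C3) ε) :
    pullbackPrimitive N q (0, gen dir2 q.2) = act q.2 2 := by
  rw [pullbackPrimitive_gen (hN.analytic q hq).differentiableAt (hN.tor_dir2 q hq),
    ← hN.act_two q hq, Fin.sum_univ_three]
  simp [dir2]

/-- When the second coordinate vanishes the `dir0` circle is a `dir01` orbit, along which `N` is
equivariant, so the action variable can be read off. -/
theorem newAction_of_eq_zero (hN : EquivariantFamily Ω ε N) {q : P × C3}
    (hq : q ∈ Ω ×ˢ Metric.ball (0 : C3) ε) (h : q.2 1 = 0) : newAction N q = act q.2 0 := by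
  have : ∀ s : ℝ, angularDensity N (q.1, tor (s • dir0) q.2) = act q.2 0 := fun s => by
    have h0 : tor (s • dir0) q.2 1 = 0 := by rw [tor_apply, h, mul_zero]
    have h1 : gen dir0 (tor (s • dir0) q.2) = gen dir01 (tor (s • dir0) q.2) := by
      rw [gen_dir0, gen_dir01, h0]; simp
    rw [angularDensity]
    simp only [h1]
    have h2 := hN.pullbackPrimitive_dir01 (tor_mem_tube hq (s • dir0))
    simp only at h2
    rw [h2, act_tor, act_tor]
    simp [act, h]
  simp only [newAction, rotAverage, this, intervalIntegral.integral_const, sub_zero, smul_eq_mul]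
  rw [inv_mul_cancel_left₀ two_pi_pos.ne']

end EquivariantFamily

/-- The differential of an action. -/
noncomputable def dact (x : C3) (j : Fin 3) : C3 →L[ℝ] ℝ := (x j).re • reC j + (x j).im • imC j

theorem dact_apply (x : C3) (j : Fin 3) (v : C3) :
    dact x j v = (x j).re * (v j).re + (x j).im * (v j).im := rfl

theorem hasFDerivAt_act (x : C3) (j : Fin 3) : HasFDerivAt (fun x => act x j) (dact x j) x := by
  have h1 := (reC j).hasFDerivAt (x := x)
  have h2 := (imC j).hasFDerivAt (x := x)
  have h3 := ((h1.pow 2).add (h2.pow 2)).mul_const (1 / 2)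
  have h4 : (fun x => act x j) = fun x => (reC j x ^ 2 + imC j x ^ 2) * (1 / 2) := by
    funext x; simp [act]; ring
  rw [h4]
  refine h3.congr_fderiv (ContinuousLinearMap.ext fun v => ?_)
  rw [dact_apply]
  simp
  ring

/-- The sum over the planes of the coefficients given by `exists_radial_coefficient`. -/
theorem exists_radial_coefficients (hΩ : IsOpen Ω) {h : P × C3 → P × C3 →L[ℝ] ℝ}
    (hh : AnalyticOnNhd ℝ h (Ω ×ˢ Metric.ball (0 : C3) ε))
    (h0 : ∀ q ∈ Ω ×ˢ Metric.ball (0 : C3) ε, ∀ j, h q (0, sng j (Complex.I * q.2 j)) = 0) :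
    ∃ b : Fin 3 → P × C3 → ℝ, (∀ j, AnalyticOnNhd ℝ (b j) (Ω ×ˢ Metric.ball (0 : C3) ε)) ∧
      ∀ q ∈ Ω ×ˢ Metric.ball (0 : C3) ε, ∀ δ : P × C3,
        h q δ = h q (δ.1, 0) + ∑ j, b j q * dact q.2 j δ.2 := by
  choose b hb1 hb2 using fun j => exists_radial_coefficient hΩ j
    (h := fun q => (h q).comp (ContinuousLinearMap.inr ℝ P C3))
    (fun q hq => (hh q hq).clm_comp_fun analyticAt_const) (fun q hq => h0 q hq j)
  refine ⟨b, hb1, fun q hq δ => ?_⟩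
  have h1 : δ = (δ.1, 0) + ContinuousLinearMap.inr ℝ P C3 (∑ j, sng j (δ.2 j)) := by
    rw [← eq_sum_sng]
    ext <;> simp
  conv_lhs => rw [h1]
  rw [map_add, map_sum, map_sum]
  congr 1
  exact Finset.sum_congr rfl fun j _ => hb2 j q hq (δ.2 j)

end EquivariantFamilies

/-! ### Rescalings and rotations of the coordinate planes -/

section PolarMap

open Filter Topology MeasureTheory C3

variable {P : Type*}

/-- Multiplication of the `j`-th coordinate by `ρ_j e^{i c_j}`. -/
noncomputable def polarMap (ρ c : Fin 3 → P × C3 → ℝ) (q : P × C3) : C3 :=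
  diag (fun j => (ρ j q : ℂ) * Complex.exp (c j q * Complex.I)) q.2

theorem polarMap_re (ρ c : Fin 3 → P × C3 → ℝ) (q : P × C3) (j : Fin 3) :
    (polarMap ρ c q j).re = ρ j q * (cos (c j q) * (q.2 j).re - sin (c j q) * (q.2 j).im) := by
  simp [polarMap, Complex.exp_ofReal_mul_I_re, Complex.exp_ofReal_mul_I_im]
  ring

theorem polarMap_im (ρ c : Fin 3 → P × C3 → ℝ) (q : P × C3) (j : Fin 3) :
    (polarMap ρ c q j).im = ρ j q * (sin (c j q) * (q.2 j).re + cos (c j q) * (q.2 j).im) := by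
  simp [polarMap, Complex.exp_ofReal_mul_I_re, Complex.exp_ofReal_mul_I_im]
  ring

theorem act_polarMap (ρ c : Fin 3 → P × C3 → ℝ) (q : P × C3) (j : Fin 3) :
    act (polarMap ρ c q) j = ρ j q ^ 2 * act q.2 j := by
  rw [act, act, polarMap_re, polarMap_im]
  linear_combination (ρ j q ^ 2 * ((q.2 j).re ^ 2 + (q.2 j).im ^ 2) / 2) *
    Real.sin_sq_add_cos_sq (c j q)

variable [NormedAddCommGroup P] [NormedSpace ℝ P]

theorem analyticAt_polarMap {ρ c : Fin 3 → P × C3 → ℝ} {q : P × C3}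
    (hρ : ∀ j, AnalyticAt ℝ (ρ j) q) (hc : ∀ j, AnalyticAt ℝ (c j) q) :
    AnalyticAt ℝ (polarMap ρ c) q := by
  refine analyticAt_iff_coords.2 fun j => ?_
  have hx : AnalyticAt ℝ (fun q : P × C3 => (q.2 j).re) q := analyticAt_snd.re_coord j
  have hy : AnalyticAt ℝ (fun q : P × C3 => (q.2 j).im) q := analyticAt_snd.im_coord j
  have hs : AnalyticAt ℝ (fun q => sin (c j q)) q := Real.analyticAt_sin.comp (hc j)
  have hk : AnalyticAt ℝ (fun q => cos (c j q)) q := Real.analyticAt_cos.comp (hc j)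
  simp only [polarMap_re, polarMap_im]
  exact ⟨(hρ j).mul ((hk.mul hx).sub (hs.mul hy)), (hρ j).mul ((hs.mul hx).add (hk.mul hy))⟩

/-- In polar coordinates the primitive is action times d(angle): a radial change contributes no
differential of ρ, and a rotation adds the new action times dc. -/
theorem om_polarMap {ρ c : Fin 3 → P × C3 → ℝ} {q : P × C3}
    (hρ : ∀ j, AnalyticAt ℝ (ρ j) q) (hc : ∀ j, AnalyticAt ℝ (c j) q) (δ : P × C3) :
    om (polarMap ρ c q) (fderiv ℝ (polarMap ρ c) q δ) =
      ∑ j, (ρ j q ^ 2 * ((q.2 j).re * (δ.2 j).im - (q.2 j).im * (δ.2 j).re) +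
        2 * (ρ j q ^ 2 * act q.2 j) * fderiv ℝ (c j) q δ) := by
  rw [om_apply]
  refine Finset.sum_congr rfl fun j _ => ?_
  have hd := (analyticAt_polarMap hρ hc).differentiableAt.hasFDerivAt
  have hre : (fderiv ℝ (polarMap ρ c) q δ j).re =
      fderiv ℝ (fun q => (polarMap ρ c q j).re) q δ := by
    have : HasFDerivAt (fun q => (polarMap ρ c q j).re)
      ((reC j).comp (fderiv ℝ (polarMap ρ c) q)) q := (reC j).hasFDerivAt.comp q hd
    rw [this.fderiv]; rfl
  have him : (fderiv ℝ (polarMap ρ c) q δ j).im =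
      fderiv ℝ (fun q => (polarMap ρ c q j).im) q δ := by
    have : HasFDerivAt (fun q => (polarMap ρ c q j).im)
      ((imC j).comp (fderiv ℝ (polarMap ρ c) q)) q := (imC j).hasFDerivAt.comp q hd
    rw [this.fderiv]; rfl
  have hx : HasFDerivAt (fun q : P × C3 => (q.2 j).re)
      ((reC j).comp (ContinuousLinearMap.snd ℝ P C3)) q :=
    ((reC j).comp (ContinuousLinearMap.snd ℝ P C3)).hasFDerivAt
  have hy : HasFDerivAt (fun q : P × C3 => (q.2 j).im)
      ((imC j).comp (ContinuousLinearMap.snd ℝ P C3)) q :=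
    ((imC j).comp (ContinuousLinearMap.snd ℝ P C3)).hasFDerivAt
  rw [hre, him, polarMap_re, polarMap_im]
  simp only [polarMap_re, polarMap_im]
  rw [wronskian_polar (hρ j).differentiableAt (hc j).differentiableAt hx.differentiableAt
    hy.differentiableAt, hx.fderiv, hy.fderiv]
  simp only [ContinuousLinearMap.comp_apply, ContinuousLinearMap.coe_snd', reC_apply, imC_apply,
    act]
  ring

end PolarMap

/-! ### The action variable near the origin: quotients by the old actions and differential -/

section Straightening

open Filter Topology MeasureTheory C3

variable {P : Type*} {Ω : Set P} {ε : ℝ}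

theorem zero_mem_tube (hε : 0 < ε) {p : P} (hp : p ∈ Ω) :
    ((p, 0) : P × C3) ∈ Ω ×ˢ Metric.ball (0 : C3) ε := ⟨hp, Metric.mem_ball_self hε⟩

variable [NormedAddCommGroup P] [NormedSpace ℝ P]
  {N : P × C3 → C3}

namespace EquivariantFamily

/-- The new action T vanishes where the first coordinate does, and J - T where the second does; both
are torus invariant, so `exists_action_factor` divides them. The square roots of the quotients will
be the rescalings; the values at the origin are limits along the axes, where T is known, and make
the quotients positive nearby. -/
theorem exists_factors (hN : EquivariantFamily Ω ε N) (hε : 0 < ε) :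
    ∃ τ₀ τ₁ : P × C3 → ℝ, AnalyticOnNhd ℝ τ₀ (Ω ×ˢ Metric.ball (0 : C3) ε) ∧
      AnalyticOnNhd ℝ τ₁ (Ω ×ˢ Metric.ball (0 : C3) ε) ∧
      (∀ q ∈ Ω ×ˢ Metric.ball (0 : C3) ε, newAction N q = τ₀ q * act q.2 0 ∧
        act q.2 0 + act q.2 1 - newAction N q = τ₁ q * act q.2 1) ∧
      ∀ p ∈ Ω, τ₀ (p, 0) = 1 ∧ τ₁ (p, 0) = 1 := by
  have hT := hN.analyticOnNhd_newAction
  have hact : ∀ (q : P × C3) (j : Fin 3), AnalyticAt ℝ (fun q : P × C3 => act q.2 j) q :=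
    fun q j => analyticAt_snd.act_coord j
  obtain ⟨τ₀, h1, h2⟩ := exists_action_factor hN.isOpen 0 hT
    (fun q hq => hN.fderiv_newAction_sng hq 0) (fun q _ h => newAction_eq_zero h)
  obtain ⟨τ₁, h3, h4⟩ := exists_action_factor hN.isOpen 1
    (T := fun q => act q.2 0 + act q.2 1 - newAction N q)
    (fun q hq => ((hact q 0).add (hact q 1)).sub (hT q hq))
    (fun q hq => by
      rw [← gen_single]
      refine fderiv_gen_of_invariant (g := fun q => act q.2 0 + act q.2 1 - newAction N q)
        (((hact q 0).add (hact q 1)).sub (hT q hq)).differentiableAt fun r => ?_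
      simp only
      rw [hN.newAction_tor hq, act_tor, act_tor])
    (fun q hq h => by
      rw [hN.newAction_of_eq_zero hq h]
      simp [act, h])
  refine ⟨τ₀, τ₁, h1, h3, fun q hq => ⟨h2 q hq, h4 q hq⟩, fun p hp => ?_⟩
  have hmem := zero_mem_tube hε hp
  constructor
  · refine eq_of_eq_along_line (G := fun _ => 1) (h1 _ hmem).continuousAt continuousAt_const
      (sng 0 1) ?_
    filter_upwards [self_mem_nhdsWithin, eventually_mem_tube_along_line hN.isOpen hmem (sng 0 1)]
      with r hr hr2
    have h5 := h2 _ hr2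
    rw [hN.newAction_of_eq_zero hr2 (by simp [sng_of_ne])] at h5
    have h6 : act (0 + r • sng 0 1) 0 ≠ 0 := by
      have : r ≠ 0 := hr
      simpa [act] using this
    exact (mul_right_cancel₀ h6 (by rw [one_mul]; exact h5)).symm
  · refine eq_of_eq_along_line (G := fun _ => 1) (h3 _ hmem).continuousAt continuousAt_const
      (sng 1 1) ?_
    filter_upwards [self_mem_nhdsWithin, eventually_mem_tube_along_line hN.isOpen hmem (sng 1 1)]
      with r hr hr2
    have h5 := h4 _ hr2
    simp only at h5
    have h0 : (0 + r • sng 1 1 : C3) 0 = 0 := by simp [sng_of_ne]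
    rw [newAction_eq_zero (q := (p, 0 + r • sng 1 1)) h0] at h5
    have h6 : act (0 + r • sng 1 1) 1 ≠ 0 := by
      have : r ≠ 0 := hr
      simpa [act] using this
    have h7 : act (0 + r • sng 1 1) 0 = 0 := by rw [act, h0]; simp
    rw [h7, zero_add, sub_zero] at h5
    exact (mul_right_cancel₀ h6 (by rw [one_mul]; exact h5)).symm

/-- Torus invariance lets dT be expanded in the differentials of the actions. Since `D 0 - D 1` is 1
at the origin, it may be used as a denominator when solving for the angles. -/
theorem exists_fderiv_newAction (hN : EquivariantFamily Ω ε N) (hε : 0 < ε) :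
    ∃ D : Fin 3 → P × C3 → ℝ, (∀ j, AnalyticOnNhd ℝ (D j) (Ω ×ˢ Metric.ball (0 : C3) ε)) ∧
      (∀ q ∈ Ω ×ˢ Metric.ball (0 : C3) ε, ∀ δ : P × C3, fderiv ℝ (newAction N) q δ =
        fderiv ℝ (newAction N) q (δ.1, 0) + ∑ j, D j q * dact q.2 j δ.2) ∧
      ∀ p ∈ Ω, D 0 (p, 0) = 1 ∧ D 1 (p, 0) = 0 := by
  have hT := hN.analyticOnNhd_newAction
  obtain ⟨D, h1, h2⟩ := exists_radial_coefficients hN.isOpen (h := fderiv ℝ (newAction N))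
    hT.fderiv (fun q hq j => hN.fderiv_newAction_sng hq j)
  refine ⟨D, h1, h2, fun p hp => ?_⟩
  have hmem := zero_mem_tube hε hp
  -- the derivative of the new action along a line
  have hline : ∀ q ∈ Ω ×ˢ Metric.ball (0 : C3) ε, ∀ v : C3,
      HasDerivAt (fun s : ℝ => newAction N (q.1, q.2 + s • v))
        (fderiv ℝ (newAction N) q (0, v)) 0 := by
    intro q hq v
    have h3 : HasDerivAt (fun s : ℝ => ((q.1, q.2 + s • v) : P × C3)) (0, v) 0 := by
      refine (hasDerivAt_const _ _).prodMk ?_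
      simpa using ((hasDerivAt_id (0 : ℝ)).smul_const v).const_add q.2
    have h4 : HasFDerivAt (newAction N) (fderiv ℝ (newAction N) q) (q.1, q.2 + (0 : ℝ) • v) := by
      simpa using (hT q hq).differentiableAt.hasFDerivAt
    exact h4.comp_hasDerivAt (0 : ℝ) h3
  constructor
  · refine eq_of_eq_along_line (G := fun _ => 1) (h1 0 _ hmem).continuousAt continuousAt_const
      (sng 0 1) ?_
    filter_upwards [self_mem_nhdsWithin, eventually_mem_tube_along_line hN.isOpen hmem (sng 0 1)]
      with r hr hr2
    set q : P × C3 := (p, 0 + r • sng 0 1) with hq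
    have h3 := h2 q hr2 (0, sng 0 1)
    rw [← Prod.zero_eq_mk, map_zero, zero_add, Fin.sum_univ_three] at h3
    have h4 : ∀ᶠ s in 𝓝 (0 : ℝ), newAction N (q.1, q.2 + s • sng 0 1) = (r + s) ^ 2 / 2 := by
      have hc : ContinuousAt (fun s : ℝ => ((q.1, q.2 + s • sng 0 1) : P × C3)) 0 := by fun_prop
      have h5 : ∀ᶠ s in 𝓝 (0 : ℝ), ((q.1, q.2 + s • sng 0 1) : P × C3) ∈
          Ω ×ˢ Metric.ball (0 : C3) ε := by
        refine hc.eventually ?_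
        simp only [zero_smul, add_zero]
        exact (hN.isOpen.prod Metric.isOpen_ball).mem_nhds hr2
      filter_upwards [h5] with s hs
      rw [hN.newAction_of_eq_zero hs (by simp [hq, sng_of_ne])]
      simp [hq, act]
    have h6 : HasDerivAt (fun s : ℝ => (r + s) ^ 2 / 2) r 0 := by
      have := (((hasDerivAt_id (0 : ℝ)).const_add r).pow 2).div_const 2
      simpa using this
    rw [(hline q hr2 (sng 0 1)).unique (h6.congr_of_eventuallyEq h4)] at h3
    have hr' : r ≠ 0 := hr
    simp [dact_apply, hq, sng_of_ne] at h3
    simp only [hq, zero_add] at h3 ⊢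
    field_simp at h3
    exact h3.symm
  · refine eq_of_eq_along_line (G := fun _ => 0) (h1 1 _ hmem).continuousAt continuousAt_const
      (sng 1 1) ?_
    filter_upwards [self_mem_nhdsWithin, eventually_mem_tube_along_line hN.isOpen hmem (sng 1 1)]
      with r hr hr2
    set q : P × C3 := (p, 0 + r • sng 1 1) with hq
    have h3 := h2 q hr2 (0, sng 1 1)
    rw [← Prod.zero_eq_mk, map_zero, zero_add, Fin.sum_univ_three] at h3
    have h4 : ∀ s : ℝ, newAction N (q.1, q.2 + s • sng 1 1) = 0 := fun s =>
      newAction_eq_zero (by simp [hq, sng_of_ne])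
    have h5 := hline q hr2 (sng 1 1)
    simp only [h4] at h5
    rw [h5.unique (hasDerivAt_const _ _)] at h3
    have hr' : r ≠ 0 := hr
    simp [dact_apply, hq, sng_of_ne] at h3
    simp only [hq, zero_add]
    rcases h3 with h3 | h3
    · exact h3
    · exact absurd h3 hr'

end EquivariantFamily

end Straightening

/-! ### The rescaling and the angles that make an equivariant family symplectic -/

section Straightening

open Filter Topology MeasureTheory C3

variable {P : Type*} [NormedAddCommGroup P] [NormedSpace ℝ P] {Ω : Set P} {ε : ℝ}
  {N : P × C3 → C3}

theorem AnalyticAt.real_sqrt {E : Type*} [NormedAddCommGroup E] [NormedSpace ℝ E] {f : E → ℝ}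
    {q : E} (hf : AnalyticAt ℝ f q) (h : 0 < f q) : AnalyticAt ℝ (fun q => √(f q)) q := by
  have h1 : AnalyticAt ℝ Real.sqrt (f q) :=
    (Real.contDiffAt_sqrt h.ne').analyticAt
  exact h1.comp hf

namespace EquivariantFamily

/-- The first correcting form kills the generators of the torus action. -/
theorem exists_angle_corrections (hN : EquivariantFamily Ω ε N) (τ₀ τ₁ : P × C3 → ℝ)
    (hτ₀ : AnalyticOnNhd ℝ τ₀ (Ω ×ˢ Metric.ball (0 : C3) ε))
    (hτ₁ : AnalyticOnNhd ℝ τ₁ (Ω ×ˢ Metric.ball (0 : C3) ε))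
    (hτ : ∀ q ∈ Ω ×ˢ Metric.ball (0 : C3) ε, newAction N q = τ₀ q * act q.2 0 ∧
        act q.2 0 + act q.2 1 - newAction N q = τ₁ q * act q.2 1) :
    ∃ (b : Fin 3 → P × C3 → ℝ) (γ : P × C3 → P →L[ℝ] ℝ),
      (∀ j, AnalyticOnNhd ℝ (b j) (Ω ×ˢ Metric.ball (0 : C3) ε)) ∧
      AnalyticOnNhd ℝ γ (Ω ×ˢ Metric.ball (0 : C3) ε) ∧
      ∀ q ∈ Ω ×ˢ Metric.ball (0 : C3) ε, ∀ δ : P × C3,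
        (∑ j, ![τ₀ q, τ₁ q, 1] j * (1 / 2 * ((q.2 j).re * (δ.2 j).im - (q.2 j).im * (δ.2 j).re))) -
          pullbackPrimitive N q δ + fderiv ℝ (rotPrimitive (angularDensity N)) q δ =
        γ q δ.1 + ∑ j, b j q * dact q.2 j δ.2 := by
  set τ : Fin 3 → P × C3 → ℝ := ![τ₀, τ₁, fun _ => 1] with hτdef
  have hτa : ∀ j, AnalyticOnNhd ℝ (τ j) (Ω ×ˢ Metric.ball (0 : C3) ε) := by
    intro j
    fin_cases j
    · exact hτ₀
    · exact hτ₁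
    · exact fun _ _ => analyticAt_const
  have hτv : ∀ q j, ![τ₀ q, τ₁ q, 1] j = τ j q := fun q j => by fin_cases j <;> rfl
  set ω : Fin 3 → P × C3 → P × C3 →L[ℝ] ℝ := fun j q =>
    ((1 / 2 * (q.2 j).re) • imC j - (1 / 2 * (q.2 j).im) • reC j).comp
      (ContinuousLinearMap.snd ℝ P C3) with hω
  have hωa : ∀ j q, AnalyticAt ℝ (ω j) q := fun j q => by
    refine AnalyticAt.clm_comp_fun (AnalyticAt.sub ?_ ?_) analyticAt_const
    · exact (analyticAt_const.mul (analyticAt_snd.re_coord j)).smul analyticAt_const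
    · exact (analyticAt_const.mul (analyticAt_snd.im_coord j)).smul analyticAt_const
  have hωv : ∀ j q δ, ω j q δ =
      1 / 2 * ((q.2 j).re * (δ.2 j).im - (q.2 j).im * (δ.2 j).re) := fun j q δ => by
    simp [hω]; ring
  -- The defect of N*θ from the form with the squared radii τ; the exact term removes the
  -- oscillation of the angular density along `dir0`. In the direction `dir0` the terms are T, minus
  -- the density, and density minus T; in `dir01` they are T + (J - T), minus J, and 0; in `dir2`
  -- they are the third action, minus itself, and 0. So h kills all generators.
  set h : P × C3 → P × C3 →L[ℝ] ℝ := fun q =>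
    (∑ j, τ j q • ω j q) - pullbackPrimitive N q + fderiv ℝ (rotPrimitive (angularDensity N)) q
    with hh
  have hv : ∀ q δ, h q δ = (∑ j, τ j q * (1 / 2 * ((q.2 j).re * (δ.2 j).im -
      (q.2 j).im * (δ.2 j).re))) - pullbackPrimitive N q δ +
        fderiv ℝ (rotPrimitive (angularDensity N)) q δ := fun q δ => by
    simp only [hh, add_apply, sub_apply, sum_apply, smul_apply, smul_eq_mul, hωv]
  have hσ := analyticOnNhd_rotPrimitive hN.analyticOnNhd_angularDensity
  have hha : AnalyticOnNhd ℝ h (Ω ×ˢ Metric.ball (0 : C3) ε) := fun q hq =>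
    ((Finset.analyticAt_fun_sum _ fun j _ => (hτa j q hq).smul (hωa j q)).sub
      (hN.analytic q hq).pullbackPrimitive).add (hσ q hq).fderiv
  have hgen : ∀ q (d : Fin 3 → ℝ), (∑ j, τ j q * (1 / 2 * ((q.2 j).re * (gen d q.2 j).im -
      (q.2 j).im * (gen d q.2 j).re))) = ∑ j, d j * (τ j q * act q.2 j) := fun q d => by
    refine Finset.sum_congr rfl fun j _ => ?_
    simp [gen_apply, act]
    ring
  have hd0 : ∀ q ∈ Ω ×ˢ Metric.ball (0 : C3) ε, h q (0, gen dir0 q.2) = 0 := fun q hq => by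
    rw [hv, fderiv_rotPrimitive hN.analyticOnNhd_angularDensity hq, hgen, Fin.sum_univ_three]
    have h1 : pullbackPrimitive N q (0, gen dir0 q.2) = angularDensity N q := rfl
    have h2 : rotAverage (angularDensity N) q = newAction N q := rfl
    rw [h1, h2, (hτ q hq).1]
    simp [dir0, hτdef]
  have hd01 : ∀ q ∈ Ω ×ˢ Metric.ball (0 : C3) ε, h q (0, gen dir01 q.2) = 0 := fun q hq => by
    rw [hv, hgen, Fin.sum_univ_three, hN.pullbackPrimitive_dir01 hq,
      fderiv_gen_of_invariant (hσ q hq).differentiableAt fun r =>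
        rotPrimitive_tor_of_invariant fun s => hN.angularDensity_dir01 (tor_mem_tube hq s) r]
    have h1 := (hτ q hq).1
    have h2 := (hτ q hq).2
    simp [dir01, hτdef]
    linarith
  have hd2 : ∀ q ∈ Ω ×ˢ Metric.ball (0 : C3) ε, h q (0, gen dir2 q.2) = 0 := fun q hq => by
    rw [hv, hgen, Fin.sum_univ_three, hN.pullbackPrimitive_dir2 hq,
      fderiv_gen_of_invariant (hσ q hq).differentiableAt fun r =>
        rotPrimitive_tor_of_invariant fun s => hN.angularDensity_dir2 (tor_mem_tube hq s) r]
    simp [dir2, hτdef]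
  obtain ⟨b, hb1, hb2⟩ := exists_radial_coefficients hN.isOpen hha (fun q hq j => by
    have h0 := hd0 q hq
    have h2 := hd2 q hq
    have h01 := hd01 q hq
    rw [gen_dir0] at h0
    rw [gen_dir2] at h2
    -- The second plane has no symmetry of its own; its generator is the difference of those of
    -- `dir01` and `dir0`.
    have h3 : ((0, gen dir01 q.2) : P × C3) =
        (0, sng 0 (Complex.I * q.2 0)) + (0, sng 1 (Complex.I * q.2 1)) := by
      rw [gen_dir01]; simp
    rw [h3, map_add, h0, zero_add] at h01
    fin_cases j
    · exact h0
    · exact h01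
    · exact h2)
  refine ⟨b, fun q => (h q).comp (ContinuousLinearMap.inl ℝ P C3), hb1,
    fun q hq => (hha q hq).clm_comp_fun analyticAt_const, fun q hq δ => ?_⟩
  have h1 := hb2 q hq δ
  rw [hv] at h1
  simp only [hτv]
  exact h1

/-- Any equivariant family is made symplectic by a rescaling and a rotation of each plane. -/
theorem exists_symplectic_rescaling (hN : EquivariantFamily Ω ε N) (hε : 0 < ε) {C : Set P}
    (hC : IsCompact C) (hCΩ : C ⊆ Ω) :
    ∃ (Ω' : Set P) (ε' : ℝ) (Φ : P × C3 → C3) (S : P × C3 → ℝ) (γ : P × C3 → P →L[ℝ] ℝ),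
      IsOpen Ω' ∧ C ⊆ Ω' ∧ 0 < ε' ∧ ∀ q ∈ Ω' ×ˢ Metric.ball (0 : C3) ε',
        q ∈ Ω ×ˢ Metric.ball (0 : C3) ε ∧
        AnalyticAt ℝ Φ q ∧ AnalyticAt ℝ S q ∧ AnalyticAt ℝ γ q ∧
        (∀ δ, pullbackPrimitive Φ q δ = pullbackPrimitive N q δ + fderiv ℝ S q δ + γ q δ.1) ∧
        act (Φ q) 0 = newAction N q ∧
        act (Φ q) 1 = act q.2 0 + act q.2 1 - newAction N q ∧
        act (Φ q) 2 = act q.2 2 := by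
  obtain ⟨τ₀, τ₁, hτ₀, hτ₁, hτ, hτ1⟩ := hN.exists_factors hε
  obtain ⟨D, hDa, hD, hD1⟩ := hN.exists_fderiv_newAction hε
  obtain ⟨b, γ₀, hb, hγ₀, hform⟩ := hN.exists_angle_corrections τ₀ τ₁ hτ₀ hτ₁ hτ
  have hT := hN.analyticOnNhd_newAction
  have hσ := analyticOnNhd_rotPrimitive hN.analyticOnNhd_angularDensity
  have hsmall : ∀ p ∈ C, ∀ᶠ q in 𝓝 (p, (0 : C3)), (q ∈ Ω ×ˢ Metric.ball (0 : C3) ε) ∧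
      0 < τ₀ q ∧ 0 < τ₁ q ∧ 0 < D 0 q - D 1 q := by
    intro p hp
    have hm := zero_mem_tube hε (hCΩ hp)
    have h1 : ∀ᶠ q in 𝓝 (p, (0 : C3)), 0 < τ₀ q :=
      (hτ₀ _ hm).continuousAt.eventually_const_lt (by rw [(hτ1 p (hCΩ hp)).1]; exact one_pos)
    have h2 : ∀ᶠ q in 𝓝 (p, (0 : C3)), 0 < τ₁ q :=
      (hτ₁ _ hm).continuousAt.eventually_const_lt (by rw [(hτ1 p (hCΩ hp)).2]; exact one_pos)
    have h3 : ∀ᶠ q in 𝓝 (p, (0 : C3)), 0 < D 0 q - D 1 q :=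
      ((hDa 0 _ hm).sub (hDa 1 _ hm)).continuousAt.eventually_const_lt (by
        simp [(hD1 p (hCΩ hp)).1, (hD1 p (hCΩ hp)).2])
    filter_upwards [(hN.isOpen.prod Metric.isOpen_ball).mem_nhds hm, h1, h2, h3]
      with q g0 g1 g2 g3 using ⟨g0, g1, g2, g3⟩
  obtain ⟨Ω', ε', hΩ', hCΩ', hε', hq'⟩ := exists_tube_of_eventually hC hsmall
  -- The angles must satisfy c₀ dT + c₁ d(J - T) + c₂ d(act 2) = ∑ b_j d(act j) in the directions of
  -- z. With c₀ = κ + c₁ this is the linear system κ D₀ + c₁ = b₀, κ D₁ + c₁ = b₁, κ D₂ + c₂ = b₂.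
  set κ : P × C3 → ℝ := fun q => (b 0 q - b 1 q) / (D 0 q - D 1 q) with hκ
  set c₁ : P × C3 → ℝ := fun q => b 0 q - κ q * D 0 q with hc₁
  set c₀ : P × C3 → ℝ := fun q => κ q + c₁ q with hc₀
  set c₂ : P × C3 → ℝ := fun q => b 2 q - κ q * D 2 q with hc₂
  set T := newAction N with hTdef
  set σ := rotPrimitive (angularDensity N) with hσdef
  set ρ : Fin 3 → P × C3 → ℝ := ![fun q => √(τ₀ q), fun q => √(τ₁ q), fun _ => 1] with hρ
  set c : Fin 3 → P × C3 → ℝ := ![c₀, c₁, c₂] with hc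
  -- By `om_polarMap` the rotations contribute T dc₀ + (J - T) dc₁ + (act 2) dc₂. The Leibniz rule
  -- turns this into an exact form minus the combination solved for above; its component along Λ
  -- remains, in the form -κ ∂T/∂Λ.
  refine ⟨Ω', ε', polarMap ρ c, fun q => T q * c₀ q + (act q.2 0 + act q.2 1 - T q) * c₁ q +
      act q.2 2 * c₂ q - σ q,
    fun q => γ₀ q - κ q • (fderiv ℝ T q).comp (ContinuousLinearMap.inl ℝ P C3),
    hΩ', hCΩ', hε', fun q hq => ?_⟩
  obtain ⟨hqD, hp0, hp1, hpD⟩ := hq' q hq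
  have aκ : AnalyticAt ℝ κ q := ((hb 0 q hqD).sub (hb 1 q hqD)).div
    ((hDa 0 q hqD).sub (hDa 1 q hqD)) hpD.ne'
  have a1 : AnalyticAt ℝ c₁ q := (hb 0 q hqD).sub (aκ.mul (hDa 0 q hqD))
  have a0 : AnalyticAt ℝ c₀ q := aκ.add a1
  have a2 : AnalyticAt ℝ c₂ q := (hb 2 q hqD).sub (aκ.mul (hDa 2 q hqD))
  have aT : AnalyticAt ℝ T q := hT q hqD
  have aσ : AnalyticAt ℝ σ q := hσ q hqD
  have aρ : ∀ j, AnalyticAt ℝ (ρ j) q := by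
    intro j
    fin_cases j
    · exact (hτ₀ q hqD).real_sqrt hp0
    · exact (hτ₁ q hqD).real_sqrt hp1
    · exact analyticAt_const
  have ac : ∀ j, AnalyticAt ℝ (c j) q := by
    intro j
    fin_cases j
    · exact a0
    · exact a1
    · exact a2
  have hact : ∀ (q : P × C3) (j : Fin 3), AnalyticAt ℝ (fun q : P × C3 => act q.2 j) q :=
    fun q j => analyticAt_snd.act_coord j
  have hdact : ∀ j, HasFDerivAt (fun q : P × C3 => act q.2 j)
      ((dact q.2 j).comp (ContinuousLinearMap.snd ℝ P C3)) q := fun j =>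
    (hasFDerivAt_act q.2 j).comp q (ContinuousLinearMap.snd ℝ P C3).hasFDerivAt
  have hρ0 : ρ 0 q ^ 2 = τ₀ q := Real.sq_sqrt hp0.le
  have hρ1 : ρ 1 q ^ 2 = τ₁ q := Real.sq_sqrt hp1.le
  have hρ2 : ρ 2 q ^ 2 = 1 := one_pow 2
  refine ⟨hqD, analyticAt_polarMap aρ ac, ?_, ?_, fun δ => ?_, ?_, ?_, ?_⟩
  · exact (((aT.mul a0).add ((((hact q 0).add (hact q 1)).sub aT).mul a1)).add
      ((hact q 2).mul a2)).sub aσ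
  · exact (hγ₀ q hqD).sub (aκ.smul (aT.fderiv.clm_comp_fun analyticAt_const))
  · rw [pullbackPrimitive_apply, om_polarMap aρ ac, Fin.sum_univ_three, hρ0, hρ1, hρ2]
    have hS := ((((aT.differentiableAt.hasFDerivAt.mul a0.differentiableAt.hasFDerivAt)).add
      ((((hdact 0).add (hdact 1)).sub aT.differentiableAt.hasFDerivAt).mul
        a1.differentiableAt.hasFDerivAt)).add
      ((hdact 2).mul a2.differentiableAt.hasFDerivAt)).sub aσ.differentiableAt.hasFDerivAt
    have hS' : fderiv ℝ (fun q => T q * c₀ q + (act q.2 0 + act q.2 1 - T q) * c₁ q +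
      act q.2 2 * c₂ q - σ q) q = _ := hS.fderiv
    have h1 := hform q hqD δ
    have h2 := hD q hqD δ
    rw [Fin.sum_univ_three] at h1 h2
    rw [Fin.sum_univ_three] at h1
    rw [hS']
    have e0 : c 0 = c₀ := rfl
    have e1 : c 1 = c₁ := rfl
    have e2 : c 2 = c₂ := rfl
    simp only [add_apply, sub_apply, smul_apply, smul_eq_mul, ContinuousLinearMap.comp_apply,
      ContinuousLinearMap.coe_snd', ContinuousLinearMap.inl_apply, Pi.add_apply,
      Pi.sub_apply, e0, e1, e2]
    simp only [Matrix.cons_val_zero, Matrix.cons_val_one, Matrix.cons_val] at h1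
    have ht0 := (hτ q hqD).1
    have ht1 := (hτ q hqD).2
    rw [← ht0, ← ht1]
    have hk : κ q * (D 0 q - D 1 q) = b 0 q - b 1 q := div_mul_cancel₀ _ hpD.ne'
    have k0 : c₀ q = κ q + c₁ q := rfl
    have k1 : c₁ q = b 0 q - κ q * D 0 q := rfl
    have k2 : c₂ q = b 2 q - κ q * D 2 q := rfl
    linear_combination h1 - fderiv ℝ T q δ * k0 - κ q * h2 -
      (dact q.2 0 δ.2 + dact q.2 1 δ.2) * k1 - dact q.2 2 δ.2 * k2 + dact q.2 1 δ.2 * hk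
  · rw [act_polarMap, hρ0, ← (hτ q hqD).1]
  · rw [act_polarMap, hρ1, ← (hτ q hqD).2]
  · rw [act_polarMap, hρ2, one_mul]

/-- Near the origin, the actions after the rescaling determine the actions before it. -/
theorem exists_act_eq_of_newAction_eq [FiniteDimensional ℝ P] (hN : EquivariantFamily Ω ε N)
    (hε : 0 < ε) {C : Set P} (hC : IsCompact C) (hCΩ : C ⊆ Ω) :
    ∃ (Ω' : Set P) (ε' : ℝ), IsOpen Ω' ∧ C ⊆ Ω' ∧ 0 < ε' ∧
      ∀ p ∈ Ω', ∀ x ∈ Metric.ball (0 : C3) ε', ∀ x' ∈ Metric.ball (0 : C3) ε',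
        newAction N (p, x) = newAction N (p, x') → act x 0 + act x 1 = act x' 0 + act x' 1 →
        act x 2 = act x' 2 → act x 0 = act x' 0 := by
  obtain ⟨τ₀, τ₁, hτ₀, hτ₁, hτ, hτ1⟩ := hN.exists_factors hε
  have hpos : ∀ p ∈ C, ∀ᶠ q in 𝓝 (p, (0 : C3)), (q ∈ Ω ×ˢ Metric.ball (0 : C3) ε) ∧
      0 < τ₀ q ∧ 0 < τ₁ q := by
    intro p hp
    have hm := zero_mem_tube hε (hCΩ hp)
    have h1 : ∀ᶠ q in 𝓝 (p, (0 : C3)), 0 < τ₀ q :=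
      (hτ₀ _ hm).continuousAt.eventually_const_lt (by rw [(hτ1 p (hCΩ hp)).1]; exact one_pos)
    have h2 : ∀ᶠ q in 𝓝 (p, (0 : C3)), 0 < τ₁ q :=
      (hτ₁ _ hm).continuousAt.eventually_const_lt (by rw [(hτ1 p (hCΩ hp)).2]; exact one_pos)
    filter_upwards [(hN.isOpen.prod Metric.isOpen_ball).mem_nhds hm, h1, h2]
      with q g0 g1 g2 using ⟨g0, g1, g2⟩
  set ρ : Fin 3 → P × C3 → ℝ := ![fun q => √(τ₀ q), fun q => √(τ₁ q), fun _ => 1] with hρ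
  set c : Fin 3 → P × C3 → ℝ := fun _ _ => 0 with hc
  have hact : ∀ q : P × C3, (q ∈ Ω ×ˢ Metric.ball (0 : C3) ε) ∧ 0 < τ₀ q ∧ 0 < τ₁ q →
      act (polarMap ρ c q) 0 = newAction N q ∧
      act (polarMap ρ c q) 1 = act q.2 0 + act q.2 1 - newAction N q ∧
      act (polarMap ρ c q) 2 = act q.2 2 := by
    rintro q ⟨hq, h0, h1⟩
    have hρ0 : ρ 0 q ^ 2 = τ₀ q := Real.sq_sqrt h0.le
    have hρ1 : ρ 1 q ^ 2 = τ₁ q := Real.sq_sqrt h1.le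
    have hρ2 : ρ 2 q ^ 2 = 1 := one_pow 2
    rw [act_polarMap, act_polarMap, act_polarMap, hρ0, hρ1, hρ2, one_mul]
    exact ⟨(hτ q hq).1.symm, (hτ q hq).2.symm, rfl⟩
  -- Here the inverse only serves to make the pure rescaling injective near the origin.
  obtain ⟨Ω₁, ε₁, M', hΩ₁, hCΩ₁, hε₁, hinv⟩ := exists_analytic_inverse_of_norm_preserving hC
    (M := polarMap ρ c) (fun p hp => by
      obtain ⟨hm, h0, h1⟩ := (hpos p hp).self_of_nhds
      refine analyticAt_polarMap (fun j => ?_) (fun _ => analyticAt_const)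
      fin_cases j
      · exact (hτ₀ _ hm).real_sqrt h0
      · exact (hτ₁ _ hm).real_sqrt h1
      · exact analyticAt_const)
    (fun p hp => by
      filter_upwards [hpos p hp] with q hq
      refine norm_eq_of_act_sum_eq ?_
      obtain ⟨h0, h1, h2⟩ := hact q hq
      rw [Fin.sum_univ_three, Fin.sum_univ_three, h0, h1, h2]
      ring)
  obtain ⟨Ω₂, ε₂, hΩ₂, hCΩ₂, hε₂, hpos'⟩ := exists_tube_of_eventually hC hpos
  refine ⟨Ω₁ ∩ Ω₂, min ε₁ ε₂, hΩ₁.inter hΩ₂, subset_inter hCΩ₁ hCΩ₂, lt_min hε₁ hε₂,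
    fun p hp x hx x' hx' hT hJ h2 => ?_⟩
  -- the representative with nonnegative coordinates
  have hrep : ∀ x : C3, ∃ s, tor s x = WithLp.toLp 2 fun j => ((‖x j‖ : ℝ) : ℂ) := by
    intro x
    refine ⟨fun j => -Complex.arg (x j), ?_⟩
    ext j
    rw [tor_apply]
    conv_lhs => rw [← Complex.norm_mul_exp_arg_mul_I (x j)]
    simp only
    rw [mul_left_comm, ← Complex.exp_add]
    simp
  obtain ⟨s, hs⟩ := hrep x
  obtain ⟨s', hs'⟩ := hrep x'
  have hb : ∀ {y : C3}, y ∈ Metric.ball (0 : C3) (min ε₁ ε₂) → ∀ t : Fin 3 → ℝ,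
      ((p, tor t y) : P × C3) ∈ Ω₁ ×ˢ Metric.ball (0 : C3) ε₁ ∧
        ((p, tor t y) : P × C3) ∈ Ω₂ ×ˢ Metric.ball (0 : C3) ε₂ := by
    intro y hy t
    rw [mem_ball_zero_iff, lt_min_iff] at hy
    refine ⟨⟨hp.1, ?_⟩, ⟨hp.2, ?_⟩⟩ <;> rw [mem_ball_zero_iff, norm_tor]
    exacts [hy.1, hy.2]
  -- On the representatives the rescaled points have nonnegative real coordinates, so they are
  -- determined by their actions T, J - T and act 2, which agree by hypothesis and torus invariance.
  have key : polarMap ρ c (p, tor s x) = polarMap ρ c (p, tor s' x') := by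
    have hA := hact _ (hpos' _ (hb hx s).2)
    have hA' := hact _ (hpos' _ (hb hx' s').2)
    have hq : ((p, x) : P × C3) ∈ Ω ×ˢ Metric.ball (0 : C3) ε := by
      have := (hpos' _ (hb hx 0).2).1
      simpa using this
    have hq' : ((p, x') : P × C3) ∈ Ω ×ˢ Metric.ball (0 : C3) ε := by
      have := (hpos' _ (hb hx' 0).2).1
      simpa using this
    have e1 := hN.newAction_tor hq s
    have e2 := hN.newAction_tor hq' s'
    simp only [act_tor] at hA hA' e1 e2
    rw [e1] at hA
    rw [e2] at hA'
    have hacts : ∀ j, act (polarMap ρ c (p, tor s x)) j = act (polarMap ρ c (p, tor s' x')) j := by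
      intro j
      fin_cases j
      · exact (hA.1.trans hT).trans hA'.1.symm
      · refine hA.2.1.trans (Eq.trans ?_ hA'.2.1.symm)
        rw [hJ, hT]
      · exact (hA.2.2.trans h2).trans hA'.2.2.symm
    have hρnn : ∀ j q, 0 ≤ ρ j q := by
      intro j q
      fin_cases j
      · exact Real.sqrt_nonneg _
      · exact Real.sqrt_nonneg _
      · exact zero_le_one
    have hre : ∀ (y : C3) (t : Fin 3 → ℝ), (tor t y = WithLp.toLp 2 fun j => ((‖y j‖ : ℝ) : ℂ)) →
        ∀ j, 0 ≤ (polarMap ρ c (p, tor t y) j).re ∧ (polarMap ρ c (p, tor t y) j).im = 0 := by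
      intro y t ht j
      rw [polarMap_re, polarMap_im]
      simp only [ht, hc, sin_zero, cos_zero, Complex.ofReal_re, Complex.ofReal_im]
      refine ⟨?_, by ring⟩
      have := hρnn j (p, WithLp.toLp 2 fun j => ((‖y j‖ : ℝ) : ℂ))
      have h3 := norm_nonneg (y j)
      rw [one_mul, zero_mul, sub_zero]
      positivity
    ext j
    have h3 := hre x s hs j
    have h4 := hre x' s' hs' j
    refine Complex.ext ?_ (h3.2.trans h4.2.symm)
    have h5 := hacts j
    rw [act, act, h3.2, h4.2] at h5
    exact (pow_left_inj₀ h3.1 h4.1 two_ne_zero).1 (by linarith)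
  have i1 := (hinv _ (hb hx s).1).2.2.2.2.1
  have i2 := (hinv _ (hb hx' s').1).2.2.2.2.1
  simp only at i1 i2
  rw [key, i2] at i1
  rw [← act_tor s x 0, ← act_tor s' x' 0, i1]

end EquivariantFamily

end Straightening

/-! ### Symplectic straightening of a family with a two-dimensional torus symmetry -/

section StraighteningTheorem

open Filter Topology MeasureTheory C3

variable {P : Type*}

theorem tube_mono {Ω Ω' : Set P} {ε ε' : ℝ} (h : Ω ⊆ Ω') (h' : ε ≤ ε') :
    Ω ×ˢ Metric.ball (0 : C3) ε ⊆ Ω' ×ˢ Metric.ball (0 : C3) ε' :=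
  prod_mono h (Metric.ball_subset_ball h')

theorem mem_tube_of_norm_eq {Ω : Set P} {ε : ℝ} {p : P} {x y : C3}
    (h : ((p, x) : P × C3) ∈ Ω ×ˢ Metric.ball (0 : C3) ε) (hxy : ‖y‖ = ‖x‖) :
    ((p, y) : P × C3) ∈ Ω ×ˢ Metric.ball (0 : C3) ε :=
  ⟨h.1, by rw [mem_ball_zero_iff, hxy, ← mem_ball_zero_iff]; exact h.2⟩

variable [NormedAddCommGroup P] [NormedSpace ℝ P]

/-- The inverse of an equivariant family that preserves the actions is an equivariant family. -/
theorem exists_equivariantFamily_inverse [FiniteDimensional ℝ P] {C : Set P} (hC : IsCompact C)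
    {M : P × C3 → C3} (hM : ∀ p ∈ C, AnalyticAt ℝ M (p, 0))
    (h01 : ∀ q (r : ℝ), M (q.1, tor (r • dir01) q.2) = tor (r • dir01) (M q))
    (h2 : ∀ q (r : ℝ), M (q.1, tor (r • dir2) q.2) = tor (r • dir2) (M q))
    (hact : ∀ p ∈ C, ∀ᶠ q in 𝓝 (p, (0 : C3)),
      act (M q) 0 + act (M q) 1 = act q.2 0 + act q.2 1 ∧ act (M q) 2 = act q.2 2) :
    ∃ (Ω : Set P) (ε : ℝ) (N : P × C3 → C3), C ⊆ Ω ∧ 0 < ε ∧ EquivariantFamily Ω ε N ∧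
      ∀ q ∈ Ω ×ˢ Metric.ball (0 : C3) ε, AnalyticAt ℝ M q ∧ ‖M q‖ = ‖q.2‖ ∧ ‖N q‖ = ‖q.2‖ ∧
        N (q.1, M q) = q.2 ∧ M (q.1, N q) = q.2 ∧
        act (M q) 0 + act (M q) 1 = act q.2 0 + act q.2 1 ∧ act (M q) 2 = act q.2 2 := by
  obtain ⟨Ω₁, ε₁, N, hΩ₁, hCΩ₁, hε₁, hN⟩ := exists_analytic_inverse_of_norm_preserving hC hM
    (fun p hp => by
      filter_upwards [hact p hp] with q hq
      refine norm_eq_of_act_sum_eq ?_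
      rw [Fin.sum_univ_three, Fin.sum_univ_three, hq.1, hq.2])
  obtain ⟨Ω₂, ε₂, hΩ₂, hCΩ₂, hε₂, hact'⟩ := exists_tube_of_eventually hC hact
  have hm1 : (Ω₁ ∩ Ω₂) ×ˢ Metric.ball (0 : C3) (min ε₁ ε₂) ⊆ Ω₁ ×ˢ Metric.ball (0 : C3) ε₁ :=
    tube_mono inter_subset_left (min_le_left _ _)
  have hm2 : (Ω₁ ∩ Ω₂) ×ˢ Metric.ball (0 : C3) (min ε₁ ε₂) ⊆ Ω₂ ×ˢ Metric.ball (0 : C3) ε₂ :=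
    tube_mono inter_subset_right (min_le_right _ _)
  refine ⟨Ω₁ ∩ Ω₂, min ε₁ ε₂, N, subset_inter hCΩ₁ hCΩ₂, lt_min hε₁ hε₂, ?_, fun q hq => ?_⟩
  · have hequiv : ∀ d : Fin 3 → ℝ,
        (∀ q (r : ℝ), M (q.1, tor (r • d) q.2) = tor (r • d) (M q)) →
        ∀ q ∈ (Ω₁ ∩ Ω₂) ×ˢ Metric.ball (0 : C3) (min ε₁ ε₂), ∀ r : ℝ,
          N (q.1, tor (r • d) q.2) = tor (r • d) (N q) := by
      intro d hd q hq r
      obtain ⟨-, -, -, hn, -, hMN⟩ := hN q (hm1 hq)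
      have h1 := hd (q.1, N q) r
      simp only [hMN] at h1
      have h3 : ((q.1, tor (r • d) (N q)) : P × C3) ∈ Ω₁ ×ˢ Metric.ball (0 : C3) ε₁ :=
        mem_tube_of_norm_eq (hm1 hq) (by rw [norm_tor, hn])
      have h4 := (hN _ h3).2.2.2.2.1
      simp only [h1] at h4
      exact h4
    have hN2 : ∀ q ∈ (Ω₁ ∩ Ω₂) ×ˢ Metric.ball (0 : C3) (min ε₁ ε₂),
        act (N q) 0 + act (N q) 1 = act q.2 0 + act q.2 1 ∧ act (N q) 2 = act q.2 2 := by
      intro q hq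
      obtain ⟨-, -, -, hn, -, hMN⟩ := hN q (hm1 hq)
      have h1 := hact' (q.1, N q) (mem_tube_of_norm_eq (hm2 hq) hn)
      simp only [hMN] at h1
      exact ⟨h1.1.symm, h1.2.symm⟩
    exact ⟨hΩ₁.inter hΩ₂, fun q hq => (hN q (hm1 hq)).2.1, hequiv _ h01, hequiv _ h2,
      fun q hq => (hN2 q hq).1, fun q hq => (hN2 q hq).2⟩
  · obtain ⟨a1, -, a3, a4, a5, a6⟩ := hN q (hm1 hq)
    exact ⟨a1, a3, a4, a5, a6, hact' q (hm2 hq)⟩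

/-- An analytic family of maps of `ℂ³` near the origin that commutes with the two-dimensional torus
of the simultaneous rotations of the first two planes and of the rotations of the third one, and
preserves the corresponding actions, can be replaced by a symplectic one, with the same level sets of
the first action. -/
theorem exists_symplectic_straightening [FiniteDimensional ℝ P] {C : Set P} (hC : IsCompact C)
    {M : P × C3 → C3} (hM : ∀ p ∈ C, AnalyticAt ℝ M (p, 0))
    (h01 : ∀ q (r : ℝ), M (q.1, tor (r • dir01) q.2) = tor (r • dir01) (M q))
    (h2 : ∀ q (r : ℝ), M (q.1, tor (r • dir2) q.2) = tor (r • dir2) (M q))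
    (hact : ∀ p ∈ C, ∀ᶠ q in 𝓝 (p, (0 : C3)),
      act (M q) 0 + act (M q) 1 = act q.2 0 + act q.2 1 ∧ act (M q) 2 = act q.2 2) :
    ∃ (Ω : Set P) (ε : ℝ) (W Z : P × C3 → C3) (S : P × C3 → ℝ) (γ : P × C3 → P →L[ℝ] ℝ),
      IsOpen Ω ∧ C ⊆ Ω ∧ 0 < ε ∧
      (∀ q ∈ Ω ×ˢ Metric.ball (0 : C3) ε,
        AnalyticAt ℝ W q ∧ AnalyticAt ℝ Z q ∧ AnalyticAt ℝ S q ∧ AnalyticAt ℝ γ q ∧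
        ‖W q‖ = ‖q.2‖ ∧ ‖Z q‖ = ‖q.2‖ ∧ Z (q.1, W q) = q.2 ∧ W (q.1, Z q) = q.2 ∧
        act (W q) 0 + act (W q) 1 = act q.2 0 + act q.2 1 ∧ act (W q) 2 = act q.2 2 ∧
        ∀ δ, pullbackPrimitive W q δ = 1 / 2 * om q.2 δ.2 + fderiv ℝ S q δ + γ q δ.1) ∧
      ∀ p ∈ Ω, ∀ x ∈ Metric.ball (0 : C3) ε, ∀ x' ∈ Metric.ball (0 : C3) ε,
        (∀ j, act (W (p, x)) j = act (W (p, x')) j) → act (M (p, x)) 0 = act (M (p, x')) 0 := by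
  obtain ⟨Ω₁, ε₁, N, hCΩ₁, hε₁, hfam, hN⟩ := exists_equivariantFamily_inverse hC hM h01 h2 hact
  obtain ⟨Ω₂, ε₂, Φ, S, γ, hΩ₂, hCΩ₂, hε₂, hΦ⟩ :=
    hfam.exists_symplectic_rescaling hε₁ hC hCΩ₁
  obtain ⟨Ω₃, ε₃, hΩ₃, hCΩ₃, hε₃, hinj⟩ := hfam.exists_act_eq_of_newAction_eq hε₁ hC hCΩ₁
  set G : P × C3 → P × C3 := fun q => (q.1, M q) with hG
  -- Pulling back Φ*θ = N*θ + dS + γ dΛ by `G` gives W*θ = θ + d(S ∘ G) + (γ ∘ G) dΛ, since N ∘ G is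
  -- the projection to z and `G` fixes Λ.
  set W : P × C3 → C3 := fun q => Φ (G q) with hW
  have hG2 : ∀ q ∈ Ω₂ ×ˢ Metric.ball (0 : C3) ε₂, G q ∈ Ω₂ ×ˢ Metric.ball (0 : C3) ε₂ := by
    intro q hq
    exact mem_tube_of_norm_eq (p := q.1) (x := q.2) hq (hN q (hΦ q hq).1).2.1
  have hGa : ∀ q ∈ Ω₂ ×ˢ Metric.ball (0 : C3) ε₂, AnalyticAt ℝ G q := fun q hq =>
    analyticAt_fst.prod (hN q (hΦ q hq).1).1
  have hWa : ∀ q ∈ Ω₂ ×ˢ Metric.ball (0 : C3) ε₂, AnalyticAt ℝ W q := fun q hq =>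
    AnalyticAt.comp (hΦ _ (hG2 q hq)).2.1 (hGa q hq)
  have hWact : ∀ q ∈ Ω₂ ×ˢ Metric.ball (0 : C3) ε₂,
      act (W q) 0 + act (W q) 1 = act q.2 0 + act q.2 1 ∧ act (W q) 2 = act q.2 2 := by
    intro q hq
    obtain ⟨-, -, -, -, -, a0, a1, a2⟩ := hΦ _ (hG2 q hq)
    obtain ⟨-, -, -, -, -, b1, b2⟩ := hN q (hΦ q hq).1
    refine ⟨?_, a2.trans b2⟩
    rw [← b1]
    simp only [hW]
    rw [a0, a1]
    simp only [hG]
    ring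
  have hWn : ∀ q ∈ Ω₂ ×ˢ Metric.ball (0 : C3) ε₂, ‖W q‖ = ‖q.2‖ := by
    intro q hq
    refine norm_eq_of_act_sum_eq ?_
    rw [Fin.sum_univ_three, Fin.sum_univ_three, (hWact q hq).1, (hWact q hq).2]
  obtain ⟨Ω₄, ε₄, Z, hΩ₄, hCΩ₄, hε₄, hZ⟩ := exists_analytic_inverse_of_norm_preserving hC
    (M := W) (fun p hp => hWa _ (zero_mem_tube hε₂ (hCΩ₂ hp)))
    (fun p hp => eventually_of_mem_tube hΩ₂ hCΩ₂ hε₂ hWn hp)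
  set ε : ℝ := min (min ε₂ ε₃) ε₄ with hε
  have hsub2 : (Ω₂ ∩ Ω₃ ∩ Ω₄) ×ˢ Metric.ball (0 : C3) ε ⊆ Ω₂ ×ˢ Metric.ball (0 : C3) ε₂ :=
    tube_mono (fun _ h => h.1.1) ((min_le_left _ _).trans (min_le_left _ _))
  have hsub4 : (Ω₂ ∩ Ω₃ ∩ Ω₄) ×ˢ Metric.ball (0 : C3) ε ⊆ Ω₄ ×ˢ Metric.ball (0 : C3) ε₄ :=
    tube_mono (fun _ h => h.2) (min_le_right _ _)
  refine ⟨Ω₂ ∩ Ω₃ ∩ Ω₄, ε, W, Z, fun q => S (G q), fun q => γ (G q),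
    (hΩ₂.inter hΩ₃).inter hΩ₄, subset_inter (subset_inter hCΩ₂ hCΩ₃) hCΩ₄,
    lt_min (lt_min hε₂ hε₃) hε₄, fun q hq => ?_, fun p hp x hx x' hx' h => ?_⟩
  · obtain ⟨c1, c2, c3, c4, c5, c6⟩ := hZ q (hsub4 hq)
    have hq2 := hsub2 hq
    obtain ⟨hGq, a1, a2, a3, a4, -⟩ := hΦ _ (hG2 q hq2)
    refine ⟨c1, c2, AnalyticAt.comp a2 (hGa q hq2), AnalyticAt.comp a3 (hGa q hq2), c3, c4, c5, c6,
      (hWact q hq2).1, (hWact q hq2).2, fun δ => ?_⟩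
    have hGd : HasFDerivAt G (fderiv ℝ G q) q := (hGa q hq2).differentiableAt.hasFDerivAt
    have hG1 : (fderiv ℝ G q δ).1 = δ.1 := by
      have h1 : HasFDerivAt (fun q => (G q).1)
        ((ContinuousLinearMap.fst ℝ P C3).comp (fderiv ℝ G q)) q := hGd.fst
      have h3 := h1.unique hasFDerivAt_fst
      exact congrArg (fun L => L δ) h3
    have hWd : fderiv ℝ W q δ = fderiv ℝ Φ (G q) (fderiv ℝ G q δ) := by
      have : HasFDerivAt W ((fderiv ℝ Φ (G q)).comp (fderiv ℝ G q)) q :=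
        a1.differentiableAt.hasFDerivAt.comp q hGd
      rw [this.fderiv]; rfl
    have hSd : fderiv ℝ (fun q => S (G q)) q δ = fderiv ℝ S (G q) (fderiv ℝ G q δ) := by
      have : HasFDerivAt (fun q => S (G q)) ((fderiv ℝ S (G q)).comp (fderiv ℝ G q)) q :=
        a2.differentiableAt.hasFDerivAt.comp q hGd
      rw [this.fderiv]; rfl
    have hNd : fderiv ℝ N (G q) (fderiv ℝ G q δ) = δ.2 := by
      have h1 : HasFDerivAt (fun q => N (G q)) ((fderiv ℝ N (G q)).comp (fderiv ℝ G q)) q :=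
        (hfam.analytic _ hGq).differentiableAt.hasFDerivAt.comp q hGd
      have h3 : (fun q => N (G q)) =ᶠ[𝓝 q] fun q => q.2 := by
        filter_upwards [(hfam.isOpen.prod Metric.isOpen_ball).mem_nhds (hΦ q hq2).1] with q' hq'
        exact (hN q' hq').2.2.2.1
      have h4 := (h1.congr_of_eventuallyEq h3.symm).unique
        (ContinuousLinearMap.snd ℝ P C3).hasFDerivAt
      exact congrArg (fun L => L δ) h4
    have hNG : N (G q) = q.2 := (hN q (hΦ q hq2).1).2.2.2.1
    have h5 := a4 (fderiv ℝ G q δ)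
    rw [pullbackPrimitive_apply, pullbackPrimitive_apply, hNd, hNG, hG1] at h5
    rw [pullbackPrimitive_apply, hWd, hSd]
    exact h5
  · have hm : ∀ {y : C3}, y ∈ Metric.ball (0 : C3) ε →
        ((p, y) : P × C3) ∈ Ω₂ ×ˢ Metric.ball (0 : C3) ε₂ ∧ M (p, y) ∈ Metric.ball (0 : C3) ε₃ := by
      intro y hy
      have h1 : ((p, y) : P × C3) ∈ Ω₂ ×ˢ Metric.ball (0 : C3) ε₂ := hsub2 ⟨hp, hy⟩
      refine ⟨h1, ?_⟩
      rw [mem_ball_zero_iff] at hy ⊢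
      rw [(hN _ (hΦ _ h1).1).2.1]
      exact hy.trans_le ((min_le_left _ _).trans (min_le_right _ _))
    have k := hΦ _ (hG2 _ (hm hx).1)
    have k' := hΦ _ (hG2 _ (hm hx').1)
    have n := hN _ (hΦ _ (hm hx).1).1
    have n' := hN _ (hΦ _ (hm hx').1).1
    have hJ : act (M (p, x)) 0 + act (M (p, x)) 1 = act (M (p, x')) 0 + act (M (p, x')) 1 := by
      rw [n.2.2.2.2.2.1, n'.2.2.2.2.2.1]
      have w := (hWact _ (hm hx).1).1
      have w' := (hWact _ (hm hx').1).1
      rw [← w, ← w', h 0, h 1]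
    -- The first and third actions of `W` are the new action and the third action at the image under
    -- `M`.
    refine hinj p hp.1.2 _ (hm hx).2 _ (hm hx').2 ?_ hJ ?_
    · exact k.2.2.2.2.2.1.symm.trans ((h 0).trans k'.2.2.2.2.2.1)
    · exact k.2.2.2.2.2.2.2.symm.trans ((h 2).trans k'.2.2.2.2.2.2.2)

end StraighteningTheorem

/-! ### From the primitive to the symplectic form; the shift of the angles -/

section PhaseSpace

open Filter Topology MeasureTheory C3

/-- A map that preserves a primitive of a constant two-form up to a differential preserves the
two-form. -/
theorem preserves_of_pullback_primitive {E : Type*} [NormedAddCommGroup E] [NormedSpace ℝ E]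
    [CompleteSpace E] (B : E →L[ℝ] E →L[ℝ] ℝ) {Ψ : E → E} {F : E → ℝ} {x : E}
    (hΨ : AnalyticAt ℝ Ψ x) (hF : AnalyticAt ℝ F x)
    (h : ∀ᶠ y in 𝓝 x, ∀ v, B (Ψ y) (fderiv ℝ Ψ y v) = B y v + fderiv ℝ F y v) (u v : E) :
    B (fderiv ℝ Ψ x u) (fderiv ℝ Ψ x v) - B (fderiv ℝ Ψ x v) (fderiv ℝ Ψ x u) =
      B u v - B v u := by
  -- The hypothesis, evaluated at `v`, differentiated in the direction `u`. Antisymmetrization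
  -- removes the second derivatives, as in the closedness of an exact form.
  have key : ∀ u v, B (fderiv ℝ Ψ x u) (fderiv ℝ Ψ x v) +
      B (Ψ x) (fderiv ℝ (fderiv ℝ Ψ) x u v) = B u v + fderiv ℝ (fderiv ℝ F) x u v := by
    intro u v
    have h1 : HasFDerivAt (fun y => B (Ψ y)) (B.comp (fderiv ℝ Ψ x)) x :=
      B.hasFDerivAt.comp x hΨ.differentiableAt.hasFDerivAt
    have h2 : HasFDerivAt (fun y => fderiv ℝ Ψ y v) _ x :=
      hΨ.fderiv.differentiableAt.hasFDerivAt.clm_apply (hasFDerivAt_const v x)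
    have h3 := h1.clm_apply h2
    have h4 : HasFDerivAt (fun y => B y v) _ x := B.hasFDerivAt.clm_apply (hasFDerivAt_const v x)
    have h5 : HasFDerivAt (fun y => fderiv ℝ F y v) _ x :=
      hF.fderiv.differentiableAt.hasFDerivAt.clm_apply (hasFDerivAt_const v x)
    have h6 := h4.add h5
    have h7 : (fun y => B (Ψ y) (fderiv ℝ Ψ y v)) =ᶠ[𝓝 x] fun y => B y v + fderiv ℝ F y v := by
      filter_upwards [h] with y hy using hy v
    have h8 := congrArg (fun L => L u) (h3.unique (h6.congr_of_eventuallyEq h7))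
    simp at h8
    linarith
  have s1 : IsSymmSndFDerivAt ℝ Ψ x := (hΨ.contDiffAt (n := 2)).isSymmSndFDerivAt (by simp)
  have s2 : IsSymmSndFDerivAt ℝ F x := (hF.contDiffAt (n := 2)).isSymmSndFDerivAt (by simp)
  have k1 := key u v
  have k2 := key v u
  rw [s1 v u, s2 v u] at k2
  linarith

namespace SpatialThreeBody

/-- The secular variables as a point of `ℂ³`: `(η₁ + i ξ₁, p₁ + i q₁, η₂ + i ξ₂)`. -/
noncomputable def toC3 : Secular ≃ₗᵢ[ℝ] C3 where
  toFun z := WithLp.toLp 2 ![⟨z 0, z 2⟩, ⟨z 4, z 5⟩, ⟨z 1, z 3⟩]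
  invFun x := WithLp.toLp 2 ![(x 0).re, (x 2).re, (x 0).im, (x 2).im, (x 1).re, (x 1).im]
  map_add' z w := by
    ext j
    fin_cases j <;> simp [Complex.ext_iff]
  map_smul' r z := by
    ext j
    fin_cases j <;> simp [Complex.ext_iff]
  left_inv z := by
    ext j
    fin_cases j <;> rfl
  right_inv x := by
    ext j
    fin_cases j <;> rfl
  norm_map' z := by
    rw [← sq_eq_sq₀ (norm_nonneg _) (norm_nonneg _), norm_sq_eq_act, EuclideanSpace.real_norm_sq_eq,
      Fin.sum_univ_three, Fin.sum_univ_six]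
    simp [act]
    ring

theorem toC3_zero (z : Secular) : toC3 z 0 = ⟨eta z 0, xi z 0⟩ := rfl
theorem toC3_one (z : Secular) : toC3 z 1 = ⟨pInc z, qInc z⟩ := rfl
theorem toC3_two (z : Secular) : toC3 z 2 = ⟨eta z 1, xi z 1⟩ := rfl

theorem act_toC3_zero (z : Secular) : act (toC3 z) 0 = tEcc z 0 := rfl
theorem act_toC3_one (z : Secular) : act (toC3 z) 1 = tInc z := rfl
theorem act_toC3_two (z : Secular) : act (toC3 z) 2 = tEcc z 1 := rfl

theorem om_toC3 (u v : Secular) : om (toC3 u) (toC3 v) =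
    (∑ i, (eta u i * xi v i - xi u i * eta v i)) + (pInc u * qInc v - qInc u * pInc v) := by
  rw [om_apply, Fin.sum_univ_three, Fin.sum_univ_two, toC3_zero, toC3_one, toC3_two, toC3_zero,
    toC3_one, toC3_two]
  ring

/-- The primitive `∑ Λ_i dλ_i + ½ ∑ (x_j dy_j - y_j dx_j)` of the symplectic form. -/
noncomputable def phasePrimitive : Phase →L[ℝ] Phase →L[ℝ] ℝ :=
  (∑ i, ((ContinuousLinearMap.proj (R := ℝ) i).comp
      (ContinuousLinearMap.fst ℝ (Fin 2 → ℝ) ((Fin 2 → ℝ) × Secular))).smulRight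
    ((ContinuousLinearMap.proj (R := ℝ) i).comp ((ContinuousLinearMap.fst ℝ (Fin 2 → ℝ) Secular).comp
      (ContinuousLinearMap.snd ℝ (Fin 2 → ℝ) ((Fin 2 → ℝ) × Secular))))) +
  (1 / 2 : ℝ) • om.bilinearComp
    ((toC3.toContinuousLinearEquiv : Secular →L[ℝ] C3).comp
      ((ContinuousLinearMap.snd ℝ (Fin 2 → ℝ) Secular).comp
        (ContinuousLinearMap.snd ℝ (Fin 2 → ℝ) ((Fin 2 → ℝ) × Secular))))
    ((toC3.toContinuousLinearEquiv : Secular →L[ℝ] C3).comp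
      ((ContinuousLinearMap.snd ℝ (Fin 2 → ℝ) Secular).comp
        (ContinuousLinearMap.snd ℝ (Fin 2 → ℝ) ((Fin 2 → ℝ) × Secular))))

theorem phasePrimitive_apply (u v : Phase) : phasePrimitive u v =
    (∑ i, u.1 i * v.2.1 i) + 1 / 2 * om (toC3 u.2.2) (toC3 v.2.2) := by
  simp [phasePrimitive]

theorem symplForm_eq (u v : Phase) :
    symplForm u v = phasePrimitive u v - phasePrimitive v u := by
  rw [phasePrimitive_apply, phasePrimitive_apply, om_swap (toC3 v.2.2), om_toC3, symplForm,
    Fin.sum_univ_two, Fin.sum_univ_two, Fin.sum_univ_two, Fin.sum_univ_two]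
  ring

theorem liftMap_comp_liftMap {φ φ' : (Fin 2 → ℝ) × Secular → (Fin 2 → ℝ)}
    {Z Z' : (Fin 2 → ℝ) × Secular → Secular} {p : Phase} (hZ : Z (p.1, Z' (p.1, p.2.2)) = p.2.2)
    (hφ : φ (p.1, Z' (p.1, p.2.2)) = -φ' (p.1, p.2.2)) : liftMap φ Z (liftMap φ' Z' p) = p := by
  simp only [liftMap, hZ, hφ]
  ext <;> simp

/-- The projection of the phase space on the variables `(Λ, z)`, with `z` as a point of `ℂ³`. -/
noncomputable def secularPart : Phase →L[ℝ] (Fin 2 → ℝ) × C3 :=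
  (ContinuousLinearMap.fst ℝ (Fin 2 → ℝ) ((Fin 2 → ℝ) × Secular)).prod
    ((toC3.toContinuousLinearEquiv : Secular →L[ℝ] C3).comp
      ((ContinuousLinearMap.snd ℝ (Fin 2 → ℝ) Secular).comp
        (ContinuousLinearMap.snd ℝ (Fin 2 → ℝ) ((Fin 2 → ℝ) × Secular))))

theorem secularPart_apply (p : Phase) : secularPart p = (p.1, toC3 p.2.2) := rfl

/-- The components of a covector. -/
noncomputable def covectorCoords : ((Fin 2 → ℝ) →L[ℝ] ℝ) →L[ℝ] (Fin 2 → ℝ) :=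
  ContinuousLinearMap.pi fun i => ContinuousLinearMap.apply ℝ ℝ (Pi.single i 1)

theorem covectorCoords_apply (L : (Fin 2 → ℝ) →L[ℝ] ℝ) (i : Fin 2) :
    covectorCoords L i = L (Pi.single i 1) := rfl

theorem sum_mul_covectorCoords (L : (Fin 2 → ℝ) →L[ℝ] ℝ) (v : Fin 2 → ℝ) :
    ∑ i, v i * covectorCoords L i = L v := by
  have : v = ∑ i, v i • Pi.single i (1 : ℝ) := by
    ext j; simp [Finset.sum_apply, Pi.single_apply]
  conv_rhs => rw [this]
  simp only [map_sum, map_smul, smul_eq_mul, covectorCoords_apply]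

/-- The lift of a family of maps whose primitive is known, with the shift of the angles given by the
remaining part of the primitive, is symplectic. -/
theorem symplForm_fderiv_lift {Ω : Set (Fin 2 → ℝ)} {ε : ℝ} (hΩ : IsOpen Ω)
    {W : (Fin 2 → ℝ) × C3 → C3} {S : (Fin 2 → ℝ) × C3 → ℝ}
    {γ : (Fin 2 → ℝ) × C3 → (Fin 2 → ℝ) →L[ℝ] ℝ}
    (h : ∀ q ∈ Ω ×ˢ Metric.ball (0 : C3) ε, AnalyticAt ℝ W q ∧ AnalyticAt ℝ S q ∧ AnalyticAt ℝ γ q ∧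
      ∀ δ, pullbackPrimitive W q δ = 1 / 2 * om q.2 δ.2 + fderiv ℝ S q δ + γ q δ.1)
    {p : Phase} (hp : secularPart p ∈ Ω ×ˢ Metric.ball (0 : C3) ε) :
    AnalyticAt ℝ (liftMap (fun q => covectorCoords (γ (q.1, toC3 q.2)))
      (fun q => toC3.symm (W (q.1, toC3 q.2)))) p ∧
    ∀ u v, symplForm (fderiv ℝ (liftMap (fun q => covectorCoords (γ (q.1, toC3 q.2)))
      (fun q => toC3.symm (W (q.1, toC3 q.2)))) p u)
      (fderiv ℝ (liftMap (fun q => covectorCoords (γ (q.1, toC3 q.2)))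
      (fun q => toC3.symm (W (q.1, toC3 q.2)))) p v) = symplForm u v := by
  set Ψ : Phase → Phase := liftMap (fun q => covectorCoords (γ (q.1, toC3 q.2)))
      (fun q => toC3.symm (W (q.1, toC3 q.2))) with hΨ
  set c : (Fin 2 → ℝ) × C3 → Fin 2 → ℝ := fun q => covectorCoords (γ q) with hc
  have hca : ∀ q ∈ Ω ×ˢ Metric.ball (0 : C3) ε, AnalyticAt ℝ c q := fun q hq =>
    (covectorCoords.analyticAt _).comp (h q hq).2.2.1
  let e' : C3 ≃L[ℝ] Secular := toC3.symm.toContinuousLinearEquiv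
  set T' : C3 →L[ℝ] Secular := e'.toContinuousLinearMap with hT'
  set πl : Phase →L[ℝ] (Fin 2 → ℝ) := (ContinuousLinearMap.fst ℝ (Fin 2 → ℝ) Secular).comp
      (ContinuousLinearMap.snd ℝ (Fin 2 → ℝ) ((Fin 2 → ℝ) × Secular)) with hπl
  have hΨv : ∀ y, Ψ y = (y.1, πl y + c (secularPart y), T' (W (secularPart y))) := fun y => rfl
  have hΨa : ∀ y, secularPart y ∈ Ω ×ˢ Metric.ball (0 : C3) ε → AnalyticAt ℝ Ψ y := by
    intro y hy
    have e1 : AnalyticAt ℝ (fun y => c (secularPart y)) y :=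
      AnalyticAt.comp (g := c) (hca _ hy) (secularPart.analyticAt y)
    have e2 : AnalyticAt ℝ (fun y => W (secularPart y)) y :=
      AnalyticAt.comp (h _ hy).1 (secularPart.analyticAt y)
    exact analyticAt_fst.prod (((πl.analyticAt y).add e1).prod ((T'.analyticAt _).comp e2))
  refine ⟨hΨa p hp, fun u v => ?_⟩
  -- The shift adds ∑ Λ_i dc_i to the primitive; together with the leftover γ dΛ = ∑ c_i dΛ_i this
  -- is the differential of ∑ Λ_i c_i.
  set F : Phase → ℝ := fun y => S (secularPart y) + ∑ i, y.1 i * c (secularPart y) i with hF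
  have hFa : ∀ y, secularPart y ∈ Ω ×ˢ Metric.ball (0 : C3) ε → AnalyticAt ℝ F y := by
    intro y hy
    have e1 : AnalyticAt ℝ (fun y => c (secularPart y)) y :=
      AnalyticAt.comp (g := c) (hca _ hy) (secularPart.analyticAt y)
    have e3 : AnalyticAt ℝ (fun y => S (secularPart y)) y :=
      AnalyticAt.comp (h _ hy).2.1 (secularPart.analyticAt y)
    refine e3.add (Finset.analyticAt_fun_sum _ fun i _ => AnalyticAt.mul ?_ ?_)
    · exact ((ContinuousLinearMap.proj (R := ℝ) (φ := fun _ : Fin 2 => ℝ) i).analyticAt _).comp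
        analyticAt_fst
    · exact ((ContinuousLinearMap.proj (R := ℝ) (φ := fun _ : Fin 2 => ℝ) i).analyticAt _).comp e1
  have hmem : ∀ᶠ y in 𝓝 p, secularPart y ∈ Ω ×ˢ Metric.ball (0 : C3) ε :=
    secularPart.continuous.continuousAt.eventually ((hΩ.prod Metric.isOpen_ball).mem_nhds hp)
  rw [symplForm_eq, symplForm_eq]
  refine preserves_of_pullback_primitive phasePrimitive (F := F) (hΨa p hp) (hFa p hp) ?_ u v
  filter_upwards [hmem] with y hy v
  have dc : HasFDerivAt (fun y => c (secularPart y)) ((fderiv ℝ c (secularPart y)).comp secularPart) y :=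
    (hca _ hy).differentiableAt.hasFDerivAt.comp y secularPart.hasFDerivAt
  have dW : HasFDerivAt (fun y => W (secularPart y)) ((fderiv ℝ W (secularPart y)).comp secularPart) y :=
    (h _ hy).1.differentiableAt.hasFDerivAt.comp y secularPart.hasFDerivAt
  have dS : HasFDerivAt (fun y => S (secularPart y)) ((fderiv ℝ S (secularPart y)).comp secularPart) y :=
    (h _ hy).2.1.differentiableAt.hasFDerivAt.comp y secularPart.hasFDerivAt
  have dΨ : HasFDerivAt Ψ ((ContinuousLinearMap.fst ℝ (Fin 2 → ℝ) ((Fin 2 → ℝ) × Secular)).prod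
      ((πl + (fderiv ℝ c (secularPart y)).comp secularPart).prod
        (T'.comp ((fderiv ℝ W (secularPart y)).comp secularPart)))) y :=
    hasFDerivAt_fst.prodMk ((πl.hasFDerivAt.add dc).prodMk (T'.hasFDerivAt.comp y dW))
  have dc' : ∀ i, HasFDerivAt (fun y => c (secularPart y) i)
      ((ContinuousLinearMap.proj (R := ℝ) (φ := fun _ : Fin 2 => ℝ) i).comp
        ((fderiv ℝ c (secularPart y)).comp secularPart)) y := fun i =>
    (ContinuousLinearMap.proj (R := ℝ) (φ := fun _ : Fin 2 => ℝ) i).hasFDerivAt.comp y dc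
  have dL : ∀ i, HasFDerivAt (fun y : Phase => y.1 i)
      ((ContinuousLinearMap.proj (R := ℝ) (φ := fun _ : Fin 2 => ℝ) i).comp
        (ContinuousLinearMap.fst ℝ (Fin 2 → ℝ) ((Fin 2 → ℝ) × Secular))) y := fun i =>
    ((ContinuousLinearMap.proj (R := ℝ) (φ := fun _ : Fin 2 => ℝ) i).comp
        (ContinuousLinearMap.fst ℝ (Fin 2 → ℝ) ((Fin 2 → ℝ) × Secular))).hasFDerivAt
  have dF := dS.add (HasFDerivAt.fun_sum (u := Finset.univ) fun i _ => (dL i).mul (dc' i))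
  have dF' : fderiv ℝ F y = _ := dF.fderiv
  rw [dΨ.fderiv, dF', phasePrimitive_apply, phasePrimitive_apply]
  have hq := (h _ hy).2.2.2 (secularPart v)
  rw [pullbackPrimitive_apply] at hq
  have hγ := sum_mul_covectorCoords (γ (secularPart y)) v.1
  have e1 : toC3 (Ψ y).2.2 = W (secularPart y) := toC3.apply_symm_apply _
  have e2 : ∀ w, toC3 (T' w) = w := fun w => toC3.apply_symm_apply _
  have e3 : (secularPart y).2 = toC3 y.2.2 := rfl
  have e4 : (secularPart v).2 = toC3 v.2.2 := rfl
  have e5 : (secularPart v).1 = v.1 := rfl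
  have e6 : (Ψ y).1 = y.1 := rfl
  have e7 : ∀ w : Phase, πl w = w.2.1 := fun w => rfl
  have e8 : c (secularPart y) = covectorCoords (γ (secularPart y)) := rfl
  rw [e3, e4, e5, ← hγ] at hq
  simp only [ContinuousLinearMap.prod_apply, ContinuousLinearMap.comp_apply, add_apply,
    smul_apply, smul_eq_mul, ContinuousLinearMap.coe_fst', ContinuousLinearMap.proj_apply,
    Pi.add_apply, e1, e2, e6, e7, e8, Fin.sum_univ_two] at hq ⊢
  linear_combination hq

theorem mem_phaseSpace {A : Set (Fin 2 → ℝ)} {ε : ℝ} {p : Phase} :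
    p ∈ phaseSpace A ε ↔ secularPart p ∈ A ×ˢ Metric.ball (0 : C3) ε := by
  simp only [phaseSpace, mem_prod, mem_univ, true_and, mem_ball_zero_iff, secularPart_apply,
    LinearIsometryEquiv.norm_map]

/-- An analytic family of norm preserving maps `M` of `ℂ³`, equivariant under simultaneous rotations
of the first two variables and rotations of the third one, yields a symplectic change of variables
of the phase space, close to `z = 0`, in which the first action of `M` depends on `Λ` and on the
actions only. -/
theorem exists_symplectic_change {C : Set (Fin 2 → ℝ)} (hC : IsCompact C)
    {M : (Fin 2 → ℝ) × C3 → C3} (hM : ∀ p ∈ C, AnalyticAt ℝ M (p, 0))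
    (h01 : ∀ q (r : ℝ), M (q.1, tor (r • dir01) q.2) = tor (r • dir01) (M q))
    (h2 : ∀ q (r : ℝ), M (q.1, tor (r • dir2) q.2) = tor (r • dir2) (M q))
    (hact : ∀ p ∈ C, ∀ᶠ q in 𝓝 ((p, 0) : (Fin 2 → ℝ) × C3),
      act (M q) 0 + act (M q) 1 = act q.2 0 + act q.2 1 ∧ act (M q) 2 = act q.2 2) :
    ∃ (Ω : Set (Fin 2 → ℝ)) (ε : ℝ) (φ : (Fin 2 → ℝ) × Secular → (Fin 2 → ℝ))
      (Z : (Fin 2 → ℝ) × Secular → Secular), IsOpen Ω ∧ C ⊆ Ω ∧ 0 < ε ∧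
      AnalyticOnNhd ℝ φ (Ω ×ˢ Metric.ball (0 : Secular) ε) ∧
      AnalyticOnNhd ℝ Z (Ω ×ˢ Metric.ball (0 : Secular) ε) ∧
      (∀ A ⊆ Ω, ∀ ε₀ ≤ ε, BijOn (liftMap φ Z) (phaseSpace A ε₀) (phaseSpace A ε₀)) ∧
      IsSymplecticOn (liftMap φ Z) (phaseSpace Ω ε) ∧
      (∀ Λ ∈ Ω, ∀ z ∈ Metric.ball (0 : Secular) ε, ‖Z (Λ, z)‖ = ‖z‖ ∧
        tEcc (Z (Λ, z)) 1 = tEcc z 1 ∧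
        tEcc (Z (Λ, z)) 0 + tInc (Z (Λ, z)) = tEcc z 0 + tInc z) ∧
      ∀ Λ ∈ Ω, ∀ z ∈ Metric.ball (0 : Secular) ε, ∀ z' ∈ Metric.ball (0 : Secular) ε,
        tEcc z 0 = tEcc z' 0 → tEcc z 1 = tEcc z' 1 → tInc z = tInc z' →
        act (M (Λ, toC3 (Z (Λ, z)))) 0 = act (M (Λ, toC3 (Z (Λ, z')))) 0 := by
  obtain ⟨Ω, ε, W, Z, S, γ, hΩ, hCΩ, hε, H, Hact⟩ := exists_symplectic_straightening hC hM h01 h2 hact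
  set Zs : (Fin 2 → ℝ) × Secular → Secular := fun q => toC3.symm (Z (q.1, toC3 q.2)) with hZs
  set Ws : (Fin 2 → ℝ) × Secular → Secular := fun q => toC3.symm (W (q.1, toC3 q.2)) with hWs
  set cs : (Fin 2 → ℝ) × Secular → (Fin 2 → ℝ) := fun q => covectorCoords (γ (q.1, toC3 q.2)) with hcs
  -- The change of variables is the inverse of the lift of `W`, so it undoes the shift at the image
  -- point.
  set φ : (Fin 2 → ℝ) × Secular → (Fin 2 → ℝ) := fun q => -cs (q.1, Zs q) with hφ
  have toZ : ∀ q, toC3 (Zs q) = Z (q.1, toC3 q.2) := fun q => toC3.apply_symm_apply _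
  have toW : ∀ q, toC3 (Ws q) = W (q.1, toC3 q.2) := fun q => toC3.apply_symm_apply _
  let e : Secular ≃L[ℝ] C3 := toC3.toContinuousLinearEquiv
  let T : (Fin 2 → ℝ) × Secular →L[ℝ] (Fin 2 → ℝ) × C3 :=
    (ContinuousLinearMap.fst ℝ (Fin 2 → ℝ) Secular).prod
      (e.toContinuousLinearMap.comp (ContinuousLinearMap.snd ℝ (Fin 2 → ℝ) Secular))
  have hT : ∀ q, T q = (q.1, toC3 q.2) := fun q => rfl
  have hmem : ∀ {q : (Fin 2 → ℝ) × Secular}, q ∈ Ω ×ˢ Metric.ball (0 : Secular) ε →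
      ((q.1, toC3 q.2) : (Fin 2 → ℝ) × C3) ∈ Ω ×ˢ Metric.ball (0 : C3) ε := by
    rintro q ⟨h1, h2⟩
    refine ⟨h1, ?_⟩
    rw [mem_ball_zero_iff] at h2 ⊢
    simpa using h2
  have hnZ : ∀ {q : (Fin 2 → ℝ) × Secular}, q ∈ Ω ×ˢ Metric.ball (0 : Secular) ε →
      ‖Zs q‖ = ‖q.2‖ := by
    intro q hq
    rw [← toC3.norm_map, toZ, (H _ (hmem hq)).2.2.2.2.2.1]
    exact toC3.norm_map _
  have hnW : ∀ {q : (Fin 2 → ℝ) × Secular}, q ∈ Ω ×ˢ Metric.ball (0 : Secular) ε →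
      ‖Ws q‖ = ‖q.2‖ := by
    intro q hq
    rw [← toC3.norm_map, toW, (H _ (hmem hq)).2.2.2.2.1]
    exact toC3.norm_map _
  have hWZ : ∀ {q : (Fin 2 → ℝ) × Secular}, q ∈ Ω ×ˢ Metric.ball (0 : Secular) ε →
      Ws (q.1, Zs q) = q.2 := by
    intro q hq
    apply toC3.injective
    rw [toW, toZ]
    exact (H _ (hmem hq)).2.2.2.2.2.2.2.1
  have hZW : ∀ {q : (Fin 2 → ℝ) × Secular}, q ∈ Ω ×ˢ Metric.ball (0 : Secular) ε →
      Zs (q.1, Ws q) = q.2 := by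
    intro q hq
    apply toC3.injective
    rw [toZ, toW]
    exact (H _ (hmem hq)).2.2.2.2.2.2.1
  have hmZ : ∀ {q : (Fin 2 → ℝ) × Secular}, q ∈ Ω ×ˢ Metric.ball (0 : Secular) ε →
      ((q.1, Zs q) : (Fin 2 → ℝ) × Secular) ∈ Ω ×ˢ Metric.ball (0 : Secular) ε := by
    intro q hq
    refine ⟨hq.1, ?_⟩
    rw [mem_ball_zero_iff, hnZ hq]
    exact mem_ball_zero_iff.1 hq.2
  have hZa : AnalyticOnNhd ℝ Zs (Ω ×ˢ Metric.ball (0 : Secular) ε) := by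
    intro q hq
    have h1 : AnalyticAt ℝ (fun q => Z (T q)) q :=
      AnalyticAt.comp (g := Z) (H _ (hmem hq)).2.1 (T.analyticAt q)
    exact (e.symm.toContinuousLinearMap.analyticAt _).comp h1
  have hca : AnalyticOnNhd ℝ cs (Ω ×ˢ Metric.ball (0 : Secular) ε) := by
    intro q hq
    have h1 : AnalyticAt ℝ (fun q => γ (T q)) q :=
      AnalyticAt.comp (g := γ) (H _ (hmem hq)).2.2.2.1 (T.analyticAt q)
    exact (covectorCoords.analyticAt _).comp h1
  have hφa : AnalyticOnNhd ℝ φ (Ω ×ˢ Metric.ball (0 : Secular) ε) := by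
    intro q hq
    have h1 : AnalyticAt ℝ (fun q => cs (q.1, Zs q)) q :=
      AnalyticAt.comp (g := cs) (hca _ (hmZ hq)) (analyticAt_fst.prod (hZa q hq))
    exact h1.neg
  have hps : ∀ {p : Phase}, p ∈ phaseSpace Ω ε →
      ((p.1, p.2.2) : (Fin 2 → ℝ) × Secular) ∈ Ω ×ˢ Metric.ball (0 : Secular) ε :=
    fun hp => ⟨hp.1, hp.2.2⟩
  have left : ∀ p ∈ phaseSpace Ω ε, liftMap cs Ws (liftMap φ Zs p) = p := fun p hp =>
    liftMap_comp_liftMap (hWZ (hps hp)) (by simp [hφ])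
  have right : ∀ p ∈ phaseSpace Ω ε, liftMap φ Zs (liftMap cs Ws p) = p := fun p hp =>
    liftMap_comp_liftMap (hZW (hps hp)) (by simp only [hφ, hZW (hps hp)])
  have mono : ∀ {A : Set (Fin 2 → ℝ)} {ε₀ : ℝ}, A ⊆ Ω → ε₀ ≤ ε → phaseSpace A ε₀ ⊆ phaseSpace Ω ε :=
    fun hA h0 => prod_mono hA (prod_mono subset_rfl (Metric.ball_subset_ball h0))
  refine ⟨Ω, ε, φ, Zs, hΩ, hCΩ, hε, hφa, hZa, ?_, ?_, ?_, ?_⟩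
  · intro A hA ε₀ h0
    refine InvOn.bijOn (f' := liftMap cs Ws) ⟨fun p hp => left p (mono hA h0 hp),
      fun p hp => right p (mono hA h0 hp)⟩ (fun p hp => ⟨hp.1, mem_univ _, ?_⟩)
      (fun p hp => ⟨hp.1, mem_univ _, ?_⟩)
    · have := hnZ (hps (mono hA h0 hp))
      have h3 := hp.2.2
      rw [mem_ball_zero_iff] at h3 ⊢
      exact this.trans_lt h3
    · have := hnW (hps (mono hA h0 hp))
      have h3 := hp.2.2
      rw [mem_ball_zero_iff] at h3 ⊢
      exact this.trans_lt h3
  · intro p hp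
    have hΦp : liftMap φ Zs p ∈ phaseSpace Ω ε := ⟨hp.1, mem_univ _, (hmZ (hps hp)).2⟩
    -- Only the lift of `W` has a known primitive; the form is transferred to its inverse through
    -- the derivative of the composition, which is the identity.
    obtain ⟨hΨa, hΨs⟩ := symplForm_fderiv_lift hΩ
      (fun q hq => ⟨(H q hq).1, (H q hq).2.2.1, (H q hq).2.2.2.1, (H q hq).2.2.2.2.2.2.2.2.2.2⟩)
      (mem_phaseSpace.1 hΦp)
    let πz : Phase →L[ℝ] (Fin 2 → ℝ) × Secular :=
      (ContinuousLinearMap.fst ℝ (Fin 2 → ℝ) ((Fin 2 → ℝ) × Secular)).prod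
        ((ContinuousLinearMap.snd ℝ (Fin 2 → ℝ) Secular).comp
          (ContinuousLinearMap.snd ℝ (Fin 2 → ℝ) ((Fin 2 → ℝ) × Secular)))
    have d1 : DifferentiableAt ℝ (fun p => φ (πz p)) p :=
      DifferentiableAt.comp (g := φ) p (hφa _ (hps hp)).differentiableAt πz.differentiableAt
    have d2 : DifferentiableAt ℝ (fun p => Zs (πz p)) p :=
      DifferentiableAt.comp (g := Zs) p (hZa _ (hps hp)).differentiableAt πz.differentiableAt
    have d3 : DifferentiableAt ℝ (fun p : Phase => p.2.1) p :=
      differentiableAt_fst.comp p differentiableAt_snd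
    have hd : DifferentiableAt ℝ (liftMap φ Zs) p :=
      differentiableAt_fst.prodMk ((d3.add d1).prodMk d2)
    refine ⟨hd, fun u v => ?_⟩
    have hopen : IsOpen (phaseSpace Ω ε) := hΩ.prod (isOpen_univ.prod Metric.isOpen_ball)
    have hc : HasFDerivAt (fun p => liftMap cs Ws (liftMap φ Zs p)) _ p :=
      (hΨa.differentiableAt.hasFDerivAt).comp p hd.hasFDerivAt
    have hid : (fun p => liftMap cs Ws (liftMap φ Zs p)) =ᶠ[𝓝 p] id := by
      filter_upwards [hopen.mem_nhds hp] with p' hp' using left p' hp'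
    have hcomp := (hc.congr_of_eventuallyEq hid.symm).unique (hasFDerivAt_id p)
    have hu : ∀ u, fderiv ℝ (liftMap cs Ws) (liftMap φ Zs p) (fderiv ℝ (liftMap φ Zs) p u) = u :=
      fun u => congrArg (fun L => L u) hcomp
    have h3 := hΨs (fderiv ℝ (liftMap φ Zs) p u) (fderiv ℝ (liftMap φ Zs) p v)
    rw [← h3]
    exact congrArg₂ symplForm (hu u) (hu v)
  · intro Λ hΛ z hz
    have hq : ((Λ, z) : (Fin 2 → ℝ) × Secular) ∈ Ω ×ˢ Metric.ball (0 : Secular) ε := ⟨hΛ, hz⟩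
    have h4 := H _ (hmem (hmZ hq))
    have h5 := (H _ (hmem hq)).2.2.2.2.2.2.2.1
    have h6 : W (Λ, toC3 (Zs (Λ, z))) = toC3 z := by rw [toZ]; exact h5
    have h7 := h4.2.2.2.2.2.2.2.2.1
    have h8 := h4.2.2.2.2.2.2.2.2.2.1
    simp only [h6] at h7 h8
    exact ⟨hnZ hq, h8.symm, h7.symm⟩
  · intro Λ hΛ z hz z' hz' e0 e1 e2
    have hq : ((Λ, z) : (Fin 2 → ℝ) × Secular) ∈ Ω ×ˢ Metric.ball (0 : Secular) ε := ⟨hΛ, hz⟩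
    have hq' : ((Λ, z') : (Fin 2 → ℝ) × Secular) ∈ Ω ×ˢ Metric.ball (0 : Secular) ε := ⟨hΛ, hz'⟩
    have h5 := (H _ (hmem hq)).2.2.2.2.2.2.2.1
    have h5' := (H _ (hmem hq')).2.2.2.2.2.2.2.1
    rw [toZ, toZ]
    have m1 := (hmem (hmZ hq)).2
    have m2 := (hmem (hmZ hq')).2
    rw [toZ] at m1 m2
    refine Hact Λ hΛ _ m1 _ m2 fun j => ?_
    rw [show W (Λ, Z (Λ, toC3 z)) = toC3 z from h5, show W (Λ, Z (Λ, toC3 z')) = toC3 z' from h5']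
    fin_cases j
    · exact e0
    · exact e2
    · exact e1

end SpatialThreeBody

end PhaseSpace

/-! ### Second derivative under the double average -/

section PotentialExpansion

open Filter Topology MeasureTheory

/-- Joint continuity of the derivative bounds it on a closed ball around ε₀ times the compact set,
and this constant dominates. -/
theorem hasDerivAt_setIntegral_of_continuousOn {X : Type*} [TopologicalSpace X]
    [MeasurableSpace X] [OpensMeasurableSpace X] {μ : Measure X} [IsFiniteMeasureOnCompacts μ]
    {K : Set X} (hK : IsCompact K) (hKm : MeasurableSet K) {δ : ℝ} {g g' : ℝ → X → ℝ}
    (hg : ∀ ε ∈ Metric.ball (0 : ℝ) δ, IntegrableOn (g ε) K μ)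
    (hg' : ∀ ε ∈ Metric.ball (0 : ℝ) δ, IntegrableOn (g' ε) K μ)
    (hc : ContinuousOn (Function.uncurry g') (Metric.ball (0 : ℝ) δ ×ˢ K))
    (hd : ∀ ε ∈ Metric.ball (0 : ℝ) δ, ∀ x ∈ K, HasDerivAt (fun ε => g ε x) (g' ε x) ε)
    {ε₀ : ℝ} (h0 : ε₀ ∈ Metric.ball (0 : ℝ) δ) :
    HasDerivAt (fun ε => ∫ x in K, g ε x ∂μ) (∫ x in K, g' ε₀ x ∂μ) ε₀ := by
  obtain ⟨r, hr, hsub⟩ := Metric.nhds_basis_closedBall.mem_iff.1 (Metric.isOpen_ball.mem_nhds h0)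
  obtain ⟨B, hB⟩ := ((isCompact_closedBall ε₀ r).prod hK).exists_bound_of_continuousOn
    (hc.mono (prod_mono hsub subset_rfl))
  refine (hasDerivAt_integral_of_dominated_loc_of_deriv_le (bound := fun _ => B)
    (Metric.closedBall_mem_nhds ε₀ hr) ?_ (hg ε₀ h0) (hg' ε₀ h0).aestronglyMeasurable ?_ ?_ ?_).2
  · filter_upwards [Metric.isOpen_ball.mem_nhds h0] with ε hε using (hg ε hε).aestronglyMeasurable
  · exact (ae_restrict_iff' hKm).2 (Eventually.of_forall fun x hx ε hε => hB (ε, x) ⟨hε, hx⟩)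
  · exact integrableOn_const hK.measure_lt_top.ne
  · exact (ae_restrict_iff' hKm).2 (Eventually.of_forall fun x hx ε hε => hd ε (hsub hε) x hx)

theorem setIntegral_Icc_prod_eq {f : ℝ × ℝ → ℝ} {a b : ℝ} (hab : a ≤ b)
    (hf : ContinuousOn f (Icc a b ×ˢ Icc a b)) :
    ∫ x in Icc a b ×ˢ Icc a b, f x = ∫ s in a..b, ∫ t in a..b, f (s, t) := by
  have hi : IntegrableOn f (Icc a b ×ˢ Icc a b) (volume.prod volume) :=
    hf.integrableOn_compact (isCompact_Icc.prod isCompact_Icc)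
  rw [Measure.volume_eq_prod, setIntegral_prod _ hi, integral_Icc_eq_integral_Ioc,
    intervalIntegral.integral_of_le hab]
  congr 1
  funext s
  rw [integral_Icc_eq_integral_Ioc, intervalIntegral.integral_of_le hab]

/-- The quadratic term of the expansion in `ε` of the double average of `1 / |ε p - s|`. -/
theorem iteratedDeriv_two_integral_inv_norm {E : Type*} [NormedAddCommGroup E]
    [InnerProductSpace ℝ E] {a b : ℝ} (hab : a ≤ b) {p s : ℝ → E} (hp : Continuous p)
    (hs : Continuous s) (hs0 : ∀ t, s t ≠ 0) :
    iteratedDeriv 2 (fun ε : ℝ => ∫ l₁ in a..b, ∫ l₂ in a..b, 1 / ‖ε • p l₁ - s l₂‖) 0 =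
      ∫ l₁ in a..b, ∫ l₂ in a..b,
        (3 * inner ℝ (p l₁) (s l₂) ^ 2 / ‖s l₂‖ ^ 5 - ‖p l₁‖ ^ 2 / ‖s l₂‖ ^ 3) := by
  set K : Set (ℝ × ℝ) := Icc a b ×ˢ Icc a b with hK
  have hKc : IsCompact K := isCompact_Icc.prod isCompact_Icc
  -- For small ε there are no collisions, uniformly in both longitudes, because the outer motion
  -- avoids the origin.
  obtain ⟨δ, hδ, hpos⟩ : ∃ δ : ℝ, 0 < δ ∧ ∀ ε ∈ Metric.ball (0 : ℝ) δ, ∀ x ∈ K,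
      ε • p x.1 - s x.2 ≠ 0 := by
    have hev : ∀ x ∈ K, ∀ᶠ y in 𝓝 ((0, x) : ℝ × (ℝ × ℝ)), y.1 • p y.2.1 - s y.2.2 ≠ 0 := by
      intro x _
      have hc : ContinuousAt (fun y : ℝ × (ℝ × ℝ) => y.1 • p y.2.1 - s y.2.2) (0, x) :=
        Continuous.continuousAt (by fun_prop)
      refine hc.eventually (isOpen_ne.mem_nhds ?_)
      simp [hs0]
    have h := hKc.eventually_forall_of_forall_eventually (x₀ := (0 : ℝ))
      (P := fun (ε : ℝ) (x : ℝ × ℝ) => ε • p x.1 - s x.2 ≠ 0) hev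
    obtain ⟨δ, hδ, h⟩ := Metric.eventually_nhds_iff_ball.1 h
    exact ⟨δ, hδ, fun ε hε x hx => h ε hε x hx⟩
  set D : ℝ → ℝ × ℝ → ℝ := fun ε x =>
    ε ^ 2 * ‖p x.1‖ ^ 2 - 2 * ε * inner ℝ (p x.1) (s x.2) + ‖s x.2‖ ^ 2 with hD
  have hDn : ∀ ε x, ‖ε • p x.1 - s x.2‖ ^ 2 = D ε x := by
    intro ε x
    rw [norm_sub_sq_real, norm_smul, mul_pow, inner_smul_left, Real.norm_eq_abs, sq_abs, hD]
    simp
    ring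
  have hDs : ∀ ε x, ‖ε • p x.1 - s x.2‖ = √(D ε x) := fun ε x => by
    rw [← hDn, Real.sqrt_sq (norm_nonneg _)]
  have hD0 : ∀ ε ∈ Metric.ball (0 : ℝ) δ, ∀ x ∈ K, 0 < D ε x := fun ε hε x hx => by
    rw [← hDn]
    have := norm_pos_iff.2 (hpos ε hε x hx)
    positivity
  set D' : ℝ → ℝ × ℝ → ℝ := fun ε x =>
    2 * ε * ‖p x.1‖ ^ 2 - 2 * inner ℝ (p x.1) (s x.2) with hD'
  have hDc : Continuous (Function.uncurry D) := by simp only [hD]; fun_prop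
  have hDc' : Continuous (Function.uncurry D') := by simp only [hD']; fun_prop
  have hDd : ∀ ε x, HasDerivAt (fun ε => D ε x) (D' ε x) ε := by
    intro ε x
    have h := (((hasDerivAt_pow 2 ε).mul_const (‖p x.1‖ ^ 2)).sub
      (((hasDerivAt_id ε).const_mul 2).mul_const (inner ℝ (p x.1) (s x.2)))).add_const (‖s x.2‖ ^ 2)
    refine h.congr_deriv ?_
    simp [hD']
  set g : ℝ → ℝ × ℝ → ℝ := fun ε x => 1 / √(D ε x) with hg
  set g' : ℝ → ℝ × ℝ → ℝ := fun ε x => -D' ε x / (2 * √(D ε x) ^ 3) with hg'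
  set g'' : ℝ → ℝ × ℝ → ℝ := fun ε x =>
    3 * D' ε x ^ 2 / (4 * √(D ε x) ^ 5) - ‖p x.1‖ ^ 2 / √(D ε x) ^ 3 with hg''
  have hsq : ∀ y ∈ Metric.ball (0 : ℝ) δ ×ˢ K, √(Function.uncurry D y) ≠ 0 := fun y hy =>
    (Real.sqrt_pos.2 (hD0 y.1 hy.1 y.2 hy.2)).ne'
  have hsc : ContinuousOn (fun y => √(Function.uncurry D y)) (Metric.ball (0 : ℝ) δ ×ˢ K) :=
    (Real.continuous_sqrt.comp hDc).continuousOn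
  have hgc : ContinuousOn (Function.uncurry g) (Metric.ball (0 : ℝ) δ ×ˢ K) :=
    continuousOn_const.div hsc hsq
  have hgc' : ContinuousOn (Function.uncurry g') (Metric.ball (0 : ℝ) δ ×ˢ K) :=
    hDc'.continuousOn.neg.div (continuousOn_const.mul (hsc.pow 3))
      fun y hy => mul_ne_zero two_ne_zero (pow_ne_zero _ (hsq y hy))
  have hgc'' : ContinuousOn (Function.uncurry g'') (Metric.ball (0 : ℝ) δ ×ˢ K) := by
    refine ((continuousOn_const.mul (hDc'.continuousOn.pow 2)).div
      (continuousOn_const.mul (hsc.pow 5))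
      fun y hy => mul_ne_zero four_ne_zero (pow_ne_zero _ (hsq y hy))).sub (ContinuousOn.div ?_
        (hsc.pow 3) fun y hy => pow_ne_zero _ (hsq y hy))
    exact Continuous.continuousOn (by fun_prop)
  have hsl : ∀ {h : ℝ → ℝ × ℝ → ℝ},
      ContinuousOn (Function.uncurry h) (Metric.ball (0 : ℝ) δ ×ˢ K) →
      ∀ ε ∈ Metric.ball (0 : ℝ) δ, ContinuousOn (h ε) K := fun hh ε hε =>
    hh.comp (f := fun x => (ε, x)) (Continuous.continuousOn (by fun_prop)) fun x hx => ⟨hε, hx⟩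
  have hsqd : ∀ ε ∈ Metric.ball (0 : ℝ) δ, ∀ x ∈ K,
      HasDerivAt (fun ε => √(D ε x)) (D' ε x / (2 * √(D ε x))) ε := fun ε hε x hx =>
    (hDd ε x).sqrt (hD0 ε hε x hx).ne'
  have d1 : ∀ ε ∈ Metric.ball (0 : ℝ) δ, ∀ x ∈ K, HasDerivAt (fun ε => g ε x) (g' ε x) ε := by
    intro ε hε x hx
    have h0 : √(D ε x) ≠ 0 := (Real.sqrt_pos.2 (hD0 ε hε x hx)).ne'
    refine ((hasDerivAt_const ε (1 : ℝ)).div (hsqd ε hε x hx) h0).congr_deriv ?_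
    simp only [hg']
    field_simp
    ring
  have d2 : ∀ ε ∈ Metric.ball (0 : ℝ) δ, ∀ x ∈ K, HasDerivAt (fun ε => g' ε x) (g'' ε x) ε := by
    intro ε hε x hx
    have h0 : √(D ε x) ≠ 0 := (Real.sqrt_pos.2 (hD0 ε hε x hx)).ne'
    have hDd' : HasDerivAt (fun ε => D' ε x) (2 * ‖p x.1‖ ^ 2) ε := by
      have h := (((hasDerivAt_id ε).const_mul 2).mul_const (‖p x.1‖ ^ 2)).sub_const
        (2 * inner ℝ (p x.1) (s x.2))
      exact h.congr_deriv (by simp)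
    refine (hDd'.neg.div (((hsqd ε hε x hx).pow 3).const_mul 2)
      (mul_ne_zero two_ne_zero (pow_ne_zero _ h0))).congr_deriv ?_
    simp only [hg'', Pi.neg_apply, Pi.pow_apply]
    field_simp
    ring
  have hint : ∀ {h : ℝ → ℝ × ℝ → ℝ},
      ContinuousOn (Function.uncurry h) (Metric.ball (0 : ℝ) δ ×ˢ K) →
      ∀ ε ∈ Metric.ball (0 : ℝ) δ, IntegrableOn (h ε) K volume := fun hh ε hε =>
    (hsl hh ε hε).integrableOn_compact hKc
  have hm0 : (0 : ℝ) ∈ Metric.ball (0 : ℝ) δ := Metric.mem_ball_self hδ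
  have e0 : (fun ε : ℝ => ∫ l₁ in a..b, ∫ l₂ in a..b, 1 / ‖ε • p l₁ - s l₂‖) =ᶠ[𝓝 0]
      fun ε => ∫ x in K, g ε x := by
    filter_upwards [Metric.isOpen_ball.mem_nhds hm0] with ε hε
    rw [setIntegral_Icc_prod_eq hab (hsl hgc ε hε)]
    simp only [hg, ← hDs]
  have e1 : deriv (fun ε => ∫ x in K, g ε x) =ᶠ[𝓝 0] fun ε => ∫ x in K, g' ε x := by
    filter_upwards [Metric.isOpen_ball.mem_nhds hm0] with ε hε
    exact (hasDerivAt_setIntegral_of_continuousOn hKc hKc.measurableSet (hint hgc) (hint hgc') hgc'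
      d1 hε).deriv
  have e2 := (hasDerivAt_setIntegral_of_continuousOn (μ := volume) hKc hKc.measurableSet (hint hgc')
    (hint hgc'') hgc'' d2 hm0).deriv
  rw [iteratedDeriv_succ, iteratedDeriv_one, (e0.deriv.trans e1).deriv_eq, e2,
    setIntegral_Icc_prod_eq hab (hsl hgc'' 0 hm0)]
  congr 1; funext l₁
  congr 1; funext l₂
  have : √(D 0 (l₁, l₂)) = ‖s l₂‖ := by rw [← hDs]; simp
  simp only [hg'', this]
  simp [hD']
  ring

end PotentialExpansion

/-! ### Kepler's equation and averages along Keplerian ellipses -/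

section Kepler

open Filter Topology MeasureTheory

namespace SpatialThreeBody

variable {e : ℝ}

theorem hasDerivAt_kepler (e ζ : ℝ) :
    HasDerivAt (fun ζ : ℝ => ζ - e * sin ζ) (1 - e * cos ζ) ζ :=
  (hasDerivAt_id ζ).sub ((hasDerivAt_sin ζ).const_mul e)

theorem one_sub_mul_cos_pos (he0 : 0 ≤ e) (he1 : e < 1) (ζ : ℝ) : 0 < 1 - e * cos ζ := by
  nlinarith [cos_le_one ζ]

theorem strictMono_kepler (he0 : 0 ≤ e) (he1 : e < 1) :
    StrictMono fun ζ : ℝ => ζ - e * sin ζ :=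
  strictMono_of_deriv_pos fun ζ => by
    rw [(hasDerivAt_kepler e ζ).deriv]; exact one_sub_mul_cos_pos he0 he1 ζ

theorem surjective_kepler (he0 : 0 ≤ e) (he1 : e < 1) :
    Function.Surjective fun ζ : ℝ => ζ - e * sin ζ := by
  have h : ∀ ζ, |e * sin ζ| ≤ 1 := fun ζ => by
    rw [abs_mul, abs_of_nonneg he0]
    nlinarith [abs_sin_le_one ζ, abs_nonneg (sin ζ)]
  refine Continuous.surjective (by fun_prop) ?_ ?_
  · refine tendsto_atTop_mono (fun ζ => ?_) (tendsto_atTop_add_const_right atTop (-1) tendsto_id)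
    have := abs_le.1 (h ζ)
    simp only [id]; linarith
  · refine tendsto_atBot_mono (fun ζ => ?_) (tendsto_atBot_add_const_right atBot 1 tendsto_id)
    have := abs_le.1 (h ζ)
    simp only [id]; linarith

theorem eccAnomaly_kepler (he0 : 0 ≤ e) (he1 : e < 1) (ζ : ℝ) :
    eccAnomaly e (ζ - e * sin ζ) = ζ :=
  Function.leftInverse_invFun (strictMono_kepler he0 he1).injective ζ

theorem kepler_eccAnomaly (he0 : 0 ≤ e) (he1 : e < 1) (ℓ : ℝ) :
    eccAnomaly e ℓ - e * sin (eccAnomaly e ℓ) = ℓ :=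
  Function.rightInverse_invFun (surjective_kepler he0 he1) ℓ

/-- The inverse of an increasing bijection of the line is monotone and surjective. -/
theorem continuous_eccAnomaly (he0 : 0 ≤ e) (he1 : e < 1) : Continuous (eccAnomaly e) := by
  refine Monotone.continuous_of_surjective (fun a b hab => ?_) fun ζ =>
    ⟨_, eccAnomaly_kepler he0 he1 ζ⟩
  rw [← (strictMono_kepler he0 he1).le_iff_le]
  simpa only [kepler_eccAnomaly he0 he1] using hab

theorem eccAnomaly_add_two_pi (he0 : 0 ≤ e) (he1 : e < 1) (ℓ : ℝ) :
    eccAnomaly e (ℓ + 2 * π) = eccAnomaly e ℓ + 2 * π := by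
  rw [← eccAnomaly_kepler he0 he1 (eccAnomaly e ℓ + 2 * π), sin_add_two_pi]
  congr 1
  linear_combination -kepler_eccAnomaly he0 he1 ℓ

/-- Averages over the mean longitude in terms of the eccentric anomaly. -/
theorem integral_comp_eccAnomaly (he0 : 0 ≤ e) (he1 : e < 1) (ϖ : ℝ) {h : ℝ → ℝ}
    (hc : Continuous h) (hp : Function.Periodic h (2 * π)) :
    ∫ l in (0 : ℝ)..2 * π, h (eccAnomaly e (l - ϖ)) =
      ∫ ζ in (0 : ℝ)..2 * π, h ζ * (1 - e * cos ζ) := by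
  have hper : Function.Periodic (fun ℓ => h (eccAnomaly e ℓ)) (2 * π) := fun ℓ => by
    simp only [eccAnomaly_add_two_pi he0 he1, hp (eccAnomaly e ℓ)]
  rw [intervalIntegral.integral_comp_sub_right (fun ℓ => h (eccAnomaly e ℓ)),
    show 2 * π - ϖ = (0 - ϖ) + 2 * π by ring, hper.intervalIntegral_add_eq (0 - ϖ) 0, zero_add]
  have := intervalIntegral.integral_comp_mul_deriv (a := 0) (b := 2 * π)
    (g := fun ℓ => h (eccAnomaly e ℓ)) (fun ζ _ => hasDerivAt_kepler e ζ)
    (Continuous.continuousOn (by fun_prop)) (hc.comp (continuous_eccAnomaly he0 he1))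
  simp only [Function.comp_def, eccAnomaly_kepler he0 he1, sin_zero, sin_two_pi, mul_zero,
    sub_zero] at this
  exact this.symm

/-- The coordinates in the plane of a Keplerian orbit, from a line at the angle `-g` from the
perihelion, as functions of the eccentric anomaly. -/
noncomputable def orbitX (a e g ζ : ℝ) : ℝ :=
  a * (cos g * (cos ζ - e) - sin g * (√(1 - e ^ 2) * sin ζ))

noncomputable def orbitY (a e g ζ : ℝ) : ℝ :=
  a * (sin g * (cos ζ - e) + cos g * (√(1 - e ^ 2) * sin ζ))

theorem continuous_orbitX (a e g : ℝ) : Continuous (orbitX a e g) := by unfold orbitX; fun_prop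
theorem continuous_orbitY (a e g : ℝ) : Continuous (orbitY a e g) := by unfold orbitY; fun_prop

theorem periodic_orbitX (a e g : ℝ) : Function.Periodic (orbitX a e g) (2 * π) := fun ζ => by
  simp [orbitX]

theorem periodic_orbitY (a e g : ℝ) : Function.Periodic (orbitY a e g) (2 * π) := fun ζ => by
  simp [orbitY]

theorem one_sub_sq_pos (he0 : 0 ≤ e) (he1 : e < 1) : 0 < 1 - e ^ 2 := by nlinarith

theorem orbitX_sq_add_orbitY_sq (he0 : 0 ≤ e) (he1 : e < 1) (a g ζ : ℝ) :
    orbitX a e g ζ ^ 2 + orbitY a e g ζ ^ 2 = (a * (1 - e * cos ζ)) ^ 2 := by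
  have h1 := Real.sq_sqrt (one_sub_sq_pos he0 he1).le
  have h2 := sin_sq_add_cos_sq ζ
  have h3 := sin_sq_add_cos_sq g
  unfold orbitX orbitY
  linear_combination a ^ 2 * ((cos ζ - e) ^ 2 + √(1 - e ^ 2) ^ 2 * sin ζ ^ 2) * h3 +
    a ^ 2 * sin ζ ^ 2 * h1 + a ^ 2 * (1 - e ^ 2) * h2

/-- From an explicit antiderivative: its periodic part drops out over a period and only the
multiples of ζ count. -/
theorem integral_orbit_sq (a e : ℝ) :
    ∫ ζ in (0 : ℝ)..2 * π, (a * (1 - e * cos ζ)) ^ 2 * (1 - e * cos ζ) =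
      2 * π * a ^ 2 * (1 + 3 / 2 * e ^ 2) := by
  have hd : ∀ ζ ∈ uIcc 0 (2 * π), HasDerivAt (fun ζ : ℝ => a ^ 2 * (ζ - 3 * e * sin ζ +
      3 / 2 * e ^ 2 * (ζ + sin ζ * cos ζ) - e ^ 3 * (sin ζ - 1 / 3 * sin ζ ^ 3)))
      ((a * (1 - e * cos ζ)) ^ 2 * (1 - e * cos ζ)) ζ := by
    intro ζ _
    have hs := hasDerivAt_sin ζ
    have hc := hasDerivAt_cos ζ
    have h := (((((hasDerivAt_id ζ).sub (hs.const_mul (3 * e))).add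
      (((hasDerivAt_id ζ).add (hs.mul hc)).const_mul (3 / 2 * e ^ 2))).sub
      ((hs.sub ((hs.pow 3).const_mul (1 / 3))).const_mul (e ^ 3))).const_mul (a ^ 2))
    refine h.congr_deriv ?_
    push_cast
    linear_combination a ^ 2 * (3 / 2 * e ^ 2 * (-1) + e ^ 3 * cos ζ) * sin_sq_add_cos_sq ζ
  rw [intervalIntegral.integral_eq_sub_of_hasDerivAt hd
    (Continuous.intervalIntegrable (by fun_prop) _ _)]
  simp
  ring

/-- The cross term in sin g cos g is odd in ζ and does not contribute. The term e² sin² g is the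
only trace of the inner perihelion in the averaged quadrupole. -/
theorem integral_orbitY_sq (he0 : 0 ≤ e) (he1 : e < 1) (a g : ℝ) :
    ∫ ζ in (0 : ℝ)..2 * π, orbitY a e g ζ ^ 2 * (1 - e * cos ζ) =
      2 * π * a ^ 2 * ((1 - e ^ 2) / 2 + 5 / 2 * e ^ 2 * sin g ^ 2) := by
  have hb := Real.sq_sqrt (one_sub_sq_pos he0 he1).le
  set b := √(1 - e ^ 2) with hbdef
  have hd : ∀ ζ ∈ uIcc 0 (2 * π), HasDerivAt (fun ζ : ℝ => a ^ 2 * (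
      sin g ^ 2 * ((1 + 2 * e ^ 2) / 2 * (ζ + sin ζ * cos ζ) - (2 * e + e ^ 3) * sin ζ + e ^ 2 * ζ -
        e * (sin ζ - 1 / 3 * sin ζ ^ 3)) +
      2 * sin g * cos g * b * (-((1 + e ^ 2) / 2) * cos ζ ^ 2 + e / 3 * cos ζ ^ 3 + e * cos ζ) +
      cos g ^ 2 * b ^ 2 * (1 / 2 * (ζ - sin ζ * cos ζ) - e / 3 * sin ζ ^ 3)))
      (orbitY a e g ζ ^ 2 * (1 - e * cos ζ)) ζ := by
    intro ζ _
    have hi := hasDerivAt_id ζ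
    have hs := hasDerivAt_sin ζ
    have hc := hasDerivAt_cos ζ
    have hsc := hs.mul hc
    have h1 := ((((hi.add hsc).const_mul ((1 + 2 * e ^ 2) / 2)).sub
      (hs.const_mul (2 * e + e ^ 3))).add (hi.const_mul (e ^ 2))).sub
      ((hs.sub ((hs.pow 3).const_mul (1 / 3))).const_mul e)
    have h2 := (((hc.pow 2).const_mul (-((1 + e ^ 2) / 2))).add ((hc.pow 3).const_mul (e / 3))).add
      (hc.const_mul e)
    have h3 := ((hi.sub hsc).const_mul (1 / 2)).sub ((hs.pow 3).const_mul (e / 3))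
    have h := (((h1.const_mul (sin g ^ 2)).add (h2.const_mul (2 * sin g * cos g * b))).add
      (h3.const_mul (cos g ^ 2 * b ^ 2))).const_mul (a ^ 2)
    refine h.congr_deriv ?_
    simp only [orbitY, ← hbdef]
    push_cast
    linear_combination a ^ 2 * (sin g ^ 2 * (-(1 + 2 * e ^ 2) / 2 + e * cos ζ) -
      cos g ^ 2 * b ^ 2 / 2) * sin_sq_add_cos_sq ζ
  rw [intervalIntegral.integral_eq_sub_of_hasDerivAt hd
    (Continuous.intervalIntegrable (by unfold orbitY; fun_prop) _ _)]
  simp only [sin_two_pi, cos_two_pi, sin_zero, cos_zero]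
  linear_combination π * a ^ 2 * cos g ^ 2 * hb + π * a ^ 2 * (1 - e ^ 2) * sin_sq_add_cos_sq g

/-- The averages of `cos 2 v / r³` and `sin 2 v / r³`, with the true anomaly `v`, vanish. -/
theorem integral_quadrupole_eq_zero (he0 : 0 ≤ e) (he1 : e < 1) (α β : ℝ) :
    ∫ ζ in (0 : ℝ)..2 * π, (α * ((cos ζ - e) ^ 2 - (√(1 - e ^ 2) * sin ζ) ^ 2) +
      β * ((cos ζ - e) * (√(1 - e ^ 2) * sin ζ))) / (1 - e * cos ζ) ^ 5 * (1 - e * cos ζ) = 0 := by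
  have hb := Real.sq_sqrt (one_sub_sq_pos he0 he1).le
  have hb0 : √(1 - e ^ 2) ≠ 0 := (Real.sqrt_pos.2 (one_sub_sq_pos he0 he1)).ne'
  set b := √(1 - e ^ 2) with hbdef
  have hρ : ∀ ζ, 1 - e * cos ζ ≠ 0 := fun ζ => (one_sub_mul_cos_pos he0 he1 ζ).ne'
  -- `C` and `S` are the cosine and sine of the true anomaly v; here dv/dζ = b / (1 - e cos ζ), and
  -- `hCe` is the polar equation of the ellipse.
  set C : ℝ → ℝ := fun ζ => (cos ζ - e) / (1 - e * cos ζ) with hC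
  set S : ℝ → ℝ := fun ζ => b * sin ζ / (1 - e * cos ζ) with hS
  have hρd : ∀ ζ, HasDerivAt (fun ζ : ℝ => 1 - e * cos ζ) (e * sin ζ) ζ := fun ζ =>
    (((hasDerivAt_cos ζ).const_mul e).const_sub 1).congr_deriv (by ring)
  have dC : ∀ ζ, HasDerivAt C (-(S ζ * (b / (1 - e * cos ζ)))) ζ := by
    intro ζ
    refine (((hasDerivAt_cos ζ).sub_const e).div (hρd ζ) (hρ ζ)).congr_deriv ?_
    have := hρ ζ
    simp only [hS]
    field_simp
    linear_combination sin ζ * hb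
  have dS : ∀ ζ, HasDerivAt S (C ζ * (b / (1 - e * cos ζ))) ζ := by
    intro ζ
    refine (((hasDerivAt_sin ζ).const_mul b).div (hρd ζ) (hρ ζ)).congr_deriv ?_
    rw [div_mul_div_comm, ← sq]
    congr 1
    linear_combination (-(e * b)) * sin_sq_add_cos_sq ζ
  have hSC : ∀ ζ, S ζ ^ 2 + C ζ ^ 2 = 1 := by
    intro ζ
    have := hρ ζ
    simp only [hC, hS]
    field_simp
    linear_combination sin ζ ^ 2 * hb + (1 - e ^ 2) * sin_sq_add_cos_sq ζ
  have hCe : ∀ ζ, 1 + e * C ζ = b ^ 2 / (1 - e * cos ζ) := by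
    intro ζ
    have := hρ ζ
    simp only [hC]
    field_simp
    linear_combination -hb
  -- In the variable v the form to integrate is b⁻³ (α cos 2v + β cos v sin v) (1 + e cos v) dv: a
  -- trigonometric polynomial with no constant term, so its antiderivative is a polynomial in cos v
  -- and sin v, hence periodic.
  have hd : ∀ ζ ∈ uIcc 0 (2 * π), HasDerivAt (fun ζ : ℝ => 1 / b ^ 3 * (
      α * (S ζ * C ζ + e * (S ζ - 2 / 3 * S ζ ^ 3)) + β * (1 / 2 * S ζ ^ 2 - e / 3 * C ζ ^ 3)))
      ((α * ((cos ζ - e) ^ 2 - (b * sin ζ) ^ 2) +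
      β * ((cos ζ - e) * (b * sin ζ))) / (1 - e * cos ζ) ^ 5 * (1 - e * cos ζ)) ζ := by
    intro ζ _
    have h1 := (((dS ζ).mul (dC ζ)).add
      (((dS ζ).sub (((dS ζ).pow 3).const_mul (2 / 3))).const_mul e)).const_mul α
    have h2 := ((((dS ζ).pow 2).const_mul (1 / 2)).sub (((dC ζ).pow 3).const_mul (e / 3))).const_mul β
    refine ((h1.add h2).const_mul (1 / b ^ 3)).congr_deriv ?_
    have h3 : (α * ((cos ζ - e) ^ 2 - (b * sin ζ) ^ 2) + β * ((cos ζ - e) * (b * sin ζ))) /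
        (1 - e * cos ζ) ^ 5 * (1 - e * cos ζ) =
        (α * (C ζ ^ 2 - S ζ ^ 2) + β * (C ζ * S ζ)) * (1 + e * C ζ) * (1 / b ^ 2) /
          (1 - e * cos ζ) := by
      rw [hCe]
      have := hρ ζ
      simp only [hC, hS]
      field_simp
    have h4 : 1 / b ^ 3 * (b / (1 - e * cos ζ)) = 1 / b ^ 2 / (1 - e * cos ζ) := by
      field_simp
    rw [h3]
    push_cast
    have h5 := hSC ζ
    linear_combination
      (α * (C ζ ^ 2 - S ζ ^ 2) + α * e * (C ζ - 2 * S ζ ^ 2 * C ζ) + β * (S ζ * C ζ) +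
        β * e * C ζ ^ 2 * S ζ) * h4 - α * e * C ζ * (1 / b ^ 2 / (1 - e * cos ζ)) * h5
  rw [intervalIntegral.integral_eq_sub_of_hasDerivAt hd ?_]
  · simp [hC, hS]
  · refine Continuous.intervalIntegrable (Continuous.mul (Continuous.div (by fun_prop) (by fun_prop)
      fun ζ => pow_ne_zero _ (hρ ζ)) (by fun_prop)) _ _

/-- Turning the axes by g only mixes cos 2v / r³ and sin 2v / r³, whose averages both vanish. -/
theorem integral_orbit_quadrupole (he0 : 0 ≤ e) (he1 : e < 1) {a : ℝ} (ha : a ≠ 0) (g : ℝ) :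
    ∫ ζ in (0 : ℝ)..2 * π, (orbitX a e g ζ ^ 2 - orbitY a e g ζ ^ 2) / (a * (1 - e * cos ζ)) ^ 5 *
      (1 - e * cos ζ) = 0 ∧
    ∫ ζ in (0 : ℝ)..2 * π, orbitX a e g ζ * orbitY a e g ζ / (a * (1 - e * cos ζ)) ^ 5 *
      (1 - e * cos ζ) = 0 := by
  have hρ : ∀ ζ, 1 - e * cos ζ ≠ 0 := fun ζ => (one_sub_mul_cos_pos he0 he1 ζ).ne'
  constructor
  · refine Eq.trans ?_ (integral_quadrupole_eq_zero he0 he1 ((cos g ^ 2 - sin g ^ 2) / a ^ 3)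
      (-(4 * sin g * cos g) / a ^ 3))
    congr 1; funext ζ
    have := hρ ζ
    unfold orbitX orbitY
    field_simp
    ring
  · refine Eq.trans ?_ (integral_quadrupole_eq_zero he0 he1 (sin g * cos g / a ^ 3)
      ((cos g ^ 2 - sin g ^ 2) / a ^ 3))
    congr 1; funext ζ
    have := hρ ζ
    unfold orbitX orbitY
    field_simp
    ring

/-- The double integral of the quadrupole term for two planar motions in planes with mutual
inclination of cosine `k`, if the outer motion has no quadrupole anisotropy. -/
theorem integral_integral_quadrupole {x₁ y₁ x₂ y₂ r : ℝ → ℝ} (hx₁ : Continuous x₁)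
    (hy₁ : Continuous y₁) (hx₂ : Continuous x₂) (hy₂ : Continuous y₂) (hr : Continuous r)
    (hr0 : ∀ t, r t ≠ 0) (hxy : ∀ t, x₂ t ^ 2 + y₂ t ^ 2 = r t ^ 2) {a b : ℝ}
    (h₁ : ∫ t in a..b, (x₂ t ^ 2 - y₂ t ^ 2) / r t ^ 5 = 0)
    (h₂ : ∫ t in a..b, x₂ t * y₂ t / r t ^ 5 = 0) (k : ℝ) :
    ∫ s in a..b, ∫ t in a..b, (3 * (x₁ s * x₂ t + k * (y₁ s * y₂ t)) ^ 2 / r t ^ 5 -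
      (x₁ s ^ 2 + y₁ s ^ 2) / r t ^ 3) =
    (∫ t in a..b, 1 / r t ^ 3) * (1 / 2 * (∫ s in a..b, (x₁ s ^ 2 + y₁ s ^ 2)) -
      3 / 2 * (1 - k ^ 2) * ∫ s in a..b, y₁ s ^ 2) := by
  have c0 : Continuous fun t => 1 / r t ^ 3 :=
    continuous_const.div (hr.pow 3) fun t => pow_ne_zero _ (hr0 t)
  have c1 : Continuous fun t => (x₂ t ^ 2 - y₂ t ^ 2) / r t ^ 5 :=
    ((hx₂.pow 2).sub (hy₂.pow 2)).div (hr.pow 5) fun t => pow_ne_zero _ (hr0 t)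
  have c2 : Continuous fun t => x₂ t * y₂ t / r t ^ 5 :=
    (hx₂.mul hy₂).div (hr.pow 5) fun t => pow_ne_zero _ (hr0 t)
  have inner : ∀ s, ∫ t in a..b, (3 * (x₁ s * x₂ t + k * (y₁ s * y₂ t)) ^ 2 / r t ^ 5 -
      (x₁ s ^ 2 + y₁ s ^ 2) / r t ^ 3) = (1 / 2 * (x₁ s ^ 2 + y₁ s ^ 2) -
        3 / 2 * (1 - k ^ 2) * y₁ s ^ 2) * ∫ t in a..b, 1 / r t ^ 3 := by
    intro s
    -- The outer quadrupole tensor is split into its isotropic part, through x₂² + y₂² = r², and the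
    -- two anisotropies whose integrals vanish.
    have e : ∀ t, 3 * (x₁ s * x₂ t + k * (y₁ s * y₂ t)) ^ 2 / r t ^ 5 -
        (x₁ s ^ 2 + y₁ s ^ 2) / r t ^ 3 =
        (1 / 2 * (x₁ s ^ 2 + y₁ s ^ 2) - 3 / 2 * (1 - k ^ 2) * y₁ s ^ 2) * (1 / r t ^ 3) +
        3 / 2 * (x₁ s ^ 2 - k ^ 2 * y₁ s ^ 2) * ((x₂ t ^ 2 - y₂ t ^ 2) / r t ^ 5) +
        6 * k * x₁ s * y₁ s * (x₂ t * y₂ t / r t ^ 5) := by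
      intro t
      have := hr0 t
      have e1 : 1 / r t ^ 3 = (x₂ t ^ 2 + y₂ t ^ 2) / r t ^ 5 := by
        rw [hxy]; field_simp
      have e2 : (x₁ s ^ 2 + y₁ s ^ 2) / r t ^ 3 = (x₁ s ^ 2 + y₁ s ^ 2) * (1 / r t ^ 3) := by ring
      rw [e2, e1]
      ring
    simp only [e]
    rw [intervalIntegral.integral_add, intervalIntegral.integral_add,
      intervalIntegral.integral_const_mul, intervalIntegral.integral_const_mul,
      intervalIntegral.integral_const_mul, h₁, h₂, mul_zero, mul_zero, add_zero, add_zero]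
    all_goals exact Continuous.intervalIntegrable (by fun_prop) _ _
  simp only [inner]
  rw [intervalIntegral.integral_mul_const, intervalIntegral.integral_sub,
    intervalIntegral.integral_const_mul, intervalIntegral.integral_const_mul]
  · ring
  all_goals exact Continuous.intervalIntegrable (by fun_prop) _ _

end SpatialThreeBody

end Kepler

/-! ### An explicit analytic normal form of the quadrupole term -/

section Quadrupole

open Filter Topology C3

namespace C3

/-- A map of the first two coordinate planes that moves `m X² + n Y²` from the second action to the
first one, where `X + i Y = x₀ conj x₁`. -/
noncomputable def actionShear (m n : ℝ) (x : C3) : C3 :=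
  WithLp.toLp 2 ![
    x 0 + x 1 * ⟨2 * m / (1 + √(1 + 4 * m * act x 1)) * (x 0 * star (x 1)).re,
      2 * n / (1 + √(1 + 4 * n * act x 1)) * (x 0 * star (x 1)).im⟩,
    x 1 - x 0 * ⟨2 * m / (1 + √(1 - 4 * m * act x 0)) * (x 0 * star (x 1)).re,
      -(2 * n / (1 + √(1 - 4 * n * act x 0)) * (x 0 * star (x 1)).im)⟩,
    x 2]

/-- This is the root of c + a c² = m that stays regular at a = 0, written without a division by a.
-/
theorem sq_coeff {m a : ℝ} (h : 0 < 1 + 4 * m * a) :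
    2 * m / (1 + √(1 + 4 * m * a)) + a * (2 * m / (1 + √(1 + 4 * m * a))) ^ 2 = m := by
  have hs := Real.sq_sqrt h.le
  have h0 := Real.sqrt_nonneg (1 + 4 * m * a)
  set s := √(1 + 4 * m * a)
  field_simp
  linear_combination (-m) * hs

/-- Expand |x₀ + x₁ w|² / 2 for w = c₁ X + i c₂ Y: the cross term is c₁ X² + c₂ Y², the square adds
c₁² X² + c₂² Y² times the second action, and `sq_coeff` sums the two to m X² + n Y². -/
theorem act_actionShear_zero {m n : ℝ} {x : C3} (hm : 0 < 1 + 4 * m * act x 1)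
    (hn : 0 < 1 + 4 * n * act x 1) : act (actionShear m n x) 0 =
      act x 0 + m * (x 0 * star (x 1)).re ^ 2 + n * (x 0 * star (x 1)).im ^ 2 := by
  have e1 := sq_coeff hm
  have e2 := sq_coeff hn
  unfold actionShear
  set c1 := 2 * m / (1 + √(1 + 4 * m * act x 1))
  set c2 := 2 * n / (1 + √(1 + 4 * n * act x 1))
  rw [← e1, ← e2]
  simp only [act, Matrix.cons_val_zero, Complex.add_re, Complex.add_im, Complex.mul_re,
    Complex.mul_im, Complex.star_def, Complex.conj_re, Complex.conj_im]
  ring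

theorem act_actionShear_one {m n : ℝ} {x : C3} (hm : 0 < 1 - 4 * m * act x 0)
    (hn : 0 < 1 - 4 * n * act x 0) : act (actionShear m n x) 1 =
      act x 1 - m * (x 0 * star (x 1)).re ^ 2 - n * (x 0 * star (x 1)).im ^ 2 := by
  have e1 := sq_coeff (m := -m) (a := act x 0) (by linarith)
  have e2 := sq_coeff (m := -n) (a := act x 0) (by linarith)
  rw [show 1 + 4 * -m * act x 0 = 1 - 4 * m * act x 0 by ring] at e1
  rw [show 1 + 4 * -n * act x 0 = 1 - 4 * n * act x 0 by ring] at e2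
  have f1 : 2 * -m / (1 + √(1 - 4 * m * act x 0)) = -(2 * m / (1 + √(1 - 4 * m * act x 0))) := by
    ring
  have f2 : 2 * -n / (1 + √(1 - 4 * n * act x 0)) = -(2 * n / (1 + √(1 - 4 * n * act x 0))) := by
    ring
  rw [f1] at e1
  rw [f2] at e2
  unfold actionShear
  set c1 := 2 * m / (1 + √(1 - 4 * m * act x 0))
  set c2 := 2 * n / (1 + √(1 - 4 * n * act x 0))
  simp only [act, Matrix.cons_val_one, Matrix.cons_val_zero, Complex.sub_re, Complex.sub_im,
    Complex.mul_re, Complex.mul_im, Complex.star_def, Complex.conj_re, Complex.conj_im] at e1 e2 ⊢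
  linear_combination
    ((x 0).re * (x 1).re - (x 0).im * -(x 1).im) ^ 2 * e1 +
    ((x 0).re * -(x 1).im + (x 0).im * (x 1).re) ^ 2 * e2

/-- X + i Y is invariant under the simultaneous rotations, so both terms of each coordinate acquire
the same phase. -/
theorem actionShear_tor_dir01 (m n r : ℝ) (x : C3) :
    actionShear m n (tor (r • dir01) x) = tor (r • dir01) (actionShear m n x) := by
  have h0 : tor (r • dir01) x 0 = Complex.exp (r * Complex.I) * x 0 := by simp [tor_apply, dir01]
  have h1 : tor (r • dir01) x 1 = Complex.exp (r * Complex.I) * x 1 := by simp [tor_apply, dir01]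
  have hs : Complex.exp (r * Complex.I) * x 0 * star (Complex.exp (r * Complex.I) * x 1) =
      x 0 * star (x 1) := by
    have : Complex.exp (r * Complex.I) * star (Complex.exp (r * Complex.I)) = 1 := by
      rw [Complex.star_def, Complex.mul_conj, Complex.normSq_eq_norm_sq,
        Complex.norm_exp_ofReal_mul_I]
      simp
    rw [star_mul']
    linear_combination (x 0 * star (x 1)) * this
  ext j
  fin_cases j
  · simp only [actionShear, act_tor, h0, h1, hs]
    simp [tor_apply, dir01]
    ring
  · simp only [actionShear, act_tor, h0, h1, hs]
    simp [tor_apply, dir01]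
    ring
  · simp [actionShear, tor_apply]

theorem actionShear_tor_dir2 (m n r : ℝ) (x : C3) :
    actionShear m n (tor (r • dir2) x) = tor (r • dir2) (actionShear m n x) := by
  have h0 : tor (r • dir2) x 0 = x 0 := by simp [tor_apply, dir2]
  have h1 : tor (r • dir2) x 1 = x 1 := by simp [tor_apply, dir2]
  ext j
  fin_cases j
  · simp only [actionShear, act_tor, h0, h1]
    simp [tor_apply, dir2]
  · simp only [actionShear, act_tor, h0, h1]
    simp [tor_apply, dir2]
  · simp [actionShear, tor_apply]

theorem analyticAt_actionShear {E : Type*} [NormedAddCommGroup E] [NormedSpace ℝ E]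
    {m n : E → ℝ} {g : E → C3} {q : E} (hm : AnalyticAt ℝ m q) (hn : AnalyticAt ℝ n q)
    (hg : AnalyticAt ℝ g q)
    (h : ∀ j : Fin 3, 0 < 1 + 4 * m q * act (g q) j ∧ 0 < 1 - 4 * m q * act (g q) j ∧
      0 < 1 + 4 * n q * act (g q) j ∧ 0 < 1 - 4 * n q * act (g q) j) :
    AnalyticAt ℝ (fun q => actionShear (m q) (n q) (g q)) q := by
  have coeffp : ∀ {m : E → ℝ} (j : Fin 3), AnalyticAt ℝ m q → 0 < 1 + 4 * m q * act (g q) j →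
      AnalyticAt ℝ (fun q => 2 * m q / (1 + √(1 + 4 * m q * act (g q) j))) q := by
    intro m j hm h
    refine (analyticAt_const.mul hm).div (analyticAt_const.add (AnalyticAt.real_sqrt
      (analyticAt_const.add ((analyticAt_const.mul hm).mul (hg.act_coord j))) h)) (by positivity)
  have coeffm : ∀ {m : E → ℝ} (j : Fin 3), AnalyticAt ℝ m q → 0 < 1 - 4 * m q * act (g q) j →
      AnalyticAt ℝ (fun q => 2 * m q / (1 + √(1 - 4 * m q * act (g q) j))) q := by
    intro m j hm h
    refine (analyticAt_const.mul hm).div (analyticAt_const.add (AnalyticAt.real_sqrt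
      (analyticAt_const.sub ((analyticAt_const.mul hm).mul (hg.act_coord j))) h)) (by positivity)
  have r := hg.re_coord
  have i := hg.im_coord
  have hX : AnalyticAt ℝ (fun q => (g q 0 * star (g q 1)).re) q := by
    have := ((r 0).mul (r 1)).add ((i 0).mul (i 1))
    refine this.congr (Filter.Eventually.of_forall fun q => ?_)
    simp
  have hY : AnalyticAt ℝ (fun q => (g q 0 * star (g q 1)).im) q := by
    have := (((r 0).mul (i 1)).neg).add ((i 0).mul (r 1))
    refine this.congr (Filter.Eventually.of_forall fun q => ?_)
    simp
  have a1 := (coeffp 1 hm (h 1).1).mul hX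
  have a2 := (coeffp 1 hn (h 1).2.2.1).mul hY
  have b1 := (coeffm 0 hm (h 0).2.1).mul hX
  have b2 := ((coeffm 0 hn (h 0).2.2.2).mul hY).neg
  refine analyticAt_iff_coords.2 fun j => ?_
  fin_cases j
  · constructor
    · exact (r 0).add (((r 1).mul a1).sub ((i 1).mul a2))
    · exact (i 0).add (((r 1).mul a2).add ((i 1).mul a1))
  · constructor
    · exact (r 1).sub (((r 0).mul b1).sub ((i 0).mul b2))
    · exact (i 1).sub (((r 0).mul b2).add ((i 0).mul b1))
  · exact ⟨r 2, i 2⟩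

end C3

namespace Quadrupole

noncomputable section

/-- The dependence of the averaged quadrupole term on `Λ₁`, `Λ₂`, the actions `t₁`, `t₂`, `t` and
on `w = Y²`, up to a factor depending on `Λ` and `t₂`. -/
def shape (L₁ L₂ t₁ t₂ t w : ℝ) : ℝ :=
  1 + 3 * t₁ * (2 * L₁ - t₁) / (2 * L₁ ^ 2) -
    (t / 8 + 5 / 32 * (2 * L₁ - t₁) / (L₁ - t₁) ^ 2 * w) * (3 / (L₁ ^ 2 * (L₂ - t₂) ^ 2)) *
      ((2 * (L₁ - t₁) - t) * (2 * (L₂ - t₂) - t) * (2 * (L₁ - t₁) + 2 * (L₂ - t₂) - t))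

/-- The coefficients of the quartic polynomial
`(J - t₁) (2 L - J - t₁) (2 G - J + t₁) (2 L + 2 G - J - t₁)` of `t₁`. -/
def quad₁ (L G J : ℝ) : ℝ := -((2 * L - J) * (2 * G - J) * (2 * L + 2 * G - J)) -
  J * (2 * G - J) * (2 * L + 2 * G - J) + J * (2 * L - J) * (2 * L + 2 * G - J) -
  J * (2 * L - J) * (2 * G - J)

def quad₂ (L G J : ℝ) : ℝ := (2 * G - J) * (2 * L + 2 * G - J) - (2 * L - J) * (2 * L + 2 * G - J) +
  (2 * L - J) * (2 * G - J) - J * (2 * L + 2 * G - J) + J * (2 * G - J) - J * (2 * L - J)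

def quad₃ (L G J : ℝ) : ℝ := (2 * L + 2 * G - J) - (2 * G - J) + (2 * L - J) + J

/-- The divided difference between t₁ = 0 and t₁ = J, at fixed J, of the part of `shape` without Y².
-/
def slope (L G J : ℝ) : ℝ := 3 * (2 * L - J) / (2 * L ^ 2) -
  3 / (8 * L ^ 2 * G ^ 2) * (quad₁ L G J + quad₂ L G J * J + quad₃ L G J * J ^ 2 - J ^ 3)

/-- What linear interpolation between t₁ = 0 and t₁ = J leaves, divided by t₁ (t₁ - J) = -t₁ t. -/
def remainder (L G J t₁ : ℝ) : ℝ := -(3 / (2 * L ^ 2)) -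
  3 / (8 * L ^ 2 * G ^ 2) * (quad₂ L G J + quad₃ L G J * (t₁ + J) - (t₁ ^ 2 + t₁ * J + J ^ 2))

def base (L G J : ℝ) : ℝ := 1 - 3 / (8 * L ^ 2 * G ^ 2) * (J * (2 * L - J) * (2 * G - J) * (2 * L + 2 * G - J))

/-- The coefficient of `Y²`. -/
def ySlope (L G J t₁ : ℝ) : ℝ := -(15 / 32 * (2 * L - t₁) / ((L - t₁) ^ 2 * L ^ 2 * G ^ 2)) *
  ((2 * L - J - t₁) * (2 * G - J + t₁) * (2 * L + 2 * G - J - t₁))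

/-- The product t₁ t = (X² + Y²)/4 shares the remainder equally between X² and Y²; `ySlope` then
enters the coefficient of Y² alone. -/
def mCoeff (L G J t₁ : ℝ) : ℝ := -(remainder L G J t₁ / (4 * slope L G J))

def nCoeff (L G J t₁ : ℝ) : ℝ := ySlope L G J t₁ / slope L G J - remainder L G J t₁ / (4 * slope L G J)

theorem shape_eq (L t₁ L₂ t₂ t X Y : ℝ) (h : slope L (L₂ - t₂) (t₁ + t) ≠ 0)
    (hXY : 4 * t₁ * t = X ^ 2 + Y ^ 2) :
    shape L L₂ t₁ t₂ t (Y ^ 2) = base L (L₂ - t₂) (t₁ + t) + slope L (L₂ - t₂) (t₁ + t) *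
      (t₁ + mCoeff L (L₂ - t₂) (t₁ + t) t₁ * X ^ 2 + nCoeff L (L₂ - t₂) (t₁ + t) t₁ * Y ^ 2) := by
  have e1 : slope L (L₂ - t₂) (t₁ + t) * mCoeff L (L₂ - t₂) (t₁ + t) t₁ =
      -(remainder L (L₂ - t₂) (t₁ + t) t₁ / 4) := by
    rw [mCoeff]; field_simp
  have e2 : slope L (L₂ - t₂) (t₁ + t) * nCoeff L (L₂ - t₂) (t₁ + t) t₁ =
      ySlope L (L₂ - t₂) (t₁ + t) t₁ - remainder L (L₂ - t₂) (t₁ + t) t₁ / 4 := by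
    rw [nCoeff]; field_simp
  have e3 : shape L L₂ t₁ t₂ t (Y ^ 2) = base L (L₂ - t₂) (t₁ + t) +
      slope L (L₂ - t₂) (t₁ + t) * t₁ + remainder L (L₂ - t₂) (t₁ + t) t₁ / 4 * (4 * t₁ * t) * (-1) +
      ySlope L (L₂ - t₂) (t₁ + t) t₁ * Y ^ 2 := by
    simp only [shape, base, slope, remainder, ySlope, quad₁, quad₂, quad₃, div_eq_mul_inv, mul_inv]
    ring
  rw [e3, hXY]
  linear_combination (-X ^ 2) * e1 - Y ^ 2 * e2

/-- The nondegeneracy of the problem: at the origin `slope` is the difference of the coefficients of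
t₁ and of t in the linear part of `shape`, that is, of the eccentricity and inclination frequencies
up to a factor. -/
theorem slope_zero_pos {L G : ℝ} (hL : 0 < L) (hG : 0 < G) : 0 < slope L G 0 := by
  have : slope L G 0 = 6 / L + 3 / G := by
    simp only [slope, quad₁, quad₂, quad₃]
    field_simp
    ring
  rw [this]
  positivity

/-- The family of maps bringing `shape` to a function of the invariants and of one action. -/
def normalize (q : (Fin 2 → ℝ) × C3) : C3 :=
  actionShear (mCoeff (q.1 0) (q.1 1 - act q.2 2) (act q.2 0 + act q.2 1) (act q.2 0))
    (nCoeff (q.1 0) (q.1 1 - act q.2 2) (act q.2 0 + act q.2 1) (act q.2 0)) q.2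

theorem normalize_tor_dir01 (q : (Fin 2 → ℝ) × C3) (r : ℝ) :
    normalize (q.1, tor (r • dir01) q.2) = tor (r • dir01) (normalize q) := by
  simp only [normalize, act_tor, actionShear_tor_dir01]

theorem normalize_tor_dir2 (q : (Fin 2 → ℝ) × C3) (r : ℝ) :
    normalize (q.1, tor (r • dir2) q.2) = tor (r • dir2) (normalize q) := by
  simp only [normalize, act_tor, actionShear_tor_dir2]

variable {E : Type*} [NormedAddCommGroup E] [NormedSpace ℝ E]

theorem analyticAt_coeffs {f g j t : E → ℝ} {q : E} (hf : AnalyticAt ℝ f q)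
    (hg : AnalyticAt ℝ g q) (hj : AnalyticAt ℝ j q) (ht : AnalyticAt ℝ t q) (hf0 : f q ≠ 0)
    (hg0 : g q ≠ 0) (hft : f q - t q ≠ 0) (hs : slope (f q) (g q) (j q) ≠ 0) :
    AnalyticAt ℝ (fun q => slope (f q) (g q) (j q)) q ∧
    AnalyticAt ℝ (fun q => mCoeff (f q) (g q) (j q) (t q)) q ∧
    AnalyticAt ℝ (fun q => nCoeff (f q) (g q) (j q) (t q)) q := by
  have q1 : AnalyticAt ℝ (fun q => quad₁ (f q) (g q) (j q)) q := by unfold quad₁; fun_prop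
  have q2 : AnalyticAt ℝ (fun q => quad₂ (f q) (g q) (j q)) q := by unfold quad₂; fun_prop
  have q3 : AnalyticAt ℝ (fun q => quad₃ (f q) (g q) (j q)) q := by unfold quad₃; fun_prop
  have i1 : AnalyticAt ℝ (fun q => 3 / (2 * f q ^ 2)) q :=
    analyticAt_const.div (by fun_prop) (by positivity)
  have i2 : AnalyticAt ℝ (fun q => 3 / (8 * f q ^ 2 * g q ^ 2)) q :=
    analyticAt_const.div (by fun_prop) (by positivity)
  have s1 : AnalyticAt ℝ (fun q => slope (f q) (g q) (j q)) q := by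
    unfold slope
    exact ((AnalyticAt.div (by fun_prop) (by fun_prop) (by positivity))).sub
      (i2.mul (by fun_prop))
  have r1 : AnalyticAt ℝ (fun q => remainder (f q) (g q) (j q) (t q)) q := by
    unfold remainder
    exact i1.neg.sub (i2.mul (by fun_prop))
  have y1 : AnalyticAt ℝ (fun q => ySlope (f q) (g q) (j q) (t q)) q := by
    unfold ySlope
    exact ((AnalyticAt.div (by fun_prop) (by fun_prop) (by positivity)).neg).mul (by fun_prop)
  have d1 : AnalyticAt ℝ (fun q => remainder (f q) (g q) (j q) (t q) /
      (4 * slope (f q) (g q) (j q))) q :=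
    r1.div (analyticAt_const.mul s1) (mul_ne_zero four_ne_zero hs)
  exact ⟨s1, d1.neg, (y1.div s1 hs).sub d1⟩

/-- Near circular coplanar motions, `normalize` is analytic, transforms the actions as a shear, and
`shape` is an affine function of its first action. -/
theorem normalize_spec {Λ : Fin 2 → ℝ} (hΛ : ∀ i, 0 < Λ i) :
    AnalyticAt ℝ normalize (Λ, 0) ∧ ∀ᶠ q in 𝓝 ((Λ, 0) : (Fin 2 → ℝ) × C3),
      (act (normalize q) 0 + act (normalize q) 1 = act q.2 0 + act q.2 1 ∧
        act (normalize q) 2 = act q.2 2) ∧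
      shape (q.1 0) (q.1 1) (act q.2 0) (act q.2 2) (act q.2 1) ((q.2 0 * star (q.2 1)).im ^ 2) =
        base (q.1 0) (q.1 1 - act q.2 2) (act q.2 0 + act q.2 1) +
        slope (q.1 0) (q.1 1 - act q.2 2) (act q.2 0 + act q.2 1) * act (normalize q) 0 := by
  have hq : ∀ i, AnalyticAt ℝ (fun q : (Fin 2 → ℝ) × C3 => q.1 i) (Λ, 0) := fun i =>
    ((ContinuousLinearMap.proj (R := ℝ) (φ := fun _ : Fin 2 => ℝ) i).analyticAt _).comp
      analyticAt_fst
  have ha : ∀ j, AnalyticAt ℝ (fun q : (Fin 2 → ℝ) × C3 => act q.2 j) (Λ, 0) := fun j =>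
    analyticAt_snd.act_coord j
  have h0 : ∀ j, act (0 : C3) j = 0 := fun j => by simp [act]
  have hs : slope (Λ 0) (Λ 1 - act 0 2) (act 0 0 + act 0 1) ≠ 0 := by
    simp only [h0, sub_zero, add_zero]
    exact (slope_zero_pos (hΛ 0) (hΛ 1)).ne'
  obtain ⟨s1, m1, n1⟩ := analyticAt_coeffs (hq 0) ((hq 1).sub (ha 2)) ((ha 0).add (ha 1)) (ha 0)
    (hΛ 0).ne' (by simpa [h0] using (hΛ 1).ne') (by simpa [h0] using (hΛ 0).ne') hs
  have pos : ∀ {m : (Fin 2 → ℝ) × C3 → ℝ}, AnalyticAt ℝ m (Λ, 0) → ∀ j,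
      ∀ᶠ q in 𝓝 ((Λ, 0) : (Fin 2 → ℝ) × C3),
        0 < 1 + 4 * m q * act q.2 j ∧ 0 < 1 - 4 * m q * act q.2 j := by
    intro m hm j
    have c1 := ((analyticAt_const (v := (4 : ℝ))).mul hm).mul (ha j)
    have c2 := ((analyticAt_const (v := (1 : ℝ))).add c1).continuousAt
    have c3 := ((analyticAt_const (v := (1 : ℝ))).sub c1).continuousAt
    exact (c2.eventually (lt_mem_nhds (by simp [h0]))).and
      (c3.eventually (lt_mem_nhds (by simp [h0])))
  refine ⟨analyticAt_actionShear m1 n1 analyticAt_snd fun j => by simp [h0], ?_⟩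
  filter_upwards [pos m1 0, pos m1 1, pos n1 0, pos n1 1,
    s1.continuousAt.eventually (isOpen_ne.mem_nhds hs)] with q hm0 hm1 hn0 hn1 hsq
  have e0 : act (normalize q) 0 = _ := act_actionShear_zero hm1.1 hn1.1
  have e1 : act (normalize q) 1 = _ := act_actionShear_one hm0.2 hn0.2
  refine ⟨⟨by rw [e0, e1]; ring, rfl⟩, ?_⟩
  rw [e0]
  refine shape_eq (q.1 0) (act q.2 0) (q.1 1) (act q.2 2) (act q.2 1) _ _ hsq ?_
  simp only [act, Complex.mul_re, Complex.mul_im, Complex.star_def, Complex.conj_re,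
    Complex.conj_im]
  ring

end

end Quadrupole

end Quadrupole

/-! ### The secular terms of order zero and two in the RPS coordinates -/

section SecularTerms

open Filter Topology MeasureTheory

namespace SpatialThreeBody

theorem tEcc_nonneg (z : Secular) (i : Fin 2) : 0 ≤ tEcc z i := by unfold tEcc; positivity

theorem tInc_nonneg (z : Secular) : 0 ≤ tInc z := by unfold tInc; positivity

theorem semiAxis_pos (D : Masses) {Λ : Fin 2 → ℝ} {i : Fin 2} (h : 0 < Λ i) :
    0 < semiAxis D Λ i := by
  have hM : 0 < D.m0 + D.μ * D.mbar i :=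
    add_pos D.m0_pos (mul_pos D.μ_pos (D.mbar_pos i))
  have hm : 0 < D.m i := div_pos (mul_pos D.m0_pos (D.mbar_pos i)) hM
  have : 0 < D.M i := hM
  unfold semiAxis
  positivity

/-- The eccentricity of an orbit with actions `L` and `L - t`. -/
noncomputable def eccOf (L t : ℝ) : ℝ := √(2 * t / L - (t / L) ^ 2)

theorem ecc_eq (Λ : Fin 2 → ℝ) (z : Secular) (i : Fin 2) : ecc Λ z i = eccOf (Λ i) (tEcc z i) := by
  have : eta z i ^ 2 + xi z i ^ 2 = 2 * tEcc z i := by unfold tEcc; ring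
  rw [ecc, eccOf, this, mul_div_mul_left _ _ two_ne_zero]

theorem eccOf_sq {L t : ℝ} (ht : 0 ≤ t) (hL : t < L) : eccOf L t ^ 2 = t * (2 * L - t) / L ^ 2 := by
  have hL0 : 0 < L := ht.trans_lt hL
  have : 2 * t / L - (t / L) ^ 2 = t * (2 * L - t) / L ^ 2 := by field_simp
  rw [eccOf, this, Real.sq_sqrt]
  have : 0 ≤ 2 * L - t := by linarith
  positivity

theorem eccOf_nonneg (L t : ℝ) : 0 ≤ eccOf L t := Real.sqrt_nonneg _

theorem one_sub_eccOf_sq {L t : ℝ} (ht : 0 ≤ t) (hL : t < L) :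
    1 - eccOf L t ^ 2 = (L - t) ^ 2 / L ^ 2 := by
  have hL0 : 0 < L := ht.trans_lt hL
  rw [eccOf_sq ht hL]
  field_simp
  ring

theorem eccOf_lt_one {L t : ℝ} (ht : 0 ≤ t) (hL : t < L) : eccOf L t < 1 := by
  have hL0 : 0 < L := ht.trans_lt hL
  have h1 := one_sub_eccOf_sq ht hL
  have h2 : 0 < (L - t) ^ 2 / L ^ 2 := by
    have : 0 < L - t := sub_pos.2 hL
    positivity
  nlinarith [eccOf_nonneg L t]

/-- The coordinates of the planets in their orbital planes, from the node. -/
theorem position_eq (D : Masses) (Λ : Fin 2 → ℝ) (z : Secular) (i : Fin 2) (l : ℝ) :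
    position D Λ z i l = WithLp.toLp 2 (![
      cos (nodeLong z) * orbitX (semiAxis D Λ i) (ecc Λ z i) (periLong z i - nodeLong z)
        (eccAnomaly (ecc Λ z i) (l - periLong z i)) -
      sin (nodeLong z) * (cos (incl Λ z i) * orbitY (semiAxis D Λ i) (ecc Λ z i)
        (periLong z i - nodeLong z) (eccAnomaly (ecc Λ z i) (l - periLong z i))),
      sin (nodeLong z) * orbitX (semiAxis D Λ i) (ecc Λ z i) (periLong z i - nodeLong z)
        (eccAnomaly (ecc Λ z i) (l - periLong z i)) +
      cos (nodeLong z) * (cos (incl Λ z i) * orbitY (semiAxis D Λ i) (ecc Λ z i)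
        (periLong z i - nodeLong z) (eccAnomaly (ecc Λ z i) (l - periLong z i))),
      sin (incl Λ z i) * orbitY (semiAxis D Λ i) (ecc Λ z i)
        (periLong z i - nodeLong z) (eccAnomaly (ecc Λ z i) (l - periLong z i))] : Fin 3 → ℝ) := by
  unfold position
  congr 1
  ext j
  fin_cases j <;>
  · simp [rot1, rot3, keplerPos, orbitX, orbitY, Matrix.mulVec, dotProduct,
      Matrix.mul_apply, Fin.sum_univ_three]
    ring

/-- Both orbital planes contain the line of nodes, so the rotation by its longitude cancels and only
the angle between the planes is left. -/
theorem inner_position (D : Masses) (Λ : Fin 2 → ℝ) (z : Secular) (i j : Fin 2) (l l' : ℝ) :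
    inner ℝ (position D Λ z i l) (position D Λ z j l') =
      orbitX (semiAxis D Λ i) (ecc Λ z i) (periLong z i - nodeLong z)
        (eccAnomaly (ecc Λ z i) (l - periLong z i)) *
      orbitX (semiAxis D Λ j) (ecc Λ z j) (periLong z j - nodeLong z)
        (eccAnomaly (ecc Λ z j) (l' - periLong z j)) +
      cos (incl Λ z j - incl Λ z i) * (orbitY (semiAxis D Λ i) (ecc Λ z i)
        (periLong z i - nodeLong z) (eccAnomaly (ecc Λ z i) (l - periLong z i)) *
      orbitY (semiAxis D Λ j) (ecc Λ z j) (periLong z j - nodeLong z)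
        (eccAnomaly (ecc Λ z j) (l' - periLong z j))) := by
  rw [position_eq, position_eq, PiLp.inner_apply, Fin.sum_univ_three, cos_sub]
  simp only [Matrix.cons_val_zero, Matrix.cons_val_one, Matrix.cons_val_two, Matrix.tail_cons,
    Matrix.head_cons, RCLike.inner_apply, conj_trivial]
  set X := orbitX (semiAxis D Λ i) (ecc Λ z i) (periLong z i - nodeLong z)
        (eccAnomaly (ecc Λ z i) (l - periLong z i))
  set X' := orbitX (semiAxis D Λ j) (ecc Λ z j) (periLong z j - nodeLong z)
        (eccAnomaly (ecc Λ z j) (l' - periLong z j))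
  set Y := orbitY (semiAxis D Λ i) (ecc Λ z i) (periLong z i - nodeLong z)
        (eccAnomaly (ecc Λ z i) (l - periLong z i))
  set Y' := orbitY (semiAxis D Λ j) (ecc Λ z j) (periLong z j - nodeLong z)
        (eccAnomaly (ecc Λ z j) (l' - periLong z j))
  linear_combination (X * X' + cos (incl Λ z i) * cos (incl Λ z j) * Y * Y') *
    sin_sq_add_cos_sq (nodeLong z)

theorem RPSDomain.tEcc_lt {Λ : Fin 2 → ℝ} {z : Secular} (h : RPSDomain Λ z) (i : Fin 2) :
    tEcc z i < Λ i := sub_pos.1 (h i).2.1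

theorem norm_position {D : Masses} {Λ : Fin 2 → ℝ} {z : Secular} (h : RPSDomain Λ z) (i : Fin 2)
    (l : ℝ) : ‖position D Λ z i l‖ = semiAxis D Λ i * (1 - ecc Λ z i *
      cos (eccAnomaly (ecc Λ z i) (l - periLong z i))) := by
  have he0 : 0 ≤ ecc Λ z i := Real.sqrt_nonneg _
  have he1 : ecc Λ z i < 1 := by rw [ecc_eq]; exact eccOf_lt_one (tEcc_nonneg z i) (h.tEcc_lt i)
  have h1 := one_sub_mul_cos_pos he0 he1 (eccAnomaly (ecc Λ z i) (l - periLong z i))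
  have h2 := semiAxis_pos D (h i).1
  rw [← sq_eq_sq₀ (norm_nonneg _) (by positivity), ← real_inner_self_eq_norm_sq, inner_position,
    ← orbitX_sq_add_orbitY_sq he0 he1 _ (periLong z i - nodeLong z), sub_self, cos_zero]
  ring

/-- The cosine of the mutual inclination. -/
theorem cos_mutual_inclination {Λ : Fin 2 → ℝ} {z : Secular} (h : RPSDomain Λ z) :
    cos (incl Λ z 1 - incl Λ z 0) =
      (Gtot Λ z ^ 2 - Gam Λ z 0 ^ 2 - Gam Λ z 1 ^ 2) / (2 * Gam Λ z 0 * Gam Λ z 1) := by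
  have h0 := (h 0).2
  have h1 := (h 1).2
  have ht := tInc_nonneg z
  have hGt : Gtot Λ z = Gam Λ z 0 + Gam Λ z 1 - tInc z := rfl
  set a := Gam Λ z 0 with ha
  set b := Gam Λ z 1 with hb
  set G := Gtot Λ z with hG
  have a0 : 0 < a := h0.1
  have b0 : 0 < b := h1.1
  have G0 : 0 < G := by linarith
  have heron : 0 ≤ (a + b + G) * (a + b - G) * ((G + a - b) * (G - a + b)) := by
    have k1 : 0 ≤ a + b - G := by linarith
    have k2 : 0 ≤ G + a - b := by linarith
    have k3 : 0 ≤ G - a + b := by linarith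
    positivity
  have mem : ∀ {a b : ℝ}, 0 < a → 0 ≤ (a + b + G) * (a + b - G) * ((G + a - b) * (G - a + b)) →
      1 - ((G ^ 2 + a ^ 2 - b ^ 2) / (2 * G * a)) ^ 2 =
        (a + b + G) * (a + b - G) * ((G + a - b) * (G - a + b)) / (2 * G * a) ^ 2 ∧
      -1 ≤ (G ^ 2 + a ^ 2 - b ^ 2) / (2 * G * a) ∧ (G ^ 2 + a ^ 2 - b ^ 2) / (2 * G * a) ≤ 1 := by
    intro a b ha hh
    have e : 1 - ((G ^ 2 + a ^ 2 - b ^ 2) / (2 * G * a)) ^ 2 =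
        (a + b + G) * (a + b - G) * ((G + a - b) * (G - a + b)) / (2 * G * a) ^ 2 := by
      field_simp
      ring
    refine ⟨e, abs_le.1 ((sq_le_one_iff_abs_le_one _).1 ?_)⟩
    have : 0 ≤ (a + b + G) * (a + b - G) * ((G + a - b) * (G - a + b)) / (2 * G * a) ^ 2 := by
      positivity
    linarith
  obtain ⟨ea, ma⟩ := mem (b := b) a0 heron
  obtain ⟨eb, mb⟩ := mem (a := b) (b := a) b0 (heron.trans_eq (by ring))
  have i0 : incl Λ z 0 = -arccos ((G ^ 2 + a ^ 2 - b ^ 2) / (2 * G * a)) := by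
    simp [incl, ha, hb, hG]
  have i1 : incl Λ z 1 = arccos ((G ^ 2 + b ^ 2 - a ^ 2) / (2 * G * b)) := by
    simp [incl, ha, hb, hG]
  rw [i0, i1, sub_neg_eq_add, cos_add, cos_arccos ma.1 ma.2, cos_arccos mb.1 mb.2, sin_arccos,
    sin_arccos, ea, eb, ← Real.sqrt_mul (div_nonneg (heron.trans_eq (by ring)) (by positivity))]
  have e : (b + a + G) * (b + a - G) * ((G + b - a) * (G - b + a)) / (2 * G * b) ^ 2 *
      ((a + b + G) * (a + b - G) * ((G + a - b) * (G - a + b)) / (2 * G * a) ^ 2) =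
      ((a + b + G) * (a + b - G) * ((G + a - b) * (G - a + b)) / ((2 * G * a) * (2 * G * b))) ^ 2 := by
    rw [div_mul_div_comm, div_pow]
    congr 1 <;> ring
  rw [e, Real.sqrt_sq (by positivity)]
  field_simp
  ring

/-- Replaces angles that are undefined for circular or coplanar orbits by the polynomial Y²; when
one of the moduli is zero both sides vanish, whatever the angles. -/
theorem sin_sq_periLong_sub_nodeLong (z : Secular) :
    4 * tEcc z 0 * tInc z * sin (periLong z 0 - nodeLong z) ^ 2 =
      (toC3 z 0 * star (toC3 z 1)).im ^ 2 := by
  have hs : ∀ u : ℂ, ‖u‖ ^ 2 = u.re ^ 2 + u.im ^ 2 := fun u => by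
    rw [← Complex.normSq_eq_norm_sq, Complex.normSq_apply]; ring
  have h1 : 2 * tEcc z 0 = ‖toC3 z 0‖ ^ 2 := by rw [hs, toC3_zero, tEcc]; ring
  have h2 : 2 * tInc z = ‖toC3 z 1‖ ^ 2 := by rw [hs, toC3_one, tInc]; ring
  have e : (toC3 z 0 * star (toC3 z 1)).im =
      -(‖toC3 z 0‖ * ‖toC3 z 1‖ * sin (periLong z 0 - nodeLong z)) := by
    have p : periLong z 0 = -Complex.arg (toC3 z 0) := rfl
    have n : nodeLong z = -Complex.arg (toC3 z 1) := rfl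
    rw [p, n, sin_sub, sin_neg, cos_neg, cos_neg, sin_neg, Complex.mul_im, Complex.star_def,
      Complex.conj_re, Complex.conj_im, ← Complex.norm_mul_cos_arg (toC3 z 0),
      ← Complex.norm_mul_sin_arg (toC3 z 0), ← Complex.norm_mul_cos_arg (toC3 z 1),
      ← Complex.norm_mul_sin_arg (toC3 z 1)]
    ring
  rw [e]
  linear_combination (sin (periLong z 0 - nodeLong z) ^ 2) *
    (2 * tInc z * h1 + ‖toC3 z 0‖ ^ 2 * h2)

/-- The integral of `1 / r ^ k` over the mean longitude of the outer planet. -/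
noncomputable def outerMean (D : Masses) (k : ℕ) (Λ : Fin 2 → ℝ) (t : ℝ) : ℝ :=
  ∫ ζ in (0 : ℝ)..2 * π, 1 / (semiAxis D Λ 1 * (1 - eccOf (Λ 1) t * cos ζ)) ^ k *
    (1 - eccOf (Λ 1) t * cos ζ)

/-- At ε = 0 only the distance of the outer planet remains, and one of the two averages is trivial.
-/
theorem f12_zero_eq (D : Masses) {Λ : Fin 2 → ℝ} {z : Secular} (h : RPSDomain Λ z) :
    f12 0 D Λ z = 1 / (2 * π) * outerMean D 1 Λ (tEcc z 1) := by
  have he0 : 0 ≤ ecc Λ z 1 := Real.sqrt_nonneg _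
  have he1 : ecc Λ z 1 < 1 := by rw [ecc_eq]; exact eccOf_lt_one (tEcc_nonneg z 1) (h.tEcc_lt 1)
  have ha := semiAxis_pos D (h 1).1
  have h1 : ∀ ζ, semiAxis D Λ 1 * (1 - ecc Λ z 1 * cos ζ) ≠ 0 := fun ζ =>
    (mul_pos ha (one_sub_mul_cos_pos he0 he1 ζ)).ne'
  have h2 := integral_comp_eccAnomaly he0 he1 (periLong z 1)
    (h := fun ζ => 1 / (semiAxis D Λ 1 * (1 - ecc Λ z 1 * cos ζ)) ^ 1)
    (Continuous.div (by fun_prop) (by fun_prop) fun ζ => pow_ne_zero _ (h1 ζ))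
    (fun ζ => by simp)
  rw [ecc_eq] at h2
  rw [outerMean, ← h2, f12, iteratedDeriv_zero, doubleAverage]
  simp only [zero_smul, zero_sub, norm_neg, norm_position h, ← ecc_eq, pow_one,
    intervalIntegral.integral_const, smul_eq_mul]
  simp
  field_simp

/-- The quadrupole term of the averaged perturbing function. -/
theorem f12_two_eq (D : Masses) {Λ : Fin 2 → ℝ} {z : Secular} (h : RPSDomain Λ z) :
    f12 2 D Λ z = semiAxis D Λ 0 ^ 2 / (8 * π) * outerMean D 3 Λ (tEcc z 1) *
      Quadrupole.shape (Λ 0) (Λ 1) (tEcc z 0) (tEcc z 1) (tInc z)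
        ((toC3 z 0 * star (toC3 z 1)).im ^ 2) := by
  have he0 : ∀ i, 0 ≤ ecc Λ z i := fun i => Real.sqrt_nonneg _
  have he1 : ∀ i, ecc Λ z i < 1 := fun i => by
    rw [ecc_eq]; exact eccOf_lt_one (tEcc_nonneg z i) (h.tEcc_lt i)
  have ha : ∀ i, 0 < semiAxis D Λ i := fun i => semiAxis_pos D (h i).1
  have hE : ∀ i, Continuous fun l => eccAnomaly (ecc Λ z i) (l - periLong z i) := fun i =>
    (continuous_eccAnomaly (he0 i) (he1 i)).comp (by fun_prop)
  have hX : ∀ i, Continuous fun l => orbitX (semiAxis D Λ i) (ecc Λ z i) (periLong z i - nodeLong z)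
      (eccAnomaly (ecc Λ z i) (l - periLong z i)) := fun i => (continuous_orbitX _ _ _).comp (hE i)
  have hY : ∀ i, Continuous fun l => orbitY (semiAxis D Λ i) (ecc Λ z i) (periLong z i - nodeLong z)
      (eccAnomaly (ecc Λ z i) (l - periLong z i)) := fun i => (continuous_orbitY _ _ _).comp (hE i)
  have hρ : ∀ i ζ, semiAxis D Λ i * (1 - ecc Λ z i * cos ζ) ≠ 0 := fun i ζ =>
    (mul_pos (ha i) (one_sub_mul_cos_pos (he0 i) (he1 i) ζ)).ne'
  have hR : Continuous fun l => semiAxis D Λ 1 * (1 - ecc Λ z 1 *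
      cos (eccAnomaly (ecc Λ z 1) (l - periLong z 1))) := by
    have := hE 1
    fun_prop
  have hp : ∀ i, Continuous fun l => position D Λ z i l := by
    intro i
    simp only [position_eq]
    refine (PiLp.continuous_toLp 2 _).comp (continuous_pi fun j => ?_)
    have h1 := hX i
    have h2 := hY i
    fin_cases j
    · exact (continuous_const.mul h1).sub (continuous_const.mul (continuous_const.mul h2))
    · exact (continuous_const.mul h1).add (continuous_const.mul (continuous_const.mul h2))
    · exact continuous_const.mul h2
  have hp0 : ∀ l, position D Λ z 1 l ≠ 0 := fun l => by
    rw [← norm_ne_zero_iff, norm_position h]; exact hρ 1 _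
  have hexp := iteratedDeriv_two_integral_inv_norm two_pi_pos.le (hp 0) (hp 1) hp0
  have hn0 : ∀ l, ‖position D Λ z 0 l‖ ^ 2 =
      orbitX (semiAxis D Λ 0) (ecc Λ z 0) (periLong z 0 - nodeLong z)
        (eccAnomaly (ecc Λ z 0) (l - periLong z 0)) ^ 2 +
      orbitY (semiAxis D Λ 0) (ecc Λ z 0) (periLong z 0 - nodeLong z)
        (eccAnomaly (ecc Λ z 0) (l - periLong z 0)) ^ 2 := fun l => by
    rw [norm_position h, orbitX_sq_add_orbitY_sq (he0 0) (he1 0)]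
  have hquad := integral_orbit_quadrupole (he0 1) (he1 1) (ha 1).ne' (periLong z 1 - nodeLong z)
  have c5 : Continuous fun ζ : ℝ => (semiAxis D Λ 1 * (1 - ecc Λ z 1 * cos ζ)) ^ 5 := by fun_prop
  have hXc := continuous_orbitX (semiAxis D Λ 1) (ecc Λ z 1) (periLong z 1 - nodeLong z)
  have hYc := continuous_orbitY (semiAxis D Λ 1) (ecc Λ z 1) (periLong z 1 - nodeLong z)
  have hXp := periodic_orbitX (semiAxis D Λ 1) (ecc Λ z 1) (periLong z 1 - nodeLong z)
  have hYp := periodic_orbitY (semiAxis D Λ 1) (ecc Λ z 1) (periLong z 1 - nodeLong z)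
  have q1 := (integral_comp_eccAnomaly (he0 1) (he1 1) (periLong z 1)
    (h := fun ζ => (orbitX (semiAxis D Λ 1) (ecc Λ z 1) (periLong z 1 - nodeLong z) ζ ^ 2 -
      orbitY (semiAxis D Λ 1) (ecc Λ z 1) (periLong z 1 - nodeLong z) ζ ^ 2) /
      (semiAxis D Λ 1 * (1 - ecc Λ z 1 * cos ζ)) ^ 5)
    (((hXc.pow 2).sub (hYc.pow 2)).div c5 fun ζ => pow_ne_zero _ (hρ 1 ζ))
    (fun ζ => by simp only [hXp ζ, hYp ζ, cos_add_two_pi])).trans hquad.1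
  have q2 := (integral_comp_eccAnomaly (he0 1) (he1 1) (periLong z 1)
    (h := fun ζ => orbitX (semiAxis D Λ 1) (ecc Λ z 1) (periLong z 1 - nodeLong z) ζ *
      orbitY (semiAxis D Λ 1) (ecc Λ z 1) (periLong z 1 - nodeLong z) ζ /
      (semiAxis D Λ 1 * (1 - ecc Λ z 1 * cos ζ)) ^ 5)
    ((hXc.mul hYc).div c5 fun ζ => pow_ne_zero _ (hρ 1 ζ))
    (fun ζ => by simp only [hXp ζ, hYp ζ, cos_add_two_pi])).trans hquad.2
  have q3 := integral_comp_eccAnomaly (he0 1) (he1 1) (periLong z 1)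
    (h := fun ζ => 1 / (semiAxis D Λ 1 * (1 - ecc Λ z 1 * cos ζ)) ^ 3)
    (Continuous.div (by fun_prop) (by fun_prop) fun ζ => pow_ne_zero _ (hρ 1 ζ))
    (fun ζ => by simp)
  have q4 := (integral_comp_eccAnomaly (he0 0) (he1 0) (periLong z 0)
    (h := fun ζ => (semiAxis D Λ 0 * (1 - ecc Λ z 0 * cos ζ)) ^ 2) (by fun_prop)
    (fun ζ => by simp)).trans (integral_orbit_sq _ _)
  have q5 := (integral_comp_eccAnomaly (he0 0) (he1 0) (periLong z 0)
    (h := fun ζ => orbitY (semiAxis D Λ 0) (ecc Λ z 0) (periLong z 0 - nodeLong z) ζ ^ 2)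
    ((continuous_orbitY _ _ _).pow 2)
    (fun ζ => by simp only [periodic_orbitY _ _ _ ζ])).trans (integral_orbitY_sq (he0 0) (he1 0) _ _)
  -- The outer perihelion disappears here, since `q1` and `q2` say that both anisotropies have zero
  -- average.
  have hdouble := integral_integral_quadrupole (hX 0) (hY 0) (hX 1) (hY 1) hR (fun l => hρ 1 _)
    (fun l => orbitX_sq_add_orbitY_sq (he0 1) (he1 1) _ _ _) q1 q2
    (cos (incl Λ z 1 - incl Λ z 0))
  simp only [orbitX_sq_add_orbitY_sq (he0 0) (he1 0)] at hdouble hn0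
  simp only [hn0, norm_position h 1, inner_position] at hexp
  rw [q3, q4, q5] at hdouble
  have hout : outerMean D 3 Λ (tEcc z 1) = ∫ ζ in (0 : ℝ)..2 * π,
      1 / (semiAxis D Λ 1 * (1 - ecc Λ z 1 * cos ζ)) ^ 3 * (1 - ecc Λ z 1 * cos ζ) := by
    rw [ecc_eq]; rfl
  have hF : f12 2 D Λ z = 1 / 2 * (1 / (2 * π) ^ 2 * iteratedDeriv 2 (fun ε : ℝ =>
      ∫ l₁ in (0 : ℝ)..2 * π, ∫ l₂ in (0 : ℝ)..2 * π,
        1 / ‖ε • position D Λ z 0 l₁ - position D Λ z 1 l₂‖) 0) := by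
    have : doubleAverage D Λ z = fun ε => 1 / (2 * π) ^ 2 * ∫ l₁ in (0 : ℝ)..2 * π,
      ∫ l₂ in (0 : ℝ)..2 * π, 1 / ‖ε • position D Λ z 0 l₁ - position D Λ z 1 l₂‖ := rfl
    rw [f12, this, iteratedDeriv_const_mul_field]
    norm_num [Nat.factorial]
  rw [hF, hexp, hdouble, ← hout]
  have hL0 : 0 < Λ 0 := (h 0).1
  have g0 : 0 < Gam Λ z 0 := (h 0).2.1
  have g1 : 0 < Gam Λ z 1 := (h 1).2.1
  have e1 := eccOf_sq (tEcc_nonneg z 0) (h.tEcc_lt 0)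
  have e2 : 1 - cos (incl Λ z 1 - incl Λ z 0) ^ 2 =
      tInc z * (2 * Gam Λ z 0 - tInc z) * (2 * Gam Λ z 1 - tInc z) *
        (2 * Gam Λ z 0 + 2 * Gam Λ z 1 - tInc z) / (4 * Gam Λ z 0 ^ 2 * Gam Λ z 1 ^ 2) := by
    rw [cos_mutual_inclination h, Gtot]
    field_simp
    ring
  -- In the term e₁² (1 - k²) sin² g, the first factor contains t₁ and the second one t, so the
  -- angle occurs only in 4 t₁ t sin² g = Y².
  have e3 := sin_sq_periLong_sub_nodeLong z
  rw [e2, ecc_eq, e1, ← e3, Quadrupole.shape]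
  have hg0 : Λ 0 - tEcc z 0 = Gam Λ z 0 := rfl
  have hg1 : Λ 1 - tEcc z 1 = Gam Λ z 1 := rfl
  have ht : tEcc z 0 = Λ 0 - Gam Λ z 0 := by rw [← hg0]; ring
  rw [hg0, hg1, ht]
  have := pi_pos
  field_simp
  ring

end SpatialThreeBody

end SecularTerms

/-! ### Uniform bounds on the domain and the main theorem -/

section Assembly

open Filter Topology

namespace SpatialThreeBody

theorem norm_sq_eq_actions (z : Secular) :
    ‖z‖ ^ 2 = 2 * (tEcc z 0 + tInc z + tEcc z 1) := by
  rw [← toC3.norm_map, C3.norm_sq_eq_act, Fin.sum_univ_three, act_toC3_zero, act_toC3_one,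
    act_toC3_two]

/-- The point on the positive `η₁`, `η₂`, `p₁` axes with given actions. -/
noncomputable def pointOfActions (a b c : ℝ) : Secular :=
  WithLp.toLp 2 ![√(2 * a), √(2 * b), 0, 0, √(2 * c), 0]

theorem pointOfActions_spec {a b c : ℝ} (ha : 0 ≤ a) (hb : 0 ≤ b) (hc : 0 ≤ c) :
    tEcc (pointOfActions a b c) 0 = a ∧ tEcc (pointOfActions a b c) 1 = b ∧
      tInc (pointOfActions a b c) = c := by
  have h : ∀ {x : ℝ}, 0 ≤ x → (√2 * √x) ^ 2 / 2 = x := fun hx => by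
    rw [mul_pow, Real.sq_sqrt zero_le_two, Real.sq_sqrt hx]; ring
  refine ⟨?_, ?_, ?_⟩
  · simp [pointOfActions, tEcc, eta, xi, h ha]
  · simp [pointOfActions, tEcc, eta, xi, h hb]
  · simp [pointOfActions, tInc, pInc, qInc, h hc]

theorem RPSDomain.of_norm_sq_le {Λ : Fin 2 → ℝ} {z : Secular} {c : ℝ} (hΛ : ∀ i, c ≤ Λ i)
    (hz : ‖z‖ ^ 2 < c) : RPSDomain Λ z := by
  have h := norm_sq_eq_actions z
  have h0 := tEcc_nonneg z 0
  have h1 := tEcc_nonneg z 1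
  have h2 := tInc_nonneg z
  have hΛ0 := hΛ 0
  have hΛ1 := hΛ 1
  intro i
  fin_cases i
  · simp only [Gam, Fin.zero_eta]
    refine ⟨?_, ?_, ?_⟩ <;> linarith
  · simp only [Gam, Fin.mk_one]
    refine ⟨?_, ?_, ?_⟩ <;> linarith

/-- Both semi-major axes lie between `am` and `ap / α`, because α < 1 makes the outer one the
larger. The compact box away from zero is what gives a radius independent of Λ. -/
theorem exists_bounds_actionDomain (D : Masses) {am ap α : ℝ} (ham : 0 < am) (hα : 0 < α)
    (hα1 : α < 1) : ∃ lo hi : Fin 2 → ℝ, (∀ i, 0 < lo i) ∧ actionDomain D am ap α ⊆ Icc lo hi := by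
  have hM : ∀ i, 0 < D.M i := fun i => add_pos D.m0_pos (mul_pos D.μ_pos (D.mbar_pos i))
  have hm : ∀ i, 0 < D.m i := fun i => div_pos (mul_pos D.m0_pos (D.mbar_pos i)) (hM i)
  refine ⟨fun i => √(am * (D.M i * D.m i ^ 2)), fun i => √(ap / α * (D.M i * D.m i ^ 2)),
    fun i => Real.sqrt_pos.2 (mul_pos ham (mul_pos (hM i) (pow_pos (hm i) 2))), ?_⟩
  rintro Λ ⟨hΛ, h1, h2, h3⟩
  have hb : ∀ i, am < semiAxis D Λ i ∧ semiAxis D Λ i < ap / α := by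
    have p1 : 0 < semiAxis D Λ 1 := semiAxis_pos D (hΛ 1)
    have e1 : semiAxis D Λ 1 < ap / α := by rw [lt_div_iff₀ hα]; linarith
    have e2 : α * semiAxis D Λ 1 < semiAxis D Λ 1 := by nlinarith
    intro i
    fin_cases i
    · exact ⟨h1, h2.trans (e2.trans e1)⟩
    · exact ⟨h1.trans (h2.trans e2), e1⟩
  have hs : ∀ i, semiAxis D Λ i * (D.M i * D.m i ^ 2) = Λ i ^ 2 := fun i => by
    have := (hM i).ne'
    have := (hm i).ne'
    unfold semiAxis
    field_simp
  have hk : ∀ i, 0 ≤ D.M i * D.m i ^ 2 := fun i => (mul_pos (hM i) (pow_pos (hm i) 2)).le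
  constructor
  · intro i
    refine Real.sqrt_le_iff.2 ⟨(hΛ i).le, ?_⟩
    rw [← hs]
    exact mul_le_mul_of_nonneg_right (hb i).1.le (hk i)
  · intro i
    refine Real.le_sqrt_of_sq_le ?_
    rw [← hs]
    exact mul_le_mul_of_nonneg_right (hb i).2.le (hk i)

end SpatialThreeBody

end Assembly

theorem mainTheorem9 (D : Masses) :
    -- (i) dependence on `(η₂, ξ₂)` only through `(η₂² + ξ₂²) / 2`
    (∃ F₂ F : (Fin 2 → ℝ) → ℝ → ℝ → ℝ → ℝ → ℝ → ℝ, ∀ (Λ : Fin 2 → ℝ) (z : Secular),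
      RPSDomain Λ z →
        f12 2 D Λ z = F₂ Λ (eta z 0) (xi z 0) (pInc z) (qInc z) (tEcc z 1) ∧
        secularN D Λ z = F Λ (eta z 0) (xi z 0) (pInc z) (qInc z) (tEcc z 1)) ∧
    -- (ii) the symplectic change of variables
    (∀ am ap α : ℝ, 0 < am → am < ap → 0 < α → α < 1 →
      ∃ ε₀ : ℝ, 0 < ε₀ ∧
        (∀ Λ ∈ actionDomain D am ap α, ∀ z ∈ Metric.ball (0 : Secular) ε₀, RPSDomain Λ z) ∧
        ∃ (φ : (Fin 2 → ℝ) × Secular → (Fin 2 → ℝ)) (Z : (Fin 2 → ℝ) × Secular → Secular),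
          AnalyticOnNhd ℝ φ (actionDomain D am ap α ×ˢ Metric.ball (0 : Secular) ε₀) ∧
          AnalyticOnNhd ℝ Z (actionDomain D am ap α ×ˢ Metric.ball (0 : Secular) ε₀) ∧
          Set.BijOn (liftMap φ Z) (phaseSpace (actionDomain D am ap α) ε₀)
            (phaseSpace (actionDomain D am ap α) ε₀) ∧
          IsSymplecticOn (liftMap φ Z) (phaseSpace (actionDomain D am ap α) ε₀) ∧
          (∃ H₂ H : (Fin 2 → ℝ) → ℝ → ℝ → ℝ → ℝ,
            ∀ Λ ∈ actionDomain D am ap α, ∀ z ∈ Metric.ball (0 : Secular) ε₀,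
              f12 2 D Λ (Z (Λ, z)) = H₂ Λ (tEcc z 0) (tEcc z 1) (tInc z) ∧
              secularN D Λ (Z (Λ, z)) = H Λ (tEcc z 0) (tEcc z 1) (tInc z)) ∧
          ∀ Λ ∈ actionDomain D am ap α, ∀ z ∈ Metric.ball (0 : Secular) ε₀,
            tEcc (Z (Λ, z)) 1 = tEcc z 1 ∧
            tEcc (Z (Λ, z)) 0 + tInc (Z (Λ, z)) = tEcc z 0 + tInc z) := by
  constructor
  -- The last argument is the square of Y = Im ((e + i x) (p - i q)).
  · set F₂ : (Fin 2 → ℝ) → ℝ → ℝ → ℝ → ℝ → ℝ → ℝ := fun Λ e x p q t =>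
      semiAxis D Λ 0 ^ 2 / (8 * π) * outerMean D 3 Λ t *
        Quadrupole.shape (Λ 0) (Λ 1) ((e ^ 2 + x ^ 2) / 2) t ((p ^ 2 + q ^ 2) / 2)
          ((e * -q + x * p) ^ 2) with hF₂
    refine ⟨F₂, fun Λ e x p q t => -(D.mbar 0 * D.mbar 1) * (1 / (2 * π) * outerMean D 1 Λ t +
      F₂ Λ e x p q t), fun Λ z h => ?_⟩
    have h2 : f12 2 D Λ z = F₂ Λ (eta z 0) (xi z 0) (pInc z) (qInc z) (tEcc z 1) := f12_two_eq D h
    exact ⟨h2, by rw [secularN, h2, f12_zero_eq D h]⟩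
  · intro am ap α ham _ hα hα1
    obtain ⟨lo, hi, hlo, hA⟩ := exists_bounds_actionDomain D (ap := ap) ham hα hα1
    have hpos : ∀ Λ ∈ Icc lo hi, ∀ i, 0 < Λ i := fun Λ hΛ i => (hlo i).trans_le (hΛ.1 i)
    obtain ⟨Ω, ε, φ, Z, -, hCΩ, hε, hφ, hZ, hbij, hsymp, hpres, hdep⟩ :=
      exists_symplectic_change (isCompact_Icc (a := lo) (b := hi))
        (fun Λ hΛ => (Quadrupole.normalize_spec (hpos Λ hΛ)).1)
        Quadrupole.normalize_tor_dir01 Quadrupole.normalize_tor_dir2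
        (fun Λ hΛ => (Quadrupole.normalize_spec (hpos Λ hΛ)).2.mono fun q hq => hq.1)
    obtain ⟨Ω', ε', -, hCΩ', hε', hshape⟩ := exists_tube_of_eventually
      (isCompact_Icc (a := lo) (b := hi))
      (fun Λ hΛ => (Quadrupole.normalize_spec (hpos Λ hΛ)).2.mono fun q hq => hq.2)
    have hc : 0 < min (lo 0) (lo 1) := lt_min (hlo 0) (hlo 1)
    set A := actionDomain D am ap α
    have hε₀ : ∀ {z : Secular}, z ∈ Metric.ball (0 : Secular) (min ε (min ε' √(min (lo 0) (lo 1)))) →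
        z ∈ Metric.ball (0 : Secular) ε ∧ ‖z‖ < ε' ∧ ‖z‖ ^ 2 < min (lo 0) (lo 1) := by
      intro z hz
      rw [mem_ball_zero_iff, lt_min_iff, lt_min_iff] at hz
      refine ⟨mem_ball_zero_iff.2 hz.1, hz.2.1, ?_⟩
      have := hz.2.2
      rwa [Real.lt_sqrt (norm_nonneg _)] at this
    have hdom : ∀ Λ ∈ A, ∀ z : Secular, ‖z‖ ^ 2 < min (lo 0) (lo 1) → RPSDomain Λ z := by
      intro Λ hΛ z hz
      refine RPSDomain.of_norm_sq_le (fun i => ?_) hz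
      have := (hA hΛ).1 i
      fin_cases i
      · exact (min_le_left _ _).trans this
      · exact (min_le_right _ _).trans this
    have hAΩ : A ⊆ Ω := hA.trans hCΩ
    have hsub : A ×ˢ Metric.ball (0 : Secular) (min ε (min ε' √(min (lo 0) (lo 1)))) ⊆
        Ω ×ˢ Metric.ball (0 : Secular) ε :=
      prod_mono hAΩ (Metric.ball_subset_ball (min_le_left _ _))
    -- The three bounds serve the change of variables, the affine form of `shape`, and the domain of
    -- the coordinates; `Z` preserves the norm, so they also hold at its values.
    refine ⟨min ε (min ε' √(min (lo 0) (lo 1))), lt_min hε (lt_min hε' (Real.sqrt_pos.2 hc)),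
      fun Λ hΛ z hz => hdom Λ hΛ z (hε₀ hz).2.2, φ, Z, hφ.mono hsub, hZ.mono hsub,
      hbij A hAΩ _ (min_le_left _ _), ?_, ?_, fun Λ hΛ z hz => (hpres Λ (hAΩ hΛ) z (hε₀ hz).1).2⟩
    · intro p hp
      exact hsymp p (prod_mono hAΩ (prod_mono subset_rfl
        (Metric.ball_subset_ball (min_le_left _ _))) hp)
    -- The point z is replaced by a representative with the same actions, which by `hdep` gives the
    -- same first action of `normalize`.
    · set H₂ : (Fin 2 → ℝ) → ℝ → ℝ → ℝ → ℝ := fun Λ a b c =>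
        semiAxis D Λ 0 ^ 2 / (8 * π) * outerMean D 3 Λ b *
          (Quadrupole.base (Λ 0) (Λ 1 - b) (a + c) + Quadrupole.slope (Λ 0) (Λ 1 - b) (a + c) *
            C3.act (Quadrupole.normalize (Λ, toC3 (Z (Λ, pointOfActions a b c)))) 0) with hH₂
      refine ⟨H₂, fun Λ a b c => -(D.mbar 0 * D.mbar 1) * (1 / (2 * π) * outerMean D 1 Λ b +
        H₂ Λ a b c), fun Λ hΛ z hz => ?_⟩
      obtain ⟨hz1, hz2, hz3⟩ := hε₀ hz
      obtain ⟨hn, ht, hJ⟩ := hpres Λ (hAΩ hΛ) z hz1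
      have hR : RPSDomain Λ (Z (Λ, z)) := hdom Λ hΛ _ (by rwa [hn])
      obtain ⟨pa, pb, pc⟩ := pointOfActions_spec (tEcc_nonneg z 0) (tEcc_nonneg z 1) (tInc_nonneg z)
      have hpn : pointOfActions (tEcc z 0) (tEcc z 1) (tInc z) ∈ Metric.ball (0 : Secular) ε := by
        rw [mem_ball_zero_iff] at hz1 ⊢
        refine lt_of_eq_of_lt ?_ hz1
        rw [← sq_eq_sq₀ (norm_nonneg _) (norm_nonneg _), norm_sq_eq_actions, norm_sq_eq_actions,
          pa, pb, pc]
      have hact := hdep Λ (hAΩ hΛ) z hz1 _ hpn pa.symm pb.symm pc.symm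
      have hs := hshape (Λ, toC3 (Z (Λ, z))) ⟨hCΩ' (hA hΛ), by
        rw [mem_ball_zero_iff, toC3.norm_map, hn]; exact hz2⟩
      simp only [act_toC3_zero, act_toC3_one, act_toC3_two, hJ] at hs
      have h2 : f12 2 D Λ (Z (Λ, z)) = H₂ Λ (tEcc z 0) (tEcc z 1) (tInc z) := by
        rw [f12_two_eq D hR, hs, hact, ht]
      exact ⟨h2, by rw [secularN, h2, f12_zero_eq D hR, ht]⟩
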